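/- Let $n>2$, and for $z,w\in\mathbb C^n$ put $q(z)=\sum_i z_i^2$ and $h(z,w)=1-2\sum_i z_i\overline{w_i}+q(z)\overline{q(w)}$. Let $$\mathscr D=\{z\in\mathbb C^n : 1-2|z|^2+|q(z)|^2>0,\ |z|<1\},\qquad \mathscr X=\mathscr D\cap\mathbb R^n .$$ Let $SO(2,n)$ be the group of real matrices $g=\begin{pmatrix}A&B\\C&D\end{pmatrix}$ of determinant $1$ preserving the quadratic form $x_1^2+x_2^2-x_3^2-\dots-x_{n+2}^2$. It acts by $Z\mapsto (C+DZ)(A+BZ)^{-1}$ on the set of real $n\times2$ matrices $Z$ with $I_2-Z^tZ$ positive definite, and hence acts on $\mathscr D$ through the Hua bijection $$z\longmapsto Z=2\left(\begin{pmatrix} q(z)+1& i(q(z)-1)\\ \overline{q(z)}+1&-i(\overline{q(z)}-1)\end{pmatrix}^{-1}\begin{pmatrix} z\\ \bar z\end{pmatrix}\right)^{t}$$ from $\mathscr D$ onto this set, where $z$ and $\bar z$ are row vectors. Let $G=SO_0(2,n)$ be the identity component, $K$ the isotropy group of $0\in\mathscr D$ in $G$, $H$ the identity component of $\{g\in G: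 g(\mathscr X)\subseteq\mathscr X\}$, and $L=H\cap K$. Let $\nu\in\{0,\tfrac{n-2}{2}\}\cup(\tfrac{n-2}{2},\infty)$, and let $\mathscr H_\nu$ be the Hilbert space of functions on $\mathscr D$ with reproducing kernel $h(z,w)^{-\nu}$, where the power is the continuous branch on $\mathscr D\times\mathscr D$ that equals $1$ at $(0,0)$. (For these $\nu$ the kernel is positive semidefinite.) For $g\in G$ and a function $f$ on $\mathscr D$ put $$(\pi_\nu(g)f)(z)=J_{g^{-1}}(z)^{\nu/n}f(g^{-1}z),$$ where $J_g(z)$ is the complex Jacobian determinant at $z$ of the transformation $g$ of $\mathscr D$, and $J_{g}^{\nu/n}=\exp(\tfrac{\nu}{n}\log J_{g})$ with the continuous logarithm of $J_{g}$ on $\mathscr D$ that has the principal value at $0$. Then the constant function $1$ belongs to $\mathscr H_\nu$; the restriction of $\pi_\nu$ to $H$ is a strongly continuous unitary representation $\pi_\nu:H\to\mathscr U(\mathscr H_\nu)$; the function $1$ is $L$-invariant, i.e. $\pi_\nu(l)1=1$ for all $l\in L$; and $1$ is cyclic for this representation, i.e. the linear span of $\{\pi_\nu(h)1: h\in H\}$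 is dense in $\mathscr H_\nu$. -/

import Mathlib

open scoped ComplexConjugate

section Positivity
open Complex MeasureTheory
open scoped ComplexOrder Matrix

theorem posSemidef_rankOne {X : Type*} (f : X → ℂ) :
    (Matrix.of fun x y => f x * conj (f y) : Matrix X X ℂ).PosSemidef := by
  refine ⟨?_, fun c => ?_⟩
  · ext x y
    simp [Matrix.conjTranspose_apply, mul_comm]
  · have : (c.sum fun i xi => c.sum fun j xj =>
        star xi * (Matrix.of fun x y => f x * conj (f y) : Matrix X X ℂ) i j * xj)
        = star (c.sum fun j xj => conj (f j) * xj) * (c.sum fun j xj => conj (f j) * xj) := by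
      simp only [Finsupp.sum, Matrix.of_apply, star_sum, Finset.sum_mul_sum]
      refine Finset.sum_congr rfl fun i _ => Finset.sum_congr rfl fun j _ => ?_
      simp
      ring
    rw [this]
    exact star_mul_self_nonneg _

theorem posSemidef_integral {X T : Type*} [MeasurableSpace T] (μ : Measure T)
    (M : T → Matrix X X ℂ) (hM : ∀ᵐ t ∂μ, (M t).PosSemidef)
    (hint : ∀ x y, Integrable (fun t => M t x y) μ) :
    (Matrix.of fun x y => ∫ t, M t x y ∂μ : Matrix X X ℂ).PosSemidef := by
  refine ⟨?_, fun c => ?_⟩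
  · ext x y
    simp only [Matrix.conjTranspose_apply, Matrix.of_apply, RCLike.star_def]
    rw [← integral_conj]
    refine integral_congr_ae ?_
    filter_upwards [hM] with t ht
    exact ht.isHermitian.apply x y
  · have : (c.sum fun i xi => c.sum fun j xj =>
        star xi * (Matrix.of fun x y => ∫ t, M t x y ∂μ : Matrix X X ℂ) i j * xj)
        = ∫ t, (c.sum fun i xi => c.sum fun j xj => star xi * M t i j * xj) ∂μ := by
      simp only [Finsupp.sum, Matrix.of_apply]
      rw [integral_finsetSum]
      · refine Finset.sum_congr rfl fun i _ => ?_
        rw [integral_finsetSum]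
        · refine Finset.sum_congr rfl fun j _ => ?_
          rw [integral_mul_const, integral_const_mul]
        · exact fun j _ => ((hint i j).const_mul _).mul_const _
      · exact fun i _ => integrable_finsetSum _ fun j _ => ((hint i j).const_mul _).mul_const _
    rw [this]
    refine integral_nonneg_of_ae ?_
    filter_upwards [hM] with t ht
    exact ht.2 c

/-- The Gamma integral `∫_0^∞ t^(s-1) e^(-rt) dt` for a complex `r` with positive real part. -/
theorem gamma_integral_complex {s : ℝ} (hs : 0 < s) {r : ℂ} (hr : 0 < r.re) :
    Integrable (fun t : ℝ => ((t ^ (s - 1) : ℝ) : ℂ) * cexp (-(t * r)))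
      (volume.restrict (Set.Ioi 0)) ∧
    ∫ t in Set.Ioi (0 : ℝ), ((t ^ (s - 1) : ℝ) : ℂ) * cexp (-(t * r))
      = (Real.Gamma s : ℂ) * r ^ (-(s : ℂ)) := by
  have hintR : ∀ {ρ : ℝ}, 0 < ρ →
      IntegrableOn (fun t : ℝ => t ^ (s - 1) * Real.exp (-(t * ρ))) (Set.Ioi 0) := by
    intro ρ hρ
    have := integrableOn_rpow_mul_exp_neg_mul_rpow (s := s - 1) (p := 1) (b := ρ)
      (by linarith) one_pos hρ
    refine this.congr_fun (fun t _ => ?_) measurableSet_Ioi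
    simp [mul_comm]
  have hmeas : ∀ w : ℂ, AEStronglyMeasurable
      (fun t : ℝ => ((t ^ (s - 1) : ℝ) : ℂ) * cexp (-(t * w))) (volume.restrict (Set.Ioi 0)) := by
    intro w
    exact (by fun_prop : Measurable
      (fun t : ℝ => ((t ^ (s - 1) : ℝ) : ℂ) * cexp (-(t * w)))).aestronglyMeasurable
  have hintC : ∀ {w : ℂ}, 0 < w.re → Integrable
      (fun t : ℝ => ((t ^ (s - 1) : ℝ) : ℂ) * cexp (-(t * w))) (volume.restrict (Set.Ioi 0)) := by
    intro w hw
    refine Integrable.mono (hintR hw) (hmeas w) ?_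
    filter_upwards with t
    simp [Complex.norm_exp]
  refine ⟨hintC hr, ?_⟩
  set U : Set ℂ := {w | 0 < w.re} with hU
  have hUo : IsOpen U := isOpen_lt continuous_const continuous_re
  have hUc : IsPreconnected U := (convex_halfSpace_re_gt 0).isPreconnected
  set F : ℂ → ℂ := fun w => ∫ t in Set.Ioi (0 : ℝ), ((t ^ (s - 1) : ℝ) : ℂ) * cexp (-(t * w))
  have hF : DifferentiableOn ℂ F U := by
    intro w hw
    have hw' : 0 < w.re := hw
    refine DifferentiableAt.differentiableWithinAt ?_
    have hε : 0 < w.re / 2 := by linarith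
    have hs2 : IntegrableOn (fun t : ℝ => t ^ s * Real.exp (-(t * (w.re / 2)))) (Set.Ioi 0) := by
      have := integrableOn_rpow_mul_exp_neg_mul_rpow (s := s) (p := 1) (b := w.re / 2)
        (by linarith) one_pos hε
      refine this.congr_fun (fun t _ => ?_) measurableSet_Ioi
      simp [mul_comm]
    refine (hasDerivAt_integral_of_dominated_loc_of_deriv_le (s := Metric.ball w (w.re / 2))
      (F := fun (w : ℂ) (t : ℝ) => ((t ^ (s - 1) : ℝ) : ℂ) * cexp (-(t * w)))
      (F' := fun (w : ℂ) (t : ℝ) => ((t ^ (s - 1) : ℝ) : ℂ) * (cexp (-(t * w)) * (-t)))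
      (bound := fun t : ℝ => t ^ s * Real.exp (-(t * (w.re / 2))))
      (Metric.ball_mem_nhds _ hε) (Filter.Eventually.of_forall hmeas) (hintC hw') ?_ ?_ hs2
      ?_).2.differentiableAt
    · exact (by fun_prop : Measurable
        (fun t : ℝ => ((t ^ (s - 1) : ℝ) : ℂ) * (cexp (-(t * w)) * (-t)))).aestronglyMeasurable
    · refine (ae_restrict_iff' measurableSet_Ioi).2 (Filter.Eventually.of_forall ?_)
      intro t ht v hv
      have ht : 0 < t := ht
      have hv' : w.re / 2 ≤ v.re := by
        have h1 := (Complex.abs_re_le_norm (v - w)).trans (le_of_lt (by simpa [dist_eq_norm] using hv))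
        rw [abs_le] at h1
        simp at h1
        linarith [h1.1]
      have h2 : t ^ s = t ^ (s - 1) * t := by
        rw [Real.rpow_sub_one ht.ne']; field_simp
      rw [norm_mul, norm_mul, Complex.norm_exp, h2]
      simp only [norm_real, Real.norm_eq_abs, norm_neg, neg_re, re_ofReal_mul]
      rw [abs_of_pos (Real.rpow_pos_of_pos ht _), abs_of_pos ht]
      have : Real.exp (-(t * v.re)) ≤ Real.exp (-(t * (w.re / 2))) := by
        apply Real.exp_le_exp.2; nlinarith
      have h3 := Real.rpow_pos_of_pos ht (s - 1)
      calc _ = t ^ (s - 1) * t * Real.exp (-(t * v.re)) := by ring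
        _ ≤ _ := by gcongr
    · refine Filter.Eventually.of_forall ?_
      intro t v _
      have : HasDerivAt (fun w : ℂ => -((t : ℂ) * w)) (-(t : ℂ)) v := by
        have h0 := ((hasDerivAt_id v).const_mul (t : ℂ)).neg
        rw [mul_one] at h0
        exact h0
      exact (this.cexp).const_mul _
  have hG : DifferentiableOn ℂ (fun w : ℂ => (Real.Gamma s : ℂ) * w ^ (-(s : ℂ))) U := by
    intro w hw
    refine DifferentiableAt.differentiableWithinAt ?_
    refine DifferentiableAt.const_mul ?_ _
    exact (differentiableAt_id).cpow_const (Or.inl hw)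
  have key := (hF.analyticOnNhd hUo).eqOn_of_preconnected_of_frequently_eq
    (hG.analyticOnNhd hUo) hUc (z₀ := 1) (by simp [hU]) ?_
  · exact key hr
  · have hreal : ∀ ρ : ℝ, 0 < ρ → F ρ = (Real.Gamma s : ℂ) * (ρ : ℂ) ^ (-(s : ℂ)) := by
      intro ρ hρ
      have := integral_cpow_mul_exp_neg_mul_Ioi (a := s) (r := ρ) (by simpa using hs) hρ
      rw [one_div, Complex.inv_cpow _ _ (by simp [Complex.arg_ofReal_of_nonneg hρ.le, Real.pi_ne_zero.symm]),
        ← Complex.cpow_neg, mul_comm, Complex.Gamma_ofReal] at this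
      rw [← this]
      refine setIntegral_congr_fun measurableSet_Ioi fun t ht => ?_
      have ht : 0 < t := ht
      rw [Complex.ofReal_cpow ht.le]
      push_cast
      ring_nf
    have : Filter.Tendsto (fun k : ℕ => (((1 + 1 / ((k : ℝ) + 1) : ℝ)) : ℂ)) Filter.atTop
        (nhdsWithin 1 {1}ᶜ) := by
      rw [tendsto_nhdsWithin_iff]
      constructor
      · have := (tendsto_one_div_add_atTop_nhds_zero_nat (𝕜 := ℝ)).const_add 1
        rw [add_zero] at this
        exact_mod_cast (Complex.continuous_ofReal.tendsto 1).comp this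
      · refine Filter.Eventually.of_forall fun k => ?_
        simp only [Set.mem_compl_iff, Set.mem_singleton_iff]
        norm_cast
        have : (0 : ℝ) < 1 / ((k : ℝ) + 1) := by positivity
        intro h
        norm_num at h
        norm_cast at h
    refine this.frequently (Filter.Eventually.frequently (Filter.Eventually.of_forall fun k => ?_))
    exact hreal _ (by positivity)

theorem posSemidef_mul_cpow {X : Type*} (g k : X → X → ℂ) (hk : ∀ x y, 0 < (k x y).re)
    (h : ∀ a : ℝ, 0 < a → (Matrix.of fun x y => g x y * cexp (-(a * k x y))).PosSemidef)
    {s : ℝ} (hs : 0 < s) :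
    (Matrix.of fun x y => g x y * k x y ^ (-(s : ℂ))).PosSemidef := by
  have h1 := posSemidef_integral (volume.restrict (Set.Ioi (0 : ℝ)))
    (fun t => (t ^ (s - 1) : ℝ) • Matrix.of fun x y => g x y * cexp (-(t * k x y))) ?_ ?_
  · have h2 := h1.smul (a := (Real.Gamma s)⁻¹) (inv_nonneg.2 (Real.Gamma_pos_of_pos hs).le)
    convert h2 using 1
    ext x y
    have := (gamma_integral_complex hs (hk x y)).2
    simp only [Matrix.of_apply, Matrix.smul_apply, Complex.real_smul]
    have e : ∀ t : ℝ, ((t ^ (s - 1) : ℝ) : ℂ) * (g x y * cexp (-(t * k x y)))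
        = g x y * (((t ^ (s - 1) : ℝ) : ℂ) * cexp (-(t * k x y))) := fun t => by ring
    simp_rw [e]
    rw [integral_const_mul, this]
    have : (Real.Gamma s : ℂ) ≠ 0 := by exact_mod_cast (Real.Gamma_pos_of_pos hs).ne'
    push_cast
    field_simp
  · refine (ae_restrict_iff' measurableSet_Ioi).2 (Filter.Eventually.of_forall fun t ht => ?_)
    exact (h t ht).smul (Real.rpow_nonneg (le_of_lt ht) _)
  · intro x y
    have := (gamma_integral_complex hs (hk x y)).1.const_mul (g x y)
    refine this.congr (Filter.Eventually.of_forall fun t => ?_)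
    simp only [Matrix.of_apply, Matrix.smul_apply, Complex.real_smul]
    ring

theorem posSemidef_gaussian {X : Type*} (τ r : X → ℂ) (hτ : ∀ x, 0 < (τ x).re)
    {a : ℝ} (ha : 0 ≤ a) :
    (Matrix.of fun x y => (τ x + conj (τ y)) ^ (-(1 / 2 : ℂ)) *
      cexp (a * ((r x + conj (r y)) ^ 2 / (τ x + conj (τ y))))).PosSemidef := by
  have hre : ∀ x y, 0 < (τ x + conj (τ y)).re := fun x y => by
    simpa using add_pos (hτ x) (hτ y)
  have h1 := posSemidef_integral (volume : Measure ℝ)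
    (fun t => Matrix.of fun x y => cexp (-(τ x + conj (τ y)) * (t : ℂ) ^ 2
      + (2 * √a * (r x + conj (r y))) * t + 0)) ?_ ?_
  · have h2 := h1.smul (a := (√Real.pi)⁻¹) (inv_nonneg.2 (Real.sqrt_nonneg _))
    convert h2 using 1
    ext x y
    simp only [Matrix.of_apply, Matrix.smul_apply, Complex.real_smul]
    have hb : (-(τ x + conj (τ y))).re < 0 := by
      rw [neg_re]; linarith [hre x y]
    rw [integral_cexp_quadratic hb]
    have hne : τ x + conj (τ y) ≠ 0 := fun h0 => by
      have := hre x y; rw [h0] at this; simp at this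
    have hsq : ((√a : ℝ) : ℂ) ^ 2 = a := by norm_cast; exact Real.sq_sqrt ha
    have hpi : ((Real.pi : ℂ) / - -(τ x + conj (τ y))) ^ (1 / 2 : ℂ)
        = (√Real.pi : ℝ) * (τ x + conj (τ y)) ^ (-(1 / 2 : ℂ)) := by
      have hln : (τ x + conj (τ y)).arg ≠ Real.pi := fun h0 => by
        have := (Complex.arg_eq_pi_iff.1 h0).1
        linarith [hre x y]
      rw [neg_neg, div_eq_mul_inv, Complex.cpow_def_of_ne_zero (by simp [hne, Real.pi_ne_zero]),
        Complex.log_ofReal_mul Real.pi_pos (inv_ne_zero hne), Complex.log_inv _ hln,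
        Complex.cpow_def_of_ne_zero hne, Real.sqrt_eq_rpow, Real.rpow_def_of_pos Real.pi_pos,
        Complex.ofReal_exp, ← Complex.exp_add]
      congr 1
      push_cast
      ring
    rw [hpi]
    have hpi0 : ((√Real.pi : ℝ) : ℂ) ≠ 0 := by
      exact_mod_cast (Real.sqrt_pos.2 Real.pi_pos).ne'
    push_cast
    have e : (0 : ℂ) - (2 * ((√a : ℝ) : ℂ) * (r x + conj (r y))) ^ 2 / (4 * -(τ x + conj (τ y)))
        = a * ((r x + conj (r y)) ^ 2 / (τ x + conj (τ y))) := by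
      rw [← hsq]; field_simp; ring
    rw [e]
    field_simp
  · refine Filter.Eventually.of_forall fun t => ?_
    convert posSemidef_rankOne (fun x => cexp (-τ x * (t : ℂ) ^ 2 + 2 * √a * r x * t)) using 1
    ext x y
    simp only [Matrix.of_apply]
    rw [← Complex.exp_conj, ← Complex.exp_add]
    congr 1
    simp only [map_add, map_mul, map_neg, map_pow, conj_ofReal, map_ofNat]
    ring
  · intro x y
    have := integrable_cexp_quadratic (b := τ x + conj (τ y)) (hre x y)
      (2 * √a * (r x + conj (r y))) 0
    exact this
end Positivity

noncomputable section LieBall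
open Complex

/-- The complex quadratic form `q(z) = z z^t = z_1^2 + ⋯ + z_n^2` on `ℂ^n`. -/
def quadForm {n : ℕ} (z : EuclideanSpace ℂ (Fin n)) : ℂ := ∑ i, z i ^ 2

/-- The Lie ball `𝒟 = {z ∈ ℂ^n : 1 - 2⟨z,z⟩ + |z z^t|^2 > 0, |z| < 1}`. -/
def lieBall (n : ℕ) : Set (EuclideanSpace ℂ (Fin n)) :=
  {z | 0 < 1 - 2 * ‖z‖ ^ 2 + ‖quadForm z‖ ^ 2 ∧ ‖z‖ < 1}

/-- The polynomial `h(z,w) = 1 - 2⟨z,w⟩ + (z z^t) \overline{(w w^t)}`. -/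
def hPoly {n : ℕ} (z w : EuclideanSpace ℂ (Fin n)) : ℂ :=
  1 - 2 * ∑ i, z i * conj (w i) + quadForm z * conj (quadForm w)

/-- The set `{0, (n-2)/2} ∪ ((n-2)/2, ∞)`. -/
def wallachSet (n : ℕ) : Set ℝ :=
  {0, ((n : ℝ) - 2) / 2} ∪ Set.Ioi (((n : ℝ) - 2) / 2)

theorem norm_quadForm_le {n : ℕ} (z : EuclideanSpace ℂ (Fin n)) : ‖quadForm z‖ ≤ ‖z‖ ^ 2 := by
  rw [EuclideanSpace.norm_sq_eq]
  refine (norm_sum_le _ _).trans (le_of_eq ?_)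
  simp

theorem quadForm_smul {n : ℕ} (s : ℂ) (z : EuclideanSpace ℂ (Fin n)) :
    quadForm (s • z) = s ^ 2 * quadForm z := by
  simp [quadForm, Finset.mul_sum, mul_pow]

theorem continuous_quadForm {n : ℕ} : Continuous (quadForm (n := n)) := by
  unfold quadForm; fun_prop

theorem hPoly_self {n : ℕ} (z : EuclideanSpace ℂ (Fin n)) :
    hPoly z z = ((1 - 2 * ‖z‖ ^ 2 + ‖quadForm z‖ ^ 2 : ℝ) : ℂ) := by
  have : ∑ i, z i * conj (z i) = ((‖z‖ ^ 2 : ℝ) : ℂ) := by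
    rw [EuclideanSpace.norm_sq_eq]
    push_cast
    simp [Complex.mul_conj']
  rw [hPoly, this, Complex.mul_conj']
  push_cast
  ring

theorem smul_mem_lieBall {n : ℕ} {z : EuclideanSpace ℂ (Fin n)} (hz : z ∈ lieBall n) {s : ℂ}
    (hs : ‖s‖ ≤ 1) : s • z ∈ lieBall n := by
  obtain ⟨h1, h2⟩ := hz
  have hq := norm_quadForm_le z
  have hs0 := norm_nonneg s
  have hz0 := norm_nonneg z
  have hq0 := norm_nonneg (quadForm z)
  have hz2 : ‖z‖ ^ 2 < 1 := by nlinarith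
  have hs2 : ‖s‖ ^ 2 ≤ 1 := by nlinarith
  have hs20 : 0 ≤ ‖s‖ ^ 2 := by positivity
  refine ⟨?_, ?_⟩
  · rw [quadForm_smul, norm_smul, norm_mul, norm_pow]
    have e : 1 - 2 * (‖s‖ * ‖z‖) ^ 2 + (‖s‖ ^ 2 * ‖quadForm z‖) ^ 2
        = (1 - 2 * ‖z‖ ^ 2 + ‖quadForm z‖ ^ 2)
          + (1 - ‖s‖ ^ 2) * (2 * ‖z‖ ^ 2 - (1 + ‖s‖ ^ 2) * ‖quadForm z‖ ^ 2) := by ring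
    rw [e]
    have : ‖quadForm z‖ ^ 2 ≤ ‖z‖ ^ 2 := by nlinarith
    have : 0 ≤ 2 * ‖z‖ ^ 2 - (1 + ‖s‖ ^ 2) * ‖quadForm z‖ ^ 2 := by nlinarith [sq_nonneg ‖quadForm z‖]
    nlinarith
  · rw [norm_smul]; nlinarith

theorem norm_quadForm_lt_one {n : ℕ} {z : EuclideanSpace ℂ (Fin n)} (hz : z ∈ lieBall n) :
    ‖quadForm z‖ < 1 := by
  have := norm_quadForm_le z
  have := norm_nonneg z
  nlinarith [hz.2]

theorem zero_mem_lieBall (n : ℕ) : (0 : EuclideanSpace ℂ (Fin n)) ∈ lieBall n := by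
  simp [lieBall, quadForm]

/-- A quadratic polynomial with constant term `1` without zeros in the closed unit disc takes a
value in the slit plane at `1`. -/
theorem mem_slitPlane_of_quadratic (b c : ℂ)
    (h : ∀ s : ℂ, ‖s‖ ≤ 1 → 1 + b * s + c * s ^ 2 ≠ 0) : 1 + b + c ∈ slitPlane := by
  obtain ⟨d, hd⟩ := IsAlgClosed.exists_pow_nat_eq (b ^ 2 - 4 * c) two_pos
  have key : ∀ μ : ℂ, μ ^ 2 + b * μ + c = 0 → ‖μ‖ < 1 := by
    intro μ hμ
    by_contra! hle
    have hμ0 : μ ≠ 0 := fun h0 => by rw [h0] at hle; simp at hle; linarith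
    refine h μ⁻¹ (by rw [norm_inv]; exact inv_le_one_of_one_le₀ hle) ?_
    field_simp
    linear_combination hμ
  have h1 := key ((-b + d) / 2) (by linear_combination hd / 4)
  have h2 := key ((-b - d) / 2) (by linear_combination hd / 4)
  set μ := (-b + d) / 2
  set η := (-b - d) / 2
  have e : 1 + b + c = (1 - μ) * (1 - η) := by
    simp only [μ, η]; linear_combination hd / 4
  have r1 : 0 < (1 - μ).re := by
    have := (Complex.re_le_norm μ); simp; linarith
  have r2 : 0 < (1 - η).re := by
    have := (Complex.re_le_norm η); simp; linarith
  rw [e]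
  generalize 1 - μ = u at *
  generalize 1 - η = v at *
  rw [mem_slitPlane_iff]
  by_contra! hcon
  obtain ⟨c1, c2⟩ := hcon
  rw [mul_re] at c1
  rw [mul_im] at c2
  have e2 : v.re * (u.re ^ 2 + u.im ^ 2)
      = u.re * (u.re * v.re - u.im * v.im) + u.im * (u.re * v.im + u.im * v.re) := by ring
  rw [c2, mul_zero, add_zero] at e2
  have : u.re * (u.re * v.re - u.im * v.im) ≤ 0 := mul_nonpos_of_nonneg_of_nonpos r1.le c1
  nlinarith [mul_pos r2 (pow_pos r1 2), mul_nonneg r2.le (sq_nonneg u.im)]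

/-- The denominator of the Cayley transform with respect to the coordinate `k`. -/
def cayleyDen {n : ℕ} (k : Fin n) (z : EuclideanSpace ℂ (Fin n)) : ℂ := 1 - 2 * z k + quadForm z

theorem cayleyDen_ne_zero {n : ℕ} (k : Fin n) {z : EuclideanSpace ℂ (Fin n)} (hz : z ∈ lieBall n) :
    cayleyDen k z ≠ 0 := by
  intro h0
  have h1 := hz.1
  have hn : ‖z‖ ^ 2 = ‖z k‖ ^ 2 + ∑ i ∈ Finset.univ.erase k, ‖z i‖ ^ 2 := by
    rw [EuclideanSpace.norm_sq_eq, Finset.add_sum_erase _ (fun i => ‖z i‖ ^ 2) (Finset.mem_univ k)]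
  have hq : quadForm z = z k ^ 2 + ∑ i ∈ Finset.univ.erase k, z i ^ 2 := by
    rw [quadForm, Finset.add_sum_erase _ (fun i => z i ^ 2) (Finset.mem_univ k)]
  set S := ∑ i ∈ Finset.univ.erase k, ‖z i‖ ^ 2
  set s := ∑ i ∈ Finset.univ.erase k, z i ^ 2
  have hs : ‖s‖ ≤ S := by
    refine (norm_sum_le _ _).trans (le_of_eq ?_)
    simp [S]
  set v := z k - 1 with hv
  have hzk : z k = 1 + v := by rw [hv]; ring
  have hsv : s = - v ^ 2 := by
    rw [cayleyDen, hq, hzk] at h0; linear_combination h0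
  have hq' : quadForm z = 1 + 2 * v := by
    rw [cayleyDen, hzk] at h0; linear_combination h0
  have hS : ‖v‖ ^ 2 ≤ S := by rw [hsv] at hs; simpa using hs
  have n1 : ‖z k‖ ^ 2 = 1 + 2 * v.re + ‖v‖ ^ 2 := by
    rw [hzk, Complex.sq_norm, Complex.sq_norm, normSq_apply, normSq_apply]; simp; ring
  have n2 : ‖quadForm z‖ ^ 2 = 1 + 4 * v.re + 4 * ‖v‖ ^ 2 := by
    rw [hq', Complex.sq_norm, Complex.sq_norm, normSq_apply, normSq_apply]; simp; ring
  rw [hn, n1, n2] at h1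
  linarith

def cayleyS {n : ℕ} (k : Fin n) (z : EuclideanSpace ℂ (Fin n)) : ℂ :=
  (1 - quadForm z) / cayleyDen k z

def cayleyR {n : ℕ} (k j : Fin n) (z : EuclideanSpace ℂ (Fin n)) : ℂ :=
  2 * I * z j / cayleyDen k z

theorem four_mul_hPoly {n : ℕ} {k l : Fin n} (hkl : l ≠ k) {z w : EuclideanSpace ℂ (Fin n)}
    (hz : z ∈ lieBall n) (hw : w ∈ lieBall n) :
    4 * hPoly z w = cayleyDen k z * conj (cayleyDen k w) *
      (((cayleyS k z - cayleyR k l z) + conj (cayleyS k w - cayleyR k l w)) *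
        ((cayleyS k z + cayleyR k l z) + conj (cayleyS k w + cayleyR k l w)) -
        ∑ j ∈ (Finset.univ.erase k).erase l, (cayleyR k j z + conj (cayleyR k j w)) ^ 2) := by
  have hz0 := cayleyDen_ne_zero k hz
  have hw0 := cayleyDen_ne_zero k hw
  have hw0' : conj (cayleyDen k w) ≠ 0 := by simpa using hw0
  have split : ∀ f : Fin n → ℂ, ∑ i, f i = f k + (f l + ∑ i ∈ (Finset.univ.erase k).erase l, f i) := by
    intro f
    rw [Finset.add_sum_erase _ f (by simp [hkl]), Finset.add_sum_erase _ f (Finset.mem_univ k)]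
  have hS : ∑ j ∈ (Finset.univ.erase k).erase l, (cayleyR k j z + conj (cayleyR k j w)) ^ 2
      = -4 * ((∑ j ∈ (Finset.univ.erase k).erase l, z j ^ 2) / cayleyDen k z ^ 2
        + (conj (∑ j ∈ (Finset.univ.erase k).erase l, w j ^ 2)) / conj (cayleyDen k w) ^ 2
        - 2 * (∑ j ∈ (Finset.univ.erase k).erase l, z j * conj (w j))
          / (cayleyDen k z * conj (cayleyDen k w))) := by
    rw [map_sum, Finset.sum_div, Finset.sum_div, Finset.mul_sum, Finset.sum_div,
      ← Finset.sum_add_distrib, ← Finset.sum_sub_distrib, Finset.mul_sum]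
    refine Finset.sum_congr rfl fun j _ => ?_
    simp only [cayleyR, map_div₀, map_mul, conj_I, map_ofNat, map_pow]
    field_simp
    ring_nf
    simp only [I_sq]
    ring
  rw [hS, hPoly, split (fun i => z i * conj (w i))]
  have dz : cayleyDen k z = 1 - 2 * z k + quadForm z := rfl
  have dw : conj (cayleyDen k w) = 1 - 2 * conj (w k) + conj (quadForm w) := by
    simp only [cayleyDen, map_add, map_sub, map_mul, map_one, map_ofNat]
  have qz := split (fun i => z i ^ 2)
  have qw := congrArg conj (split (fun i => w i ^ 2))
  change quadForm z = _ at qz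
  change conj (quadForm w) = _ at qw
  simp only [map_add, map_pow] at qw
  simp only [cayleyS, cayleyR, map_div₀, map_mul, conj_I, map_ofNat, map_sub, map_one, map_add]
  have ez : ∑ j ∈ (Finset.univ.erase k).erase l, z j ^ 2 = quadForm z - z k ^ 2 - z l ^ 2 := by
    rw [qz]; ring
  have ew : conj (∑ j ∈ (Finset.univ.erase k).erase l, w j ^ 2)
      = conj (quadForm w) - conj (w k) ^ 2 - conj (w l) ^ 2 := by
    rw [qw]; ring
  rw [ez, ew]
  generalize conj (quadForm w) = Qw at *
  generalize conj (cayleyDen k w) = Dw at *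
  generalize quadForm z = Qz at *
  generalize cayleyDen k z = Dz at *
  generalize ∑ j ∈ (Finset.univ.erase k).erase l, z j * conj (w j) = T at *
  have e2 : I ^ 2 = -1 := I_sq
  field_simp
  ring_nf
  simp only [I_sq]
  subst dz dw
  ring


theorem cayley_re_mul_pos {n : ℕ} {k l : Fin n} (hkl : l ≠ k) {z : EuclideanSpace ℂ (Fin n)}
    (hz : z ∈ lieBall n) :
    ∑ j ∈ (Finset.univ.erase k).erase l, (cayleyR k j z).re ^ 2
      < (cayleyS k z - cayleyR k l z).re * (cayleyS k z + cayleyR k l z).re := by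
  have h := four_mul_hPoly hkl hz hz
  have hpos := hz.1
  rw [hPoly_self] at h
  simp only [Complex.add_conj, Complex.mul_conj] at h
  have hD : 0 < normSq (cayleyDen k z) := normSq_pos.2 (cayleyDen_ne_zero k hz)
  norm_cast at h
  have e : ∑ j ∈ (Finset.univ.erase k).erase l, (2 * (cayleyR k j z).re) ^ 2
      = 4 * ∑ j ∈ (Finset.univ.erase k).erase l, (cayleyR k j z).re ^ 2 := by
    rw [Finset.mul_sum]; exact Finset.sum_congr rfl fun j _ => by ring
  rw [e] at h
  have h2 : 0 < normSq (cayleyDen k z) * (2 * (cayleyS k z - cayleyR k l z).re *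
      (2 * (cayleyS k z + cayleyR k l z).re) -
        4 * ∑ j ∈ (Finset.univ.erase k).erase l, (cayleyR k j z).re ^ 2) := by
    rw [← h]; linarith
  have h3 := (pos_iff_pos_of_mul_pos h2).1 hD
  linarith

theorem continuousOn_cayleyDen_inv {n : ℕ} (k : Fin n) {z : EuclideanSpace ℂ (Fin n)}
    (hz : z ∈ lieBall n) :
    ContinuousOn (fun t : ℝ => (cayleyDen k ((t : ℂ) • z))⁻¹) (Set.Icc 0 1) := by
  have : Continuous fun t : ℝ => cayleyDen k ((t : ℂ) • z) := by
    have := continuous_quadForm (n := n)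
    unfold cayleyDen
    fun_prop
  refine this.continuousOn.inv₀ fun t ht => cayleyDen_ne_zero k (smul_mem_lieBall hz ?_)
  simpa [abs_of_nonneg ht.1] using ht.2

theorem smul_mem_lieBall_of_mem_Icc {n : ℕ} {z : EuclideanSpace ℂ (Fin n)}
    (hz : z ∈ lieBall n) {t : ℝ} (ht : t ∈ Set.Icc (0 : ℝ) 1) : (t : ℂ) • z ∈ lieBall n :=
  smul_mem_lieBall hz (by simpa [abs_of_nonneg ht.1] using ht.2)

theorem continuousOn_cayleyS {n : ℕ} (k : Fin n) {z : EuclideanSpace ℂ (Fin n)}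
    (hz : z ∈ lieBall n) :
    ContinuousOn (fun t : ℝ => cayleyS k ((t : ℂ) • z)) (Set.Icc 0 1) := by
  have h1 : Continuous fun t : ℝ => (1 - quadForm ((t : ℂ) • z)) := by
    have := continuous_quadForm (n := n)
    fun_prop
  exact (h1.continuousOn.mul (continuousOn_cayleyDen_inv k hz)).congr fun t _ => div_eq_mul_inv _ _

theorem continuousOn_cayleyR {n : ℕ} (k j : Fin n) {z : EuclideanSpace ℂ (Fin n)}
    (hz : z ∈ lieBall n) :
    ContinuousOn (fun t : ℝ => cayleyR k j ((t : ℂ) • z)) (Set.Icc 0 1) := by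
  have h1 : Continuous fun t : ℝ => 2 * I * ((t : ℂ) • z) j := by
    fun_prop
  exact (h1.continuousOn.mul (continuousOn_cayleyDen_inv k hz)).congr fun t _ => div_eq_mul_inv _ _

theorem pos_of_continuousOn_ne_zero {f : ℝ → ℝ} (hf : ContinuousOn f (Set.Icc 0 1))
    (h0 : 0 < f 0) (hne : ∀ t ∈ Set.Icc (0 : ℝ) 1, f t ≠ 0) : 0 < f 1 := by
  by_contra! hle
  obtain ⟨t, ht, htz⟩ := intermediate_value_Icc' zero_le_one hf ⟨hle, h0.le⟩
  exact hne t ht htz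

theorem cayley_re_pos {n : ℕ} {k l : Fin n} (hkl : l ≠ k) {z : EuclideanSpace ℂ (Fin n)}
    (hz : z ∈ lieBall n) :
    0 < (cayleyS k z - cayleyR k l z).re ∧ 0 < (cayleyS k z + cayleyR k l z).re := by
  have hm : ∀ t ∈ Set.Icc (0 : ℝ) 1, 0 < (cayleyS k ((t : ℂ) • z) - cayleyR k l ((t : ℂ) • z)).re
      * (cayleyS k ((t : ℂ) • z) + cayleyR k l ((t : ℂ) • z)).re := fun t ht =>
    lt_of_le_of_lt (Finset.sum_nonneg fun j _ => sq_nonneg _)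
      (cayley_re_mul_pos hkl (smul_mem_lieBall_of_mem_Icc hz ht))
  have hS := continuousOn_cayleyS k hz
  have hR := continuousOn_cayleyR k l hz
  constructor
  · have := pos_of_continuousOn_ne_zero
      (Complex.continuous_re.comp_continuousOn (hS.sub hR)) (by
        simp [cayleyS, cayleyR, cayleyDen, quadForm])
      (fun t ht h0 => (left_ne_zero_of_mul (hm t ht).ne') h0)
    simpa using this
  · have := pos_of_continuousOn_ne_zero
      (Complex.continuous_re.comp_continuousOn (hS.add hR)) (by
        simp [cayleyS, cayleyR, cayleyDen, quadForm])
      (fun t ht h0 => (right_ne_zero_of_mul (hm t ht).ne') h0)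
    simpa using this

theorem re_sq_div_le (w y : ℂ) (hy : 0 < y.re) : (w ^ 2 / y).re ≤ w.re ^ 2 / y.re := by
  have hN : 0 < normSq y := normSq_pos.2 fun h => by simp [h] at hy
  rw [Complex.div_re, ← add_div, div_le_div_iff₀ hN hy, normSq_apply]
  simp only [sq, mul_re, mul_im]
  nlinarith [sq_nonneg (w.im * y.re - w.re * y.im)]

theorem titu (a b p q : ℝ) (hp : 0 < p) (hq : 0 < q) :
    (a + b) ^ 2 / (p + q) ≤ a ^ 2 / p + b ^ 2 / q := by
  rw [div_add_div _ _ hp.ne' hq.ne', div_le_div_iff₀ (by positivity) (by positivity)]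
  nlinarith [sq_nonneg (a * q - b * p), mul_pos hp hq]

/-- The Schur complement that appears in the factorisation of `h`. -/
def cayleyY {n : ℕ} (k l : Fin n) (z w : EuclideanSpace ℂ (Fin n)) : ℂ :=
  ((cayleyS k z - cayleyR k l z) + conj (cayleyS k w - cayleyR k l w)) -
    ∑ j ∈ (Finset.univ.erase k).erase l, (cayleyR k j z + conj (cayleyR k j w)) ^ 2 /
      ((cayleyS k z + cayleyR k l z) + conj (cayleyS k w + cayleyR k l w))

def cayleyT {n : ℕ} (k l : Fin n) (z w : EuclideanSpace ℂ (Fin n)) : ℂ :=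
  (cayleyS k z + cayleyR k l z) + conj (cayleyS k w + cayleyR k l w)

theorem cayleyT_re_pos {n : ℕ} {k l : Fin n} (hkl : l ≠ k) {z w : EuclideanSpace ℂ (Fin n)}
    (hz : z ∈ lieBall n) (hw : w ∈ lieBall n) : 0 < (cayleyT k l z w).re := by
  rw [cayleyT, add_re (_ + _), conj_re]
  exact add_pos (cayley_re_pos hkl hz).2 (cayley_re_pos hkl hw).2

theorem cayleyY_re_pos {n : ℕ} {k l : Fin n} (hkl : l ≠ k) {z w : EuclideanSpace ℂ (Fin n)}
    (hz : z ∈ lieBall n) (hw : w ∈ lieBall n) : 0 < (cayleyY k l z w).re := by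
  have hz1 := cayley_re_pos hkl hz
  have hw1 := cayley_re_pos hkl hw
  have hz2 := cayley_re_mul_pos hkl hz
  have hw2 := cayley_re_mul_pos hkl hw
  have hT := cayleyT_re_pos hkl hz hw
  rw [← div_lt_iff₀ hz1.2, Finset.sum_div] at hz2
  rw [← div_lt_iff₀ hw1.2, Finset.sum_div] at hw2
  rw [cayleyY, sub_re, re_sum, add_re (_ - _), conj_re, sub_pos]
  refine lt_of_le_of_lt ?_ (add_lt_add hz2 hw2)
  rw [← Finset.sum_add_distrib]
  refine Finset.sum_le_sum fun j _ => ?_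
  refine (re_sq_div_le _ _ hT).trans ?_
  rw [cayleyT, add_re (_ + _), conj_re, add_re (cayleyR k j z), conj_re]
  exact titu _ _ _ _ hz1.2 hw1.2

theorem four_mul_hPoly' {n : ℕ} {k l : Fin n} (hkl : l ≠ k) {z w : EuclideanSpace ℂ (Fin n)}
    (hz : z ∈ lieBall n) (hw : w ∈ lieBall n) :
    4 * hPoly z w = cayleyDen k z * conj (cayleyDen k w) * (cayleyT k l z w * cayleyY k l z w) := by
  have hT : cayleyT k l z w ≠ 0 := fun h0 => by
    have := cayleyT_re_pos hkl hz hw; rw [h0] at this; simp at this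
  rw [four_mul_hPoly hkl hz hw, cayleyY, ← Finset.sum_div]
  congr 1
  change _ * cayleyT k l z w - _ = cayleyT k l z w * (_ - _ / cayleyT k l z w)
  field_simp

theorem hPoly_ne_zero {n : ℕ} (hn : 2 ≤ n) {z w : EuclideanSpace ℂ (Fin n)}
    (hz : z ∈ lieBall n) (hw : w ∈ lieBall n) : hPoly z w ≠ 0 := by
  have hkl : (⟨1, hn⟩ : Fin n) ≠ ⟨0, by omega⟩ := by simp
  have hT := cayleyT_re_pos hkl hz hw
  have hY := cayleyY_re_pos hkl hz hw
  intro h0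
  have h := four_mul_hPoly' hkl hz hw
  rw [h0, mul_zero] at h
  have h1 := cayleyDen_ne_zero ⟨0, by omega⟩ hz
  have h2 := cayleyDen_ne_zero ⟨0, by omega⟩ hw
  have h3 := h.symm
  simp only [mul_eq_zero, map_eq_zero, h1, h2, false_or] at h3
  rcases h3 with h3 | h3
  · rw [h3] at hT; simp at hT
  · rw [h3] at hY; simp at hY

/-- On the Lie ball `h(z,w)` avoids the non-positive real axis, so that the principal power of
`h(z,w)` is its continuous branch with value `1` at `(0,0)`. -/
theorem hPoly_mem_slitPlane {n : ℕ} (hn : 2 ≤ n) {z w : EuclideanSpace ℂ (Fin n)}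
    (hz : z ∈ lieBall n) (hw : w ∈ lieBall n) : hPoly z w ∈ slitPlane := by
  have := mem_slitPlane_of_quadratic (-(2 * ∑ i, z i * conj (w i)))
    (quadForm z * conj (quadForm w)) ?_
  · simpa only [hPoly, sub_eq_add_neg] using this
  · intro s hs
    have h := hPoly_ne_zero hn (smul_mem_lieBall hz hs) hw
    convert h using 1
    rw [hPoly, quadForm_smul]
    simp only [PiLp.smul_apply, smul_eq_mul, mul_assoc, ← Finset.mul_sum]
    ring

theorem cayleyDen_mem_slitPlane {n : ℕ} (k : Fin n) {z : EuclideanSpace ℂ (Fin n)}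
    (hz : z ∈ lieBall n) : cayleyDen k z ∈ slitPlane := by
  have := mem_slitPlane_of_quadratic (-(2 * z k)) (quadForm z) ?_
  · simpa only [cayleyDen, sub_eq_add_neg] using this
  · intro s hs
    have h := cayleyDen_ne_zero k (smul_mem_lieBall hz hs)
    convert h using 1
    rw [cayleyDen, quadForm_smul]
    simp only [PiLp.smul_apply, smul_eq_mul]
    ring

theorem mem_slitPlane_of_re_pos {y : ℂ} (h : 0 < y.re) : y ∈ slitPlane := Or.inl h

theorem conj_mem_slitPlane {y : ℂ} (h : y ∈ slitPlane) : conj y ∈ slitPlane := by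
  simpa [mem_slitPlane_iff] using h

theorem continuous_hPoly {n : ℕ} :
    Continuous fun p : EuclideanSpace ℂ (Fin n) × EuclideanSpace ℂ (Fin n) => hPoly p.1 p.2 := by
  have h := continuous_quadForm (n := n)
  unfold hPoly
  have h1 : Continuous fun p : EuclideanSpace ℂ (Fin n) × EuclideanSpace ℂ (Fin n) =>
      quadForm p.1 * conj (quadForm p.2) :=
    (h.comp continuous_fst).mul (Complex.continuous_conj.comp (h.comp continuous_snd))
  have h2 : Continuous fun p : EuclideanSpace ℂ (Fin n) × EuclideanSpace ℂ (Fin n) =>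
      ∑ i, p.1 i * conj (p.2 i) := by
    refine continuous_finsetSum _ fun i _ => Continuous.mul (by fun_prop) ?_
    exact Complex.continuous_conj.comp (by fun_prop)
  exact (continuous_const.sub (continuous_const.mul h2)).add h1

theorem log_hPoly {n : ℕ} {k l : Fin n} (hkl : l ≠ k) {z w : EuclideanSpace ℂ (Fin n)}
    (hz : z ∈ lieBall n) (hw : w ∈ lieBall n) :
    log (hPoly z w) = log (cayleyDen k z) + conj (log (cayleyDen k w)) +
      (log (cayleyT k l z w / 2) + log (cayleyY k l z w / 2)) := by
  have hn : 2 ≤ n := by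
    have h1 := k.2; have h2 := l.2
    have : (l : ℕ) ≠ k := fun h => hkl (Fin.ext h)
    omega
  set F : ℝ → ℂ := fun t => log (hPoly ((t : ℂ) • z) ((t : ℂ) • w)) -
    (log (cayleyDen k ((t : ℂ) • z)) + conj (log (cayleyDen k ((t : ℂ) • w))) +
      (log (cayleyT k l ((t : ℂ) • z) ((t : ℂ) • w) / 2)
        + log (cayleyY k l ((t : ℂ) • z) ((t : ℂ) • w) / 2))) with hFdef
  have hcS := continuousOn_cayleyS k hz
  have hcR := fun j => continuousOn_cayleyR k j hz
  have hcS' := continuousOn_cayleyS k hw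
  have hcR' := fun j => continuousOn_cayleyR k j hw
  have hconj : ∀ {f : ℝ → ℂ}, ContinuousOn f (Set.Icc 0 1) →
      ContinuousOn (fun t => conj (f t)) (Set.Icc 0 1) := fun hf =>
    Complex.continuous_conj.comp_continuousOn hf
  have hmz := fun t ht => smul_mem_lieBall_of_mem_Icc hz (t := t) ht
  have hmw := fun t ht => smul_mem_lieBall_of_mem_Icc hw (t := t) ht
  have hT0 : ∀ t ∈ Set.Icc (0 : ℝ) 1, 0 < (cayleyT k l ((t : ℂ) • z) ((t : ℂ) • w)).re :=
    fun t ht => cayleyT_re_pos hkl (hmz t ht) (hmw t ht)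
  have hY0 : ∀ t ∈ Set.Icc (0 : ℝ) 1, 0 < (cayleyY k l ((t : ℂ) • z) ((t : ℂ) • w)).re :=
    fun t ht => cayleyY_re_pos hkl (hmz t ht) (hmw t ht)
  have hcT : ContinuousOn (fun t : ℝ => cayleyT k l ((t : ℂ) • z) ((t : ℂ) • w)) (Set.Icc 0 1) :=
    (hcS.add (hcR l)).add (hconj (hcS'.add (hcR' l)))
  have hcY : ContinuousOn (fun t : ℝ => cayleyY k l ((t : ℂ) • z) ((t : ℂ) • w)) (Set.Icc 0 1) := by
    refine ((hcS.sub (hcR l)).add (hconj (hcS'.sub (hcR' l)))).sub ?_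
    refine continuousOn_finsetSum _ fun j _ => ?_
    refine (((hcR j).add (hconj (hcR' j))).pow 2).div hcT fun t ht h0 => ?_
    have := hT0 t ht
    change cayleyT k l _ _ = 0 at h0
    rw [h0] at this
    simp at this
  have hcD : ∀ v : EuclideanSpace ℂ (Fin n), Continuous fun t : ℝ => cayleyDen k ((t : ℂ) • v) := by
    intro v
    have := continuous_quadForm (n := n)
    unfold cayleyDen
    fun_prop
  have hhalf : ∀ y : ℂ, 0 < y.re → 0 < (y / 2).re := fun y hy => by
    have : (y / 2).re = y.re / 2 := by simp
    rw [this]; linarith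
  have hF : ContinuousOn F (Set.Icc 0 1) := by
    refine ContinuousOn.sub ?_ (ContinuousOn.add (ContinuousOn.add ?_ ?_) (ContinuousOn.add ?_ ?_))
    · refine ContinuousOn.clog ?_ fun t ht => hPoly_mem_slitPlane hn (hmz t ht) (hmw t ht)
      exact (continuous_hPoly.comp (by fun_prop : Continuous fun t : ℝ =>
        (((t : ℂ) • z, (t : ℂ) • w) : EuclideanSpace ℂ (Fin n) × EuclideanSpace ℂ (Fin n)))).continuousOn
    · exact (hcD z).continuousOn.clog fun t ht => cayleyDen_mem_slitPlane k (hmz t ht)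
    · exact hconj ((hcD w).continuousOn.clog fun t ht => cayleyDen_mem_slitPlane k (hmw t ht))
    · exact (hcT.div_const 2).clog fun t ht => mem_slitPlane_of_re_pos (hhalf _ (hT0 t ht))
    · exact (hcY.div_const 2).clog fun t ht => mem_slitPlane_of_re_pos (hhalf _ (hY0 t ht))
  have hexp : ∀ t ∈ Set.Icc (0 : ℝ) 1, cexp (F t) = 1 := by
    intro t ht
    have h1 := four_mul_hPoly' hkl (hmz t ht) (hmw t ht)
    have a1 := hPoly_ne_zero hn (hmz t ht) (hmw t ht)
    have a2 := cayleyDen_ne_zero k (hmz t ht)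
    have a3 := cayleyDen_ne_zero k (hmw t ht)
    have a4 := slitPlane_ne_zero (mem_slitPlane_of_re_pos (hhalf _ (hT0 t ht)))
    have a5 := slitPlane_ne_zero (mem_slitPlane_of_re_pos (hhalf _ (hY0 t ht)))
    rw [hFdef]
    simp only
    rw [Complex.exp_sub, Complex.exp_add, Complex.exp_add, Complex.exp_add, Complex.exp_conj,
      Complex.exp_log a1, Complex.exp_log a2, Complex.exp_log a3, Complex.exp_log a4,
      Complex.exp_log a5, div_eq_one_iff_eq (mul_ne_zero (mul_ne_zero a2 (by simpa using a3))
        (mul_ne_zero a4 a5))]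
    linear_combination h1 / 4
  have hF0 : F 0 = 0 := by
    simp [hFdef, hPoly, cayleyDen, cayleyT, cayleyY, cayleyS, cayleyR, quadForm]
  -- the imaginary part of `F` is a continuous function with values in `2πℤ`
  have hre : ∀ t ∈ Set.Icc (0 : ℝ) 1, (F t).re = 0 ∧ Real.cos ((F t).im) = 1 := by
    intro t ht
    have h1 := hexp t ht
    have h2 := congrArg norm h1
    rw [Complex.norm_exp, norm_one, Real.exp_eq_one_iff] at h2
    refine ⟨h2, ?_⟩
    have h3 := congrArg re h1
    rw [Complex.exp_re, h2] at h3
    simpa using h3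
  have him : (F 1).im = 0 := by
    by_contra hne
    have hc : ContinuousOn (fun t => |(F t).im|) (Set.Icc 0 1) :=
      (Complex.continuous_im.comp_continuousOn hF).abs
    have hpos : 0 < |(F 1).im| := abs_pos.2 hne
    obtain ⟨t, ht, hval⟩ := intermediate_value_Icc zero_le_one hc
      (show min (|(F 1).im|) Real.pi ∈ Set.Icc (|(F 0).im|) (|(F 1).im|) by
        rw [hF0]
        exact ⟨by simpa using Real.pi_pos.le, min_le_left _ _⟩)
    have h1 := (hre t ht).2
    rw [← Real.cos_abs] at h1
    simp only at hval
    rw [hval] at h1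
    have h2 : 0 < min (|(F 1).im|) Real.pi := lt_min hpos Real.pi_pos
    have h3 : min (|(F 1).im|) Real.pi ≤ Real.pi := min_le_right _ _
    have := (Real.cos_eq_one_iff_of_lt_of_lt (by linarith) (by linarith [Real.pi_pos])).1 h1
    linarith
  have hF1 : F 1 = 0 := Complex.ext (hre 1 (by simp)).1 him
  simpa [hFdef, sub_eq_zero] using hF1


/-- The kernel `K_ν(z,w) = h(z,w)^{-ν}` on `𝒟`, acting on `ℂ` by multiplication. The power is the
principal one, see `hPoly_mem_slitPlane`. -/
def lieBallKernel (n : ℕ) (ν : ℝ) : Matrix (lieBall n) (lieBall n) (ℂ →L[ℂ] ℂ) :=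
  Matrix.of fun z w => (hPoly (z : EuclideanSpace ℂ (Fin n)) w ^ (-(ν : ℂ))) •
    ContinuousLinearMap.id ℂ ℂ

section
open scoped ComplexOrder Matrix

theorem posSemidef_hadamard' {X : Type*} {f g : X → X → ℂ}
    (hf : (Matrix.of fun x y => f x y : Matrix X X ℂ).PosSemidef)
    (hg : (Matrix.of fun x y => g x y : Matrix X X ℂ).PosSemidef) :
    (Matrix.of fun x y => f x y * g x y : Matrix X X ℂ).PosSemidef :=
  Matrix.PosSemidef.hadamard hf hg

theorem posSemidef_hadamard_prod {X ι : Type*} (s : Finset ι) (M : ι → X → X → ℂ)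
    (h : ∀ i ∈ s, (Matrix.of (M i)).PosSemidef) :
    (Matrix.of fun x y => ∏ i ∈ s, M i x y : Matrix X X ℂ).PosSemidef := by
  classical
  induction s using Finset.induction_on with
  | empty => simpa using posSemidef_rankOne (fun _ : X => (1 : ℂ))
  | insert i s hi ih =>
    have := posSemidef_hadamard' (h i (by simp)) (ih fun j hj => h j (by simp [hj]))
    simpa only [Finset.prod_insert hi] using this

theorem posSemidef_hPoly_cpow {n : ℕ} (hn : 2 ≤ n) {ν : ℝ} (hν : ν ∈ wallachSet n) :
    (Matrix.of fun z w : lieBall n =>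
      hPoly (z : EuclideanSpace ℂ (Fin n)) w ^ (-(ν : ℂ))).PosSemidef := by
  have hn' : (2 : ℝ) ≤ n := by exact_mod_cast hn
  rcases eq_or_ne ν 0 with rfl | hν0
  · simpa using posSemidef_rankOne (fun _ : lieBall n => (1 : ℂ))
  have hge : ((n : ℝ) - 2) / 2 ≤ ν := by
    rcases hν with (h | h) | h
    · exact absurd h hν0
    · exact h.ge
    · exact le_of_lt h
  have hpos : 0 < ν := lt_of_le_of_ne (le_trans (by linarith) hge) hν0.symm
  set k : Fin n := ⟨0, by omega⟩ with hk
  set l : Fin n := ⟨1, hn⟩ with hl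
  have hkl : l ≠ k := by simp [hk, hl]
  have hTre : ∀ z w : lieBall n, 0 < (cayleyT k l (z : EuclideanSpace ℂ (Fin n)) w).re :=
    fun z w => cayleyT_re_pos hkl z.2 w.2
  have hYre : ∀ z w : lieBall n, 0 < (cayleyY k l (z : EuclideanSpace ℂ (Fin n)) w).re :=
    fun z w => cayleyY_re_pos hkl z.2 w.2
  have hTne : ∀ z w : lieBall n, cayleyT k l (z : EuclideanSpace ℂ (Fin n)) w ≠ 0 := fun z w =>
    slitPlane_ne_zero (mem_slitPlane_of_re_pos (hTre z w))
  -- the power of `T` that is left over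
  have h1 : (Matrix.of fun z w : lieBall n =>
      cayleyT k l (z : EuclideanSpace ℂ (Fin n)) w ^ (-((ν - ((n : ℝ) - 2) / 2 : ℝ) : ℂ))).PosSemidef := by
    rcases eq_or_lt_of_le hge with heq | hlt
    · rw [heq, sub_self]
      simpa using posSemidef_rankOne (fun _ : lieBall n => (1 : ℂ))
    · have := posSemidef_mul_cpow (fun _ _ : lieBall n => (1 : ℂ))
        (fun z w : lieBall n => cayleyT k l (z : EuclideanSpace ℂ (Fin n)) w) hTre ?_
        (sub_pos.2 hlt)
      · simpa using this
      · intro a _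
        convert posSemidef_rankOne (fun z : lieBall n =>
          cexp (-(a * (cayleyS k (z : EuclideanSpace ℂ (Fin n)) + cayleyR k l z)))) using 1
        ext z w
        simp only [Matrix.of_apply, one_mul, cayleyT]
        rw [← Complex.exp_conj, ← Complex.exp_add]
        congr 1
        simp only [map_add, map_mul, map_neg, conj_ofReal]
        ring
  have h2 : ∀ a : ℝ, 0 < a → (Matrix.of fun z w : lieBall n =>
      cayleyT k l (z : EuclideanSpace ℂ (Fin n)) w ^ (-(ν : ℂ)) *
        cexp (-(a * cayleyY k l (z : EuclideanSpace ℂ (Fin n)) w))).PosSemidef := by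
    intro a ha
    have g1 := posSemidef_hadamard_prod ((Finset.univ.erase k).erase l)
      (fun j (z w : lieBall n) => (cayleyT k l (z : EuclideanSpace ℂ (Fin n)) w) ^ (-(1 / 2 : ℂ)) *
        cexp (a * ((cayleyR k j (z : EuclideanSpace ℂ (Fin n)) + conj (cayleyR k j w)) ^ 2 /
          cayleyT k l (z : EuclideanSpace ℂ (Fin n)) w)))
      (fun j _ => posSemidef_gaussian
        (fun z : lieBall n => cayleyS k (z : EuclideanSpace ℂ (Fin n)) + cayleyR k l z)
        (fun z : lieBall n => cayleyR k j (z : EuclideanSpace ℂ (Fin n)))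
        (fun z => (cayley_re_pos hkl z.2).2) ha.le)
    have g2 := posSemidef_rankOne (fun z : lieBall n =>
      cexp (-(a * (cayleyS k (z : EuclideanSpace ℂ (Fin n)) - cayleyR k l z))))
    convert posSemidef_hadamard' (posSemidef_hadamard' h1 g1) g2 using 1
    ext z w
    simp only [Matrix.of_apply]
    have hcard : ((Finset.univ.erase k).erase l).card = n - 2 := by
      rw [Finset.card_erase_of_mem (by simp [hkl]), Finset.card_erase_of_mem (Finset.mem_univ k)]
      simp
      omega
    rw [Finset.prod_mul_distrib, Finset.prod_const, hcard, ← Complex.exp_sum, ← Complex.exp_conj]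
    have e1 : cayleyT k l (z : EuclideanSpace ℂ (Fin n)) w ^ (-(ν : ℂ))
        = cayleyT k l (z : EuclideanSpace ℂ (Fin n)) w ^ (-((ν - ((n : ℝ) - 2) / 2 : ℝ) : ℂ)) *
          (cayleyT k l (z : EuclideanSpace ℂ (Fin n)) w ^ (-(1 / 2 : ℂ))) ^ (n - 2) := by
      rw [← Complex.cpow_nat_mul, ← Complex.cpow_add _ _ (hTne z w)]
      congr 1
      rw [Nat.cast_sub hn]
      push_cast
      ring
    rw [e1, mul_assoc, mul_assoc, mul_assoc, ← Complex.exp_add, ← Complex.exp_add]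
    congr 3
    rw [cayleyY, ← Finset.mul_sum]
    simp only [map_add, map_mul, map_neg, map_sub, conj_ofReal, cayleyT]
    ring
  have h3 := posSemidef_mul_cpow _ _ hYre h2 hpos
  have h4 := posSemidef_rankOne (fun z : lieBall n =>
    cexp (-ν * log (cayleyDen k (z : EuclideanSpace ℂ (Fin n))) + ν * (Real.log 2 : ℝ)))
  convert posSemidef_hadamard' h3 h4 using 1
  ext z w
  have hhalf : ∀ y : ℂ, y ≠ 0 → log (y / 2) = log y - (Real.log 2 : ℝ) := fun y hy => by
    have := Complex.log_mul_ofReal (1 / 2) (by norm_num) y hy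
    rw [Real.log_div one_ne_zero two_ne_zero, Real.log_one] at this
    push_cast at this ⊢
    rw [div_eq_mul_one_div, this]
    ring
  have hYne := slitPlane_ne_zero (mem_slitPlane_of_re_pos (hYre z w))
  simp only [Matrix.of_apply]
  rw [Complex.cpow_def_of_ne_zero (hPoly_ne_zero hn z.2 w.2), log_hPoly hkl z.2 w.2,
    hhalf _ (hTne z w), hhalf _ hYne, Complex.cpow_def_of_ne_zero (hTne z w),
    Complex.cpow_def_of_ne_zero hYne, ← Complex.exp_conj, ← Complex.exp_add, ← Complex.exp_add,
    ← Complex.exp_add]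
  congr 1
  simp only [map_add, map_mul, map_neg, conj_ofReal]
  ring

theorem lieBallKernel_posSemidef {n : ℕ} (hn : 2 ≤ n) {ν : ℝ} (hν : ν ∈ wallachSet n) :
    (lieBallKernel n ν).PosSemidef := by
  have h := posSemidef_hPoly_cpow hn hν
  have hH : (lieBallKernel n ν).IsHermitian := by
    ext z w
    have h1 := h.isHermitian.apply z w
    simp only [Matrix.of_apply, RCLike.star_def] at h1
    have h2 : star (ContinuousLinearMap.id ℂ ℂ) = ContinuousLinearMap.id ℂ ℂ := star_one _
    simp [lieBallKernel, Matrix.conjTranspose_apply, ← h1, h2]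
  have T := (RKHS.posSemidef_tfae (K := lieBallKernel n ν)).out 0 2
  rw [T]
  refine ⟨hH, fun v => (Complex.nonneg_iff.1 (h.2 v)).1.trans (le_of_eq ?_)⟩
  refine congrArg Complex.re ?_
  refine Finset.sum_congr rfl fun z _ => Finset.sum_congr rfl fun w _ => ?_
  have h1 := h.isHermitian.apply z w
  simp only [Matrix.of_apply, RCLike.star_def] at h1
  simp only [Matrix.of_apply, lieBallKernel, ← h1]
  simp
  ring
end

end LieBall

noncomputable section Group
open Complex Matrix

/-- The Gram matrix of the form `(x|y) = x_1 y_1 + x_2 y_2 - x_3 y_3 - ⋯ - x_{n+2} y_{n+2}` on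
`ℝ^2 ⊕ ℝ^n`. -/
def formMatrix (n : ℕ) : Matrix (Fin 2 ⊕ Fin n) (Fin 2 ⊕ Fin n) ℝ := Matrix.fromBlocks 1 0 0 (-1)

/-- The group `SO(2,n)`. -/
def indefiniteSO (n : ℕ) : Subgroup (SpecialLinearGroup (Fin 2 ⊕ Fin n) ℝ) where
  carrier := {g | (g : Matrix _ _ ℝ)ᵀ * formMatrix n * (g : Matrix _ _ ℝ) = formMatrix n}
  one_mem' := by simp
  mul_mem' := by
    intro a b ha hb
    have ha : a.1ᵀ * formMatrix n * a.1 = formMatrix n := ha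
    have hb : b.1ᵀ * formMatrix n * b.1 = formMatrix n := hb
    change (a.1 * b.1)ᵀ * formMatrix n * (a.1 * b.1) = formMatrix n
    calc (a.1 * b.1)ᵀ * formMatrix n * (a.1 * b.1)
        = b.1ᵀ * (a.1ᵀ * formMatrix n * a.1) * b.1 := by
          simp only [transpose_mul, Matrix.mul_assoc]
      _ = _ := by rw [ha, hb]
  inv_mem' := by
    intro a ha
    have ha : a.1ᵀ * formMatrix n * a.1 = formMatrix n := ha
    change (a⁻¹).1ᵀ * formMatrix n * (a⁻¹).1 = formMatrix n
    have h1 : a.1 * (a⁻¹).1 = 1 := congrArg Subtype.val (mul_inv_cancel a)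
    have h2 := congrArg Matrix.transpose h1
    rw [transpose_mul, transpose_one] at h2
    calc (a⁻¹).1ᵀ * formMatrix n * (a⁻¹).1
        = (a⁻¹).1ᵀ * (a.1ᵀ * formMatrix n * a.1) * (a⁻¹).1 := by rw [ha]
      _ = ((a⁻¹).1ᵀ * a.1ᵀ) * formMatrix n * (a.1 * (a⁻¹).1) := by
        simp only [Matrix.mul_assoc]
      _ = formMatrix n := by rw [h1, h2, Matrix.one_mul, Matrix.mul_one]

/-- The matrix ball `M = {Z ∈ M_{n2}(ℝ) : Z^t Z < I_2}`. -/
def matrixBall (n : ℕ) : Set (Matrix (Fin n) (Fin 2) ℝ) := {Z | (1 - Zᵀ * Z).PosDef}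

/-- The fractional linear action `Z ↦ (C + D Z)(A + B Z)⁻¹` of a block matrix. -/
def moebius {n : ℕ} (g : Matrix (Fin 2 ⊕ Fin n) (Fin 2 ⊕ Fin n) ℝ) (Z : Matrix (Fin n) (Fin 2) ℝ) :
    Matrix (Fin n) (Fin 2) ℝ :=
  (g.toBlocks₂₁ + g.toBlocks₂₂ * Z) * (g.toBlocks₁₁ + g.toBlocks₁₂ * Z)⁻¹

theorem quad_eq {n : ℕ} (Z : Matrix (Fin n) (Fin 2) ℝ) (v : Fin 2 → ℝ) :
    v ⬝ᵥ ((1 - Zᵀ * Z) *ᵥ v) = v ⬝ᵥ v - (Z *ᵥ v) ⬝ᵥ (Z *ᵥ v) := by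
  rw [sub_mulVec, one_mulVec, dotProduct_sub, ← mulVec_mulVec, dotProduct_mulVec v Zᵀ,
    vecMul_transpose]

theorem mem_matrixBall_iff {n : ℕ} (Z : Matrix (Fin n) (Fin 2) ℝ) :
    Z ∈ matrixBall n ↔ ∀ v : Fin 2 → ℝ, v ≠ 0 → (Z *ᵥ v) ⬝ᵥ (Z *ᵥ v) < v ⬝ᵥ v := by
  constructor
  · intro h v hv
    have := Matrix.PosDef.dotProduct_mulVec_pos h hv
    rw [star_trivial, quad_eq] at this
    linarith
  · intro h
    refine Matrix.PosDef.of_dotProduct_mulVec_pos ?_ fun v hv => ?_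
    · rw [Matrix.IsHermitian, conjTranspose_eq_transpose_of_trivial]
      simp
    · rw [star_trivial, quad_eq]
      linarith [h v hv]

theorem mulVec_elim {n : ℕ} (g : Matrix (Fin 2 ⊕ Fin n) (Fin 2 ⊕ Fin n) ℝ)
    (Z : Matrix (Fin n) (Fin 2) ℝ) (v : Fin 2 → ℝ) :
    g *ᵥ (Sum.elim v (Z *ᵥ v)) = Sum.elim ((g.toBlocks₁₁ + g.toBlocks₁₂ * Z) *ᵥ v)
      ((g.toBlocks₂₁ + g.toBlocks₂₂ * Z) *ᵥ v) := by
  conv_lhs => rw [← fromBlocks_toBlocks g]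
  rw [fromBlocks_mulVec]
  simp [add_mulVec, mulVec_mulVec, Function.comp_def]

theorem form_elim {n : ℕ} (x : Fin 2 → ℝ) (y : Fin n → ℝ) :
    (Sum.elim x y) ⬝ᵥ (formMatrix n *ᵥ (Sum.elim x y)) = x ⬝ᵥ x - y ⬝ᵥ y := by
  rw [formMatrix, fromBlocks_mulVec]
  simp [Function.comp_def, neg_mulVec, sub_eq_add_neg]

theorem form_preserved {n : ℕ} {g : Matrix (Fin 2 ⊕ Fin n) (Fin 2 ⊕ Fin n) ℝ}
    (hg : gᵀ * formMatrix n * g = formMatrix n) (Z : Matrix (Fin n) (Fin 2) ℝ) (v : Fin 2 → ℝ) :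
    ((g.toBlocks₁₁ + g.toBlocks₁₂ * Z) *ᵥ v) ⬝ᵥ ((g.toBlocks₁₁ + g.toBlocks₁₂ * Z) *ᵥ v) -
      ((g.toBlocks₂₁ + g.toBlocks₂₂ * Z) *ᵥ v) ⬝ᵥ ((g.toBlocks₂₁ + g.toBlocks₂₂ * Z) *ᵥ v)
      = v ⬝ᵥ v - (Z *ᵥ v) ⬝ᵥ (Z *ᵥ v) := by
  rw [← form_elim, ← form_elim, ← mulVec_elim]
  conv_rhs => rw [← hg]
  rw [Matrix.mul_assoc, ← mulVec_mulVec, dotProduct_mulVec _ gᵀ, vecMul_transpose, mulVec_mulVec]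

theorem isUnit_moebius_den {n : ℕ} {g : Matrix (Fin 2 ⊕ Fin n) (Fin 2 ⊕ Fin n) ℝ}
    (hg : gᵀ * formMatrix n * g = formMatrix n) {Z : Matrix (Fin n) (Fin 2) ℝ}
    (hZ : Z ∈ matrixBall n) : IsUnit (g.toBlocks₁₁ + g.toBlocks₁₂ * Z) := by
  rw [← Matrix.mulVec_injective_iff_isUnit]
  refine (injective_iff_map_eq_zero (Matrix.mulVecLin (g.toBlocks₁₁ + g.toBlocks₁₂ * Z))).2 ?_
  intro v hv
  by_contra hne
  have h1 := form_preserved hg Z v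
  have h2 := (mem_matrixBall_iff Z).1 hZ v hne
  rw [mulVecLin_apply] at hv
  rw [hv, dotProduct_zero, zero_sub] at h1
  have h3 : 0 ≤ ((g.toBlocks₂₁ + g.toBlocks₂₂ * Z) *ᵥ v) ⬝ᵥ ((g.toBlocks₂₁ + g.toBlocks₂₂ * Z) *ᵥ v) :=
    Finset.sum_nonneg fun i _ => mul_self_nonneg _
  linarith

theorem moebius_mulVec {n : ℕ} {g : Matrix (Fin 2 ⊕ Fin n) (Fin 2 ⊕ Fin n) ℝ}
    (hg : gᵀ * formMatrix n * g = formMatrix n) {Z : Matrix (Fin n) (Fin 2) ℝ}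
    (hZ : Z ∈ matrixBall n) (w : Fin 2 → ℝ) :
    ∃ v, (g.toBlocks₁₁ + g.toBlocks₁₂ * Z) *ᵥ v = w ∧
      moebius g Z *ᵥ w = (g.toBlocks₂₁ + g.toBlocks₂₂ * Z) *ᵥ v := by
  refine ⟨(g.toBlocks₁₁ + g.toBlocks₁₂ * Z)⁻¹ *ᵥ w, ?_, ?_⟩
  · rw [mulVec_mulVec, Matrix.mul_nonsing_inv _
      ((Matrix.isUnit_iff_isUnit_det _).1 (isUnit_moebius_den hg hZ)), one_mulVec]
  · rw [mulVec_mulVec, moebius]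

theorem moebius_mem {n : ℕ} {g : Matrix (Fin 2 ⊕ Fin n) (Fin 2 ⊕ Fin n) ℝ}
    (hg : gᵀ * formMatrix n * g = formMatrix n) {Z : Matrix (Fin n) (Fin 2) ℝ}
    (hZ : Z ∈ matrixBall n) : moebius g Z ∈ matrixBall n := by
  rw [mem_matrixBall_iff]
  intro w hw
  obtain ⟨v, rfl, h⟩ := moebius_mulVec hg hZ w
  rw [h]
  have h1 := form_preserved hg Z v
  have h2 := (mem_matrixBall_iff Z).1 hZ v (fun h0 => hw (by rw [h0, mulVec_zero]))
  linarith

theorem moebius_mul {n : ℕ} (g : Matrix (Fin 2 ⊕ Fin n) (Fin 2 ⊕ Fin n) ℝ)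
    {g' : Matrix (Fin 2 ⊕ Fin n) (Fin 2 ⊕ Fin n) ℝ}
    (hg' : g'ᵀ * formMatrix n * g' = formMatrix n) {Z : Matrix (Fin n) (Fin 2) ℝ}
    (hZ : Z ∈ matrixBall n) : moebius (g * g') Z = moebius g (moebius g' Z) := by
  have hu := (Matrix.isUnit_iff_isUnit_det _).1 (isUnit_moebius_den hg' hZ)
  have e := fromBlocks_multiply g.toBlocks₁₁ g.toBlocks₁₂ g.toBlocks₂₁ g.toBlocks₂₂
    g'.toBlocks₁₁ g'.toBlocks₁₂ g'.toBlocks₂₁ g'.toBlocks₂₂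
  rw [fromBlocks_toBlocks, fromBlocks_toBlocks] at e
  rw [e]
  unfold moebius
  rw [toBlocks_fromBlocks₁₁, toBlocks_fromBlocks₁₂, toBlocks_fromBlocks₂₁, toBlocks_fromBlocks₂₂]
  generalize g'.toBlocks₁₁ = A' at *
  generalize g'.toBlocks₁₂ = B' at *
  generalize g'.toBlocks₂₁ = C' at *
  generalize g'.toBlocks₂₂ = D' at *
  generalize g.toBlocks₁₁ = A at *
  generalize g.toBlocks₁₂ = B at *
  generalize g.toBlocks₂₁ = C at *
  generalize g.toBlocks₂₂ = D at *
  have e1 : A * A' + B * C' + (A * B' + B * D') * Z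
      = (A + B * ((C' + D' * Z) * (A' + B' * Z)⁻¹)) * (A' + B' * Z) := by
    rw [Matrix.add_mul A, Matrix.mul_assoc B, Matrix.mul_assoc (C' + D' * Z),
      Matrix.nonsing_inv_mul _ hu, Matrix.mul_one]
    simp only [Matrix.mul_add, Matrix.add_mul, Matrix.mul_assoc]
    abel
  have e2 : C * A' + D * C' + (C * B' + D * D') * Z
      = (C + D * ((C' + D' * Z) * (A' + B' * Z)⁻¹)) * (A' + B' * Z) := by
    rw [Matrix.add_mul C, Matrix.mul_assoc D, Matrix.mul_assoc (C' + D' * Z),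
      Matrix.nonsing_inv_mul _ hu, Matrix.mul_one]
    simp only [Matrix.mul_add, Matrix.add_mul, Matrix.mul_assoc]
    abel
  rw [e1, e2, Matrix.mul_inv_rev, Matrix.mul_assoc, ← Matrix.mul_assoc (A' + B' * Z),
    Matrix.mul_nonsing_inv _ hu, Matrix.one_mul]

theorem moebius_one {n : ℕ} (Z : Matrix (Fin n) (Fin 2) ℝ) : moebius 1 Z = Z := by
  have e : (1 : Matrix (Fin 2 ⊕ Fin n) (Fin 2 ⊕ Fin n) ℝ) = fromBlocks 1 0 0 1 :=
    fromBlocks_one.symm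
  rw [moebius, e, toBlocks_fromBlocks₁₁, toBlocks_fromBlocks₁₂, toBlocks_fromBlocks₂₁,
    toBlocks_fromBlocks₂₂]
  simp

instance matrixBallAction (n : ℕ) : MulAction (indefiniteSO n) (matrixBall n) where
  smul g Z := ⟨moebius g.1.1 Z, moebius_mem g.2 Z.2⟩
  one_smul _ := Subtype.ext (moebius_one _)
  mul_smul _ g' Z := Subtype.ext (moebius_mul _ g'.2 Z.2)

/-- The Hua transform
`z ↦ Z = 2 ( [[zz^t+1, i(zz^t-1)], [conj(zz^t)+1, -i(conj(zz^t)-1)]]⁻¹ [z; conj z] )^t`.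
The entries of `Z` are real, see `hua_spec`, and are therefore read off by their real parts. -/
def hua {n : ℕ} (z : EuclideanSpace ℂ (Fin n)) : Matrix (Fin n) (Fin 2) ℝ :=
  ((2 : ℂ) • ((!![quadForm z + 1, I * (quadForm z - 1);
      conj (quadForm z) + 1, -I * (conj (quadForm z) - 1)])⁻¹ *
    (Matrix.of ![fun i => z i, fun i => conj (z i)] : Matrix (Fin 2) (Fin n) ℂ)))ᵀ.map re

theorem hua_complex {n : ℕ} {z : EuclideanSpace ℂ (Fin n)} (hz : z ∈ lieBall n) :
    ((2 : ℂ) • ((!![quadForm z + 1, I * (quadForm z - 1);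
      conj (quadForm z) + 1, -I * (conj (quadForm z) - 1)])⁻¹ *
    (Matrix.of ![fun i => z i, fun i => conj (z i)] : Matrix (Fin 2) (Fin n) ℂ)))ᵀ
    = Matrix.of fun k j => ((![2 * ((1 - conj (quadForm z)) * z k).re / (1 - ‖quadForm z‖ ^ 2),
        -2 * ((1 + conj (quadForm z)) * z k).im / (1 - ‖quadForm z‖ ^ 2)] j : ℝ) : ℂ) := by
  have hq := norm_quadForm_lt_one hz
  have hq0 := norm_nonneg (quadForm z)
  have hn : (1 - ‖quadForm z‖ ^ 2 : ℝ) ≠ 0 := by nlinarith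
  have hnC : ((1 - ‖quadForm z‖ ^ 2 : ℝ) : ℂ) ≠ 0 := by exact_mod_cast hn
  have hqq : quadForm z * conj (quadForm z) = 1 - ((1 - ‖quadForm z‖ ^ 2 : ℝ) : ℂ) := by
    rw [Complex.mul_conj']; push_cast; ring
  have hre : ∀ w : ℂ, ((w.re : ℝ) : ℂ) = (w + conj w) / 2 := fun w => by
    rw [Complex.add_conj]; push_cast; ring
  have him : ∀ w : ℂ, ((w.im : ℝ) : ℂ) = -I * (w - conj w) / 2 := fun w => by
    rw [Complex.sub_conj]; push_cast; linear_combination (w.im : ℂ) * I_sq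
  generalize (1 - ‖quadForm z‖ ^ 2 : ℝ) = N at *
  have hdet : (!![quadForm z + 1, I * (quadForm z - 1);
      conj (quadForm z) + 1, -I * (conj (quadForm z) - 1)] : Matrix (Fin 2) (Fin 2) ℂ).det
      = 2 * I * N := by
    rw [Matrix.det_fin_two_of]
    linear_combination (-2 * I) * hqq
  ext k j
  rw [Matrix.inv_def, hdet, Matrix.adjugate_fin_two_of, Ring.inverse_eq_inv']
  fin_cases j
  · simp [hre, him]
    field_simp
    ring_nf
    simp only [I_sq]
    ring
  · simp [hre, him]
    field_simp
    ring

theorem hua_zero {n : ℕ} {z : EuclideanSpace ℂ (Fin n)} (hz : z ∈ lieBall n) (k : Fin n) :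
    hua z k 0 = 2 * ((1 - conj (quadForm z)) * z k).re / (1 - ‖quadForm z‖ ^ 2) := by
  rw [hua, hua_complex hz]
  simp only [Matrix.map_apply, Matrix.of_apply, ofReal_re, cons_val_zero]

theorem hua_one {n : ℕ} {z : EuclideanSpace ℂ (Fin n)} (hz : z ∈ lieBall n) (k : Fin n) :
    hua z k 1 = -2 * ((1 + conj (quadForm z)) * z k).im / (1 - ‖quadForm z‖ ^ 2) := by
  rw [hua, hua_complex hz]
  simp only [Matrix.map_apply, Matrix.of_apply, ofReal_re, cons_val_one, cons_val_zero]

theorem hua_spec {n : ℕ} {z : EuclideanSpace ℂ (Fin n)} (hz : z ∈ lieBall n) (k : Fin n) :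
    z k = (1 + quadForm z) / 2 * hua z k 0 + I * (quadForm z - 1) / 2 * hua z k 1 := by
  have hq := norm_quadForm_lt_one hz
  have hq0 := norm_nonneg (quadForm z)
  have hn : (1 - ‖quadForm z‖ ^ 2 : ℝ) ≠ 0 := by nlinarith
  rw [hua_zero hz, hua_one hz]
  have hqq : ‖quadForm z‖ ^ 2 = (quadForm z).re * (quadForm z).re
      + (quadForm z).im * (quadForm z).im := by
    rw [Complex.sq_norm, normSq_apply]
  have e : ∀ a b : ℝ, (1 + quadForm z) / 2 * ((2 * a / (1 - ‖quadForm z‖ ^ 2) : ℝ) : ℂ)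
      + I * (quadForm z - 1) / 2 * ((-2 * b / (1 - ‖quadForm z‖ ^ 2) : ℝ) : ℂ)
      = ((1 + quadForm z) * a - I * (quadForm z - 1) * b) / ((1 - ‖quadForm z‖ ^ 2 : ℝ) : ℂ) := by
    intro a b
    push_cast
    ring
  rw [e, eq_div_iff (Complex.ofReal_ne_zero.2 hn)]
  rw [hqq]
  generalize quadForm z = q
  generalize z k = w
  apply Complex.ext
  · simp
    ring
  · simp
    ring

theorem hua_unique {n : ℕ} {z : EuclideanSpace ℂ (Fin n)} (hz : z ∈ lieBall n)
    {Z : Matrix (Fin n) (Fin 2) ℝ}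
    (h : ∀ k, z k = (1 + quadForm z) / 2 * Z k 0 + I * (quadForm z - 1) / 2 * Z k 1) :
    hua z = Z := by
  have hq := norm_quadForm_lt_one hz
  have hq0 := norm_nonneg (quadForm z)
  have hn : (1 - ‖quadForm z‖ ^ 2 : ℝ) ≠ 0 := by nlinarith
  rw [Complex.sq_norm, normSq_apply] at hn
  have key : ∀ k, hua z k 0 = Z k 0 ∧ hua z k 1 = Z k 1 := by
    intro k
    have h1 := (hua_spec hz k).symm.trans (h k)
    have hr := congrArg re h1
    have hi := congrArg im h1
    simp at hr hi
    generalize (quadForm z).re = a at *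
    generalize (quadForm z).im = b at *
    constructor
    · apply mul_left_cancel₀ hn
      linear_combination -2 * (a - 1) * hr - 2 * b * hi
    · apply mul_left_cancel₀ hn
      linear_combination -2 * (1 + a) * hi + 2 * b * hr
  ext k j
  fin_cases j
  · exact (key k).1
  · exact (key k).2

/-- `z = Z a` with `a = a(q)` splits into real and imaginary part. -/
theorem sum_sq_lin {n : ℕ} (Z : Matrix (Fin n) (Fin 2) ℝ) (a b : ℂ) :
    ∑ k, (a * Z k 0 + b * Z k 1) ^ 2 = a ^ 2 * ((∑ k, Z k 0 ^ 2 : ℝ) : ℂ)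
      + 2 * a * b * ((∑ k, Z k 0 * Z k 1 : ℝ) : ℂ) + b ^ 2 * ((∑ k, Z k 1 ^ 2 : ℝ) : ℂ) := by
  push_cast
  rw [Finset.mul_sum, Finset.mul_sum, Finset.mul_sum, ← Finset.sum_add_distrib,
    ← Finset.sum_add_distrib]
  exact Finset.sum_congr rfl fun k _ => by ring

theorem sum_norm_lin {n : ℕ} (Z : Matrix (Fin n) (Fin 2) ℝ) (a b : ℂ) :
    ∑ k, ‖a * Z k 0 + b * Z k 1‖ ^ 2
      = (Z *ᵥ ![a.re, b.re]) ⬝ᵥ (Z *ᵥ ![a.re, b.re]) + (Z *ᵥ ![a.im, b.im]) ⬝ᵥ (Z *ᵥ ![a.im, b.im]) := by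
  simp only [dotProduct, mulVec, Fin.sum_univ_two]
  rw [← Finset.sum_add_distrib]
  refine Finset.sum_congr rfl fun k _ => ?_
  rw [Complex.sq_norm, normSq_apply]
  simp
  ring

/-- The quadratic equation satisfied by `q(z)` in terms of `Z`. -/
def huaC {n : ℕ} (Z : Matrix (Fin n) (Fin 2) ℝ) : ℂ :=
  (((1 - ∑ k, Z k 0 ^ 2) - (1 - ∑ k, Z k 1 ^ 2) : ℝ) : ℂ) / 4 - I * ((∑ k, Z k 0 * Z k 1 : ℝ) : ℂ) / 2

def huaT {n : ℕ} (Z : Matrix (Fin n) (Fin 2) ℝ) : ℝ :=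
  ((1 - ∑ k, Z k 0 ^ 2) + (1 - ∑ k, Z k 1 ^ 2)) / 2

theorem huaQuadratic_iff {n : ℕ} (Z : Matrix (Fin n) (Fin 2) ℝ) (q : ℂ) :
    huaC Z * q ^ 2 + huaT Z * q + conj (huaC Z) = 0 ↔
      ∑ k, ((1 + q) / 2 * Z k 0 + I * (q - 1) / 2 * Z k 1) ^ 2 = q := by
  have hc : conj (huaC Z) = (((1 - ∑ k, Z k 0 ^ 2) - (1 - ∑ k, Z k 1 ^ 2) : ℝ) : ℂ) / 4
      + I * ((∑ k, Z k 0 * Z k 1 : ℝ) : ℂ) / 2 := by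
    simp only [huaC, map_sub, map_div₀, map_mul, conj_ofReal, conj_I, map_ofNat]
    ring
  rw [sum_sq_lin, hc, huaC, huaT]
  generalize ∑ k, Z k 0 ^ 2 = X
  generalize ∑ k, Z k 1 ^ 2 = Y
  generalize ∑ k, Z k 0 * Z k 1 = P
  push_cast
  have e2 : I ^ 2 = -1 := I_sq
  constructor
  · intro h
    linear_combination -h + (q - 1) ^ 2 / 4 * Y * e2
  · intro h
    linear_combination -h + (q - 1) ^ 2 / 4 * Y * e2

theorem huaT_pos {n : ℕ} {Z : Matrix (Fin n) (Fin 2) ℝ} (hZ : Z ∈ matrixBall n) :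
    0 < 1 - ∑ k, Z k 0 ^ 2 ∧ 0 < 1 - ∑ k, Z k 1 ^ 2 ∧
      (∑ k, Z k 0 * Z k 1) ^ 2 < (1 - ∑ k, Z k 0 ^ 2) * (1 - ∑ k, Z k 1 ^ 2) := by
  have h := (mem_matrixBall_iff Z).1 hZ
  have key : ∀ a b : ℝ, (Z *ᵥ ![a, b]) ⬝ᵥ (Z *ᵥ ![a, b]) = a ^ 2 * (∑ k, Z k 0 ^ 2)
      + 2 * a * b * (∑ k, Z k 0 * Z k 1) + b ^ 2 * (∑ k, Z k 1 ^ 2) := by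
    intro a b
    rw [Finset.mul_sum, Finset.mul_sum, Finset.mul_sum, ← Finset.sum_add_distrib,
      ← Finset.sum_add_distrib]
    refine Finset.sum_congr rfl fun k _ => ?_
    simp [mulVec, dotProduct, Fin.sum_univ_two]
    ring
  have key2 : ∀ a b : ℝ, (![a, b] : Fin 2 → ℝ) ⬝ᵥ ![a, b] = a ^ 2 + b ^ 2 := by
    intro a b
    simp [dotProduct, Fin.sum_univ_two]
    ring
  have h0 := h ![1, 0] (by intro h; simpa using congrFun h 0)
  have h1 := h ![0, 1] (by intro h; simpa using congrFun h 1)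
  rw [key, key2] at h0 h1
  generalize ∑ k, Z k 0 ^ 2 = X at *
  generalize ∑ k, Z k 1 ^ 2 = Y at *
  generalize ∑ k, Z k 0 * Z k 1 = P at *
  have hX : 0 < 1 - X := by linarith
  have hY : 0 < 1 - Y := by linarith
  refine ⟨hX, hY, ?_⟩
  have h2 := h ![1 - Y, P] (by intro h; have := congrFun h 0; simp at this; linarith)
  rw [key, key2] at h2
  have : 0 < (1 - Y) * ((1 - X) * (1 - Y) - P ^ 2) := by nlinarith
  have := (pos_iff_pos_of_mul_pos this).1 hY
  linarith

theorem two_norm_huaC_lt {n : ℕ} {Z : Matrix (Fin n) (Fin 2) ℝ} (hZ : Z ∈ matrixBall n) :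
    4 * ‖huaC Z‖ ^ 2 < huaT Z ^ 2 ∧ 0 < huaT Z := by
  obtain ⟨h1, h2, h3⟩ := huaT_pos hZ
  have : ‖huaC Z‖ ^ 2 = (((1 - ∑ k, Z k 0 ^ 2) - (1 - ∑ k, Z k 1 ^ 2)) / 4) ^ 2
      + ((∑ k, Z k 0 * Z k 1) / 2) ^ 2 := by
    rw [Complex.sq_norm, normSq_apply, huaC]
    generalize ∑ k, Z k 0 ^ 2 = X
    generalize ∑ k, Z k 1 ^ 2 = Y
    generalize ∑ k, Z k 0 * Z k 1 = P
    simp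
    ring
  rw [this, huaT]
  constructor
  · nlinarith
  · linarith

theorem hua_root_unique {n : ℕ} {Z : Matrix (Fin n) (Fin 2) ℝ} (hZ : Z ∈ matrixBall n) {q q' : ℂ}
    (hq : ‖q‖ < 1) (hq' : ‖q'‖ < 1) (h : huaC Z * q ^ 2 + huaT Z * q + conj (huaC Z) = 0)
    (h' : huaC Z * q' ^ 2 + huaT Z * q' + conj (huaC Z) = 0) : q = q' := by
  by_contra hne
  have hsub : q - q' ≠ 0 := sub_ne_zero.2 hne
  have h1 : huaC Z * (q + q') + huaT Z = 0 := by
    apply mul_left_cancel₀ hsub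
    linear_combination h - h'
  have h2 : conj (huaC Z) = huaC Z * (q * q') := by
    linear_combination h - q * h1
  have h3 := congrArg norm h2
  rw [norm_mul, norm_mul, Complex.norm_conj] at h3
  have hq0 := norm_nonneg q
  have hq0' := norm_nonneg q'
  have h4 : ‖q‖ * ‖q'‖ < 1 := by nlinarith
  have h5 : ‖huaC Z‖ = 0 := by nlinarith [norm_nonneg (huaC Z)]
  rw [norm_eq_zero] at h5
  rw [h5, zero_mul, zero_add] at h1
  have := (two_norm_huaC_lt hZ).2
  norm_cast at h1
  linarith

theorem exists_hua_root {n : ℕ} {Z : Matrix (Fin n) (Fin 2) ℝ} (hZ : Z ∈ matrixBall n) :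
    ∃ q : ℂ, ‖q‖ < 1 ∧ huaC Z * q ^ 2 + huaT Z * q + conj (huaC Z) = 0 := by
  obtain ⟨h1, h2⟩ := two_norm_huaC_lt hZ
  set c := huaC Z
  set t := huaT Z
  set s := √(t ^ 2 - 4 * ‖c‖ ^ 2)
  have hs : s ^ 2 = t ^ 2 - 4 * ‖c‖ ^ 2 := Real.sq_sqrt (by linarith)
  have hs0 : 0 < s := Real.sqrt_pos.2 (by linarith)
  have hr : 0 < t + s := by linarith
  have hcc : (c : ℂ) * conj c = ((t ^ 2 - s ^ 2 : ℝ) : ℂ) / 4 := by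
    rw [Complex.mul_conj', hs]; push_cast; ring
  have hrC : (t : ℂ) + s ≠ 0 := by exact_mod_cast hr.ne'
  refine ⟨-2 * conj c / (t + s), ?_, ?_⟩
  · have : ‖(t : ℂ) + s‖ = t + s := by
      rw [← ofReal_add, norm_real, Real.norm_of_nonneg hr.le]
    rw [norm_div, norm_mul, Complex.norm_conj, this, div_lt_one hr]
    simp
    have := norm_nonneg c
    nlinarith
  · field_simp
    push_cast at hcc
    linear_combination 4 * conj c * hcc

theorem hua_mem {n : ℕ} {z : EuclideanSpace ℂ (Fin n)} (hz : z ∈ lieBall n) :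
    hua z ∈ matrixBall n := by
  rw [mem_matrixBall_iff]
  intro v hv
  have hspec := hua_spec hz
  have hq := norm_quadForm_lt_one hz
  have hq0 := norm_nonneg (quadForm z)
  have hpos := hz.1
  have hqdef : ∑ k, z k ^ 2 = quadForm z := rfl
  have hqq : ‖quadForm z‖ ^ 2 = (quadForm z).re * (quadForm z).re
      + (quadForm z).im * (quadForm z).im := by
    rw [Complex.sq_norm, normSq_apply]
  rw [EuclideanSpace.norm_sq_eq] at hpos
  generalize hua z = Z at *
  generalize quadForm z = q at *
  set a : ℂ := (1 + q) / 2 with ha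
  set b : ℂ := I * (q - 1) / 2 with hb
  have hab : a ^ 2 + b ^ 2 = q := by
    rw [ha, hb]; linear_combination ((q - 1) ^ 2 / 4) * I_sq
  have hab2 : 2 * (‖a‖ ^ 2 + ‖b‖ ^ 2) = 1 + ‖q‖ ^ 2 := by
    rw [hqq, Complex.sq_norm, Complex.sq_norm, normSq_apply, normSq_apply, ha, hb]
    simp
    ring
  have hD : a * conj b - conj a * b = I * (((1 - ‖q‖ ^ 2) / 2 : ℝ) : ℂ) := by
    have hcq : q * conj q = ((‖q‖ ^ 2 : ℝ) : ℂ) := by rw [Complex.mul_conj']; push_cast; ring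
    rw [ha, hb]
    simp only [map_div₀, map_add, map_mul, map_sub, map_one, conj_I, map_ofNat]
    push_cast at hcq ⊢
    linear_combination (-I / 2) * hcq
  have hspec : ∀ k, z k = a * Z k 0 + b * Z k 1 := hspec
  clear_value a b
  have hD0 : a * conj b - conj a * b ≠ 0 := by
    rw [hD]
    refine mul_ne_zero I_ne_zero (Complex.ofReal_ne_zero.2 ?_)
    nlinarith
  have hD0' : conj a * b - a * conj b ≠ 0 := fun h => hD0 (by linear_combination -h)
  set α : ℂ := (v 0 * conj b - v 1 * conj a) / (a * conj b - conj a * b) with hα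
  have hαc : conj α = (v 0 * b - v 1 * a) / (conj a * b - a * conj b) := by
    rw [hα]
    simp only [map_div₀, map_sub, map_mul, conj_ofReal, conj_conj]
  have hv0 : v 0 = 2 * (α * a).re := by
    have : ((v 0 : ℝ) : ℂ) = ((2 * (α * a).re : ℝ) : ℂ) := by
      rw [← Complex.add_conj, map_mul, hαc, hα]
      have e : conj a * b - a * conj b = -(a * conj b - conj a * b) := by ring
      rw [e, div_neg, neg_mul, div_mul_eq_mul_div, div_mul_eq_mul_div, ← sub_eq_add_neg, ← sub_div,
        eq_div_iff hD0]
      ring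
    exact_mod_cast this
  have hv1 : v 1 = 2 * (α * b).re := by
    have : ((v 1 : ℝ) : ℂ) = ((2 * (α * b).re : ℝ) : ℂ) := by
      rw [← Complex.add_conj, map_mul, hαc, hα]
      have e : conj a * b - a * conj b = -(a * conj b - conj a * b) := by ring
      rw [e, div_neg, neg_mul, div_mul_eq_mul_div, div_mul_eq_mul_div, ← sub_eq_add_neg, ← sub_div,
        eq_div_iff hD0]
      ring
    exact_mod_cast this
  have hα0 : 0 < ‖α‖ ^ 2 := by
    have : α ≠ 0 := fun h0 => hv (by
      ext j
      fin_cases j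
      · simpa [h0] using hv0
      · simpa [h0] using hv1)
    positivity
  have hre2 : ∀ x : ℂ, (2 * x.re) * (2 * x.re) = 2 * ‖x‖ ^ 2 + 2 * (x ^ 2).re := by
    intro x
    rw [Complex.sq_norm, normSq_apply, sq x, mul_re]
    ring
  have h1 : v ⬝ᵥ v = ‖α‖ ^ 2 * (1 + ‖q‖ ^ 2) + 2 * (α ^ 2 * q).re := by
    rw [← hab2, ← hab]
    simp only [dotProduct, Fin.sum_univ_two]
    rw [hv0, hv1, hre2, hre2, mul_add (α ^ 2), add_re, norm_mul, norm_mul, mul_pow, mul_pow,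
      mul_pow, mul_pow]
    ring
  have hZv : ∀ k, (Z *ᵥ v) k = 2 * (α * z k).re := by
    intro k
    have : α * z k = (α * a) * (Z k 0 : ℝ) + (α * b) * (Z k 1 : ℝ) := by
      rw [hspec k]; ring
    rw [this, add_re, re_mul_ofReal, re_mul_ofReal]
    simp only [mulVec, dotProduct, Fin.sum_univ_two]
    rw [hv0, hv1]
    ring
  have h2 : (Z *ᵥ v) ⬝ᵥ (Z *ᵥ v) = 2 * ‖α‖ ^ 2 * (∑ k, ‖z k‖ ^ 2) + 2 * (α ^ 2 * q).re := by
    rw [← hqdef, Finset.mul_sum, Finset.mul_sum, re_sum, Finset.mul_sum, ← Finset.sum_add_distrib]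
    refine Finset.sum_congr rfl fun k _ => ?_
    rw [hZv k, hre2, norm_mul, mul_pow, mul_pow]
    ring
  rw [h1, h2]
  nlinarith

theorem hua_injOn {n : ℕ} : Set.InjOn (hua (n := n)) (lieBall n) := by
  intro z hz w hw h
  have hroot : ∀ {y : EuclideanSpace ℂ (Fin n)}, y ∈ lieBall n →
      huaC (hua y) * quadForm y ^ 2 + huaT (hua y) * quadForm y + conj (huaC (hua y)) = 0 := by
    intro y hy
    rw [huaQuadratic_iff]
    exact Finset.sum_congr rfl fun k _ => by rw [← hua_spec hy k]
  have hq : quadForm z = quadForm w :=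
    hua_root_unique (hua_mem hz) (norm_quadForm_lt_one hz) (norm_quadForm_lt_one hw) (hroot hz)
      (by rw [h]; exact hroot hw)
  ext k
  refine (hua_spec hz k).trans ((?_ : _ = _).trans (hua_spec hw k).symm)
  rw [h, hq]

theorem exists_hua_eq {n : ℕ} {Z : Matrix (Fin n) (Fin 2) ℝ} (hZ : Z ∈ matrixBall n) :
    ∃ z ∈ lieBall n, hua z = Z := by
  obtain ⟨q, hq, hroot⟩ := exists_hua_root hZ
  rw [huaQuadratic_iff] at hroot
  set z : EuclideanSpace ℂ (Fin n) :=
    WithLp.toLp 2 fun k => (1 + q) / 2 * Z k 0 + I * (q - 1) / 2 * Z k 1 with hz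
  have hzq : quadForm z = q := hroot
  have hnorm : 2 * ‖z‖ ^ 2 < 1 + ‖q‖ ^ 2 := by
    have h1 := (mem_matrixBall_iff Z).1 hZ
    have h2 : ‖z‖ ^ 2 = _ := (EuclideanSpace.norm_sq_eq z).trans
      (sum_norm_lin Z ((1 + q) / 2) (I * (q - 1) / 2))
    have hle : ∀ v : Fin 2 → ℝ, (Z *ᵥ v) ⬝ᵥ (Z *ᵥ v) ≤ v ⬝ᵥ v := fun v => by
      by_cases hv : v = 0
      · simp [hv]
      · exact (h1 v hv).le
    have hu := h1 ![((1 + q) / 2).re, (I * (q - 1) / 2).re] ?_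
    · have hv := hle ![((1 + q) / 2).im, (I * (q - 1) / 2).im]
      rw [h2]
      have hqq : ‖q‖ ^ 2 = q.re * q.re + q.im * q.im := by
        rw [Complex.sq_norm, normSq_apply]
      rw [hqq]
      simp [dotProduct, Fin.sum_univ_two] at hu hv ⊢
      nlinarith
    · intro h0
      have := congrFun h0 0
      simp at this
      have h3 := Complex.abs_re_le_norm q
      rw [abs_le] at h3
      linarith [h3.1]
  have hz0 := norm_nonneg z
  have hq0 := norm_nonneg q
  have hmem : z ∈ lieBall n := by
    refine ⟨?_, ?_⟩
    · rw [hzq]; linarith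
    · nlinarith
  refine ⟨z, hmem, hua_unique hmem fun k => ?_⟩
  rw [hzq]

/-- The Hua transform as a bijection of `𝒟` onto `M`. -/
def huaEquiv (n : ℕ) : lieBall n ≃ matrixBall n :=
  Equiv.ofBijective (fun z => ⟨hua z, hua_mem z.2⟩)
    ⟨fun z w h => Subtype.ext (hua_injOn z.2 w.2 (congrArg Subtype.val h)), fun Z => by
      obtain ⟨z, hz, h⟩ := exists_hua_eq Z.2
      exact ⟨⟨z, hz⟩, Subtype.ext h⟩⟩

/-- The action of `SO(2,n)` on `𝒟`, transported from `M` by the Hua transform. -/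
instance lieBallAction (n : ℕ) : MulAction (indefiniteSO n) (lieBall n) where
  smul g z := (huaEquiv n).symm (g • huaEquiv n z)
  one_smul z := by
    change (huaEquiv n).symm ((1 : indefiniteSO n) • huaEquiv n z) = z
    rw [one_smul, Equiv.symm_apply_apply]
  mul_smul g g' z := by
    change (huaEquiv n).symm ((g * g') • huaEquiv n z)
      = (huaEquiv n).symm (g • huaEquiv n ((huaEquiv n).symm (g' • huaEquiv n z)))
    rw [Equiv.apply_symm_apply, mul_smul]

theorem huaEquiv_smul {n : ℕ} (g : indefiniteSO n) (z : lieBall n) :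
    huaEquiv n (g • z) = g • huaEquiv n z :=
  (huaEquiv n).apply_symm_apply _

/-- The real part `𝒳 = 𝒟 ∩ ℝ^n` of the Lie ball. -/
def lieBallReal (n : ℕ) : Set (lieBall n) := {z | ∀ i, ((z : EuclideanSpace ℂ (Fin n)) i).im = 0}

theorem mem_lieBallReal_iff {n : ℕ} (z : lieBall n) :
    z ∈ lieBallReal n ↔ ∀ k, (huaEquiv n z : Matrix (Fin n) (Fin 2) ℝ) k 1 = 0 := by
  change _ ↔ ∀ k, hua (z : EuclideanSpace ℂ (Fin n)) k 1 = 0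
  constructor
  · intro h k
    have hq : (quadForm (z : EuclideanSpace ℂ (Fin n))).im = 0 := by
      rw [quadForm, im_sum]
      refine Finset.sum_eq_zero fun i _ => ?_
      rw [sq, mul_im, h i]
      ring
    rw [hua_one z.2, mul_im]
    simp [hq, h k]
  · intro h
    set Z := hua (z : EuclideanSpace ℂ (Fin n)) with hZ
    have hroot : huaC Z * quadForm (z : EuclideanSpace ℂ (Fin n)) ^ 2
        + huaT Z * quadForm (z : EuclideanSpace ℂ (Fin n)) + conj (huaC Z) = 0 := by
      rw [huaQuadratic_iff]
      exact Finset.sum_congr rfl fun k _ => by rw [← hua_spec z.2 k]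
    have hc : conj (huaC Z) = huaC Z := by
      simp [huaC, h, map_ofNat]
    have hroot' := congrArg conj hroot
    simp only [map_add, map_mul, map_pow, hc, conj_ofReal, map_zero] at hroot'
    rw [← hc] at hroot'
    have hq := hua_root_unique (hua_mem z.2) (norm_quadForm_lt_one z.2)
      (by rw [Complex.norm_conj]; exact norm_quadForm_lt_one z.2) hroot
      (by rw [hc] at hroot' ⊢; exact hroot')
    have hq' : (quadForm (z : EuclideanSpace ℂ (Fin n))).im = 0 :=
      Complex.conj_eq_iff_im.1 hq.symm
    intro k
    rw [hua_spec z.2 k, ← hZ, h k]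
    simp [hq']

/-- If `g` maps `𝒳` into itself, then so does `g⁻¹`. -/
theorem inv_preserves_lieBallReal {n : ℕ} {g : indefiniteSO n}
    (hg : ∀ x ∈ lieBallReal n, g • x ∈ lieBallReal n) : ∀ x ∈ lieBallReal n, g⁻¹ • x ∈ lieBallReal n := by
  rcases Nat.eq_zero_or_pos n with rfl | hn
  · intro x _ i
    exact i.elim0
  -- the common isotropic direction `e_2`
  set E : Fin 2 ⊕ Fin n → ℝ := Sum.elim ![0, 1] 0 with hE
  have hinv : g⁻¹.1.1 * g.1.1 = 1 := congrArg (fun a : indefiniteSO n => a.1.1) (inv_mul_cancel g)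
  have step : ∀ Z : matrixBall n, (∀ k, Z.1 k 1 = 0) →
      ∃ u : Fin 2 → ℝ, Sum.elim u (Z.1 *ᵥ u) = g⁻¹.1.1 *ᵥ E := by
    intro Z hZ
    have h1 : (huaEquiv n).symm Z ∈ lieBallReal n := by
      rw [mem_lieBallReal_iff, Equiv.apply_symm_apply]; exact hZ
    have h2 := (mem_lieBallReal_iff _).1 (hg _ h1)
    rw [huaEquiv_smul, Equiv.apply_symm_apply] at h2
    obtain ⟨u, hu1, hu2⟩ := moebius_mulVec g.2 Z.2 ![0, 1]
    refine ⟨u, ?_⟩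
    have h3 : moebius g.1.1 Z.1 *ᵥ ![0, 1] = 0 := by
      ext k
      have : moebius g.1.1 Z.1 k 1 = 0 := h2 k
      simp [mulVec, dotProduct, Fin.sum_univ_two, this]
    rw [h3] at hu2
    have h4 : g.1.1 *ᵥ (Sum.elim u (Z.1 *ᵥ u)) = E := by
      rw [mulVec_elim, hu1, ← hu2]
    rw [← h4, mulVec_mulVec, hinv, one_mulVec]
  have hmem : ∀ t : ℝ, |t| < 1 → (Matrix.of fun (k : Fin n) (j : Fin 2) =>
      if k = ⟨0, hn⟩ ∧ j = 0 then t else 0) ∈ matrixBall n := by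
    intro t ht
    rw [mem_matrixBall_iff]
    intro v hv
    have e : ∀ k : Fin n, ((Matrix.of fun (k : Fin n) (j : Fin 2) =>
      if k = ⟨0, hn⟩ ∧ j = 0 then t else 0) *ᵥ v) k = if k = ⟨0, hn⟩ then t * v 0 else 0 := by
      intro k
      by_cases hk : k = ⟨0, hn⟩ <;> simp [mulVec, dotProduct, Fin.sum_univ_two, hk]
    have e2 : ((Matrix.of fun (k : Fin n) (j : Fin 2) =>
      if k = ⟨0, hn⟩ ∧ j = 0 then t else 0) *ᵥ v) ⬝ᵥ ((Matrix.of fun (k : Fin n) (j : Fin 2) =>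
      if k = ⟨0, hn⟩ ∧ j = 0 then t else 0) *ᵥ v) = t ^ 2 * v 0 ^ 2 := by
      rw [dotProduct]
      simp only [e]
      simp
      ring
    rw [e2, dotProduct, Fin.sum_univ_two]
    have ht2 : t ^ 2 < 1 := by rw [← sq_abs]; nlinarith [abs_nonneg t]
    by_cases h0 : v 0 = 0
    · have h1 : v 1 ≠ 0 := fun h1 => hv (by ext j; fin_cases j <;> assumption)
      have : 0 < v 1 * v 1 := mul_self_pos.2 h1
      rw [h0]; nlinarith
    · have : 0 < v 0 ^ 2 := by positivity
      nlinarith [mul_self_nonneg (v 1)]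
  obtain ⟨u, hu⟩ := step ⟨_, hmem 0 (by simp)⟩ (fun k => by simp)
  obtain ⟨u', hu'⟩ := step ⟨_, hmem (1 / 2) (by norm_num [abs_of_pos])⟩ (fun k => by simp)
  have huu : u' = u := by
    ext j
    have := congrFun (hu'.trans hu.symm) (Sum.inl j)
    simpa using this
  subst huu
  have hu0 : u' 0 = 0 := by
    have := congrFun (hu'.trans hu.symm) (Sum.inr ⟨0, hn⟩)
    simpa [mulVec, dotProduct, Fin.sum_univ_two] using this
  have hgE : g⁻¹.1.1 *ᵥ E = u' 1 • E := by
    rw [← hu]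
    ext j
    rcases j with j | j
    · fin_cases j
      · simp [hE, hu0]
      · simp [hE]
    · simp [hE, mulVec, dotProduct, Fin.sum_univ_two]
  intro x hx
  have hZ := (mem_lieBallReal_iff x).1 hx
  rw [mem_lieBallReal_iff, huaEquiv_smul]
  intro k
  change moebius g⁻¹.1.1 (huaEquiv n x).1 k 1 = 0
  set Z := huaEquiv n x
  have hZE : Z.1 *ᵥ ![0, 1] = 0 := by
    ext k
    simp [mulVec, dotProduct, Fin.sum_univ_two, hZ k]
  have h1 := mulVec_elim g⁻¹.1.1 Z.1 ![0, 1]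
  rw [hZE] at h1
  change g⁻¹.1.1 *ᵥ E = _ at h1
  rw [hgE] at h1
  set W := g⁻¹.1.1.toBlocks₁₁ + g⁻¹.1.1.toBlocks₁₂ * Z.1 with hW
  set U := g⁻¹.1.1.toBlocks₂₁ + g⁻¹.1.1.toBlocks₂₂ * Z.1 with hU
  have hWe : W *ᵥ ![0, 1] = u' 1 • ![0, 1] := by
    ext j
    have := congrFun h1 (Sum.inl j)
    simpa [hE] using this.symm
  have hUe : U *ᵥ ![0, 1] = 0 := by
    ext j
    have := congrFun h1 (Sum.inr j)
    simpa [hE] using this.symm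
  have hWu : IsUnit W.det := (Matrix.isUnit_iff_isUnit_det _).1 (isUnit_moebius_den g⁻¹.2 Z.2)
  have h2 : u' 1 • (W⁻¹ *ᵥ ![0, 1]) = (![0, 1] : Fin 2 → ℝ) := by
    rw [← mulVec_smul, ← hWe, mulVec_mulVec, Matrix.nonsing_inv_mul _ hWu, one_mulVec]
  have h3 : u' 1 ≠ 0 := by
    intro h0
    rw [h0, zero_smul] at h2
    simpa using congrFun h2 1
  have h4 : u' 1 • (moebius g⁻¹.1.1 Z.1 *ᵥ ![0, 1]) = 0 := by
    change u' 1 • ((U * W⁻¹) *ᵥ ![0, 1]) = 0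
    rw [← mulVec_mulVec, ← mulVec_smul, h2, hUe]
  have h5 := congrFun ((smul_eq_zero.1 h4).resolve_left h3) k
  simpa [mulVec, dotProduct, Fin.sum_univ_two] using h5

/-- The group `G = SO_0(2,n)`, the identity component of `SO(2,n)`. -/
def groupG (n : ℕ) : Subgroup (indefiniteSO n) := Subgroup.connectedComponentOfOne (indefiniteSO n)

/-- The isotropy group `K` of `0` in `G`. -/
def groupK (n : ℕ) : Subgroup (indefiniteSO n) :=
  groupG n ⊓ MulAction.stabilizer (indefiniteSO n) (⟨0, zero_mem_lieBall n⟩ : lieBall n)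

/-- The group `{h ∈ G : h(x) ∈ 𝒳 if x ∈ 𝒳}`. -/
def realStabilizer (n : ℕ) : Subgroup (indefiniteSO n) where
  carrier := {g | g ∈ groupG n ∧ ∀ x ∈ lieBallReal n, g • x ∈ lieBallReal n}
  one_mem' := ⟨one_mem _, fun x hx => by rwa [one_smul]⟩
  mul_mem' := fun ha hb =>
    ⟨mul_mem ha.1 hb.1, fun x hx => by rw [mul_smul]; exact ha.2 _ (hb.2 x hx)⟩
  inv_mem' := fun ha => ⟨inv_mem ha.1, inv_preserves_lieBallReal ha.2⟩

/-- The group `H`, the identity component of `realStabilizer n`. -/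
def groupH (n : ℕ) : Subgroup (indefiniteSO n) :=
  (Subgroup.connectedComponentOfOne (realStabilizer n)).map (realStabilizer n).subtype

/-- The group `L = H ∩ K`. -/
def groupL (n : ℕ) : Subgroup (indefiniteSO n) := groupH n ⊓ groupK n

end Group

noncomputable section Representation
open Complex

instance lieBallKernel_fact (n : ℕ) [hn : Fact (2 < n)] (ν : ℝ) [hν : Fact (ν ∈ wallachSet n)] :
    Fact (lieBallKernel n ν).PosSemidef :=
  ⟨lieBallKernel_posSemidef hn.out.le hν.out⟩

/-- The Hilbert space `𝓗_ν` of functions on `𝒟` with reproducing kernel `h(z,w)^{-ν}`. -/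
abbrev HilbertNu (n : ℕ) [Fact (2 < n)] (ν : ℝ) [Fact (ν ∈ wallachSet n)] : Type :=
  RKHS.OfKernel (lieBallKernel n ν)

/-- The transformation of `𝒟` given by `g`, as a function on `ℂ^n` (with value `0` off `𝒟`). -/
def transformation {n : ℕ} (g : indefiniteSO n) :
    EuclideanSpace ℂ (Fin n) → EuclideanSpace ℂ (Fin n) :=
  Function.extend (Subtype.val : lieBall n → EuclideanSpace ℂ (Fin n)) (fun z => (g • z).1) 0

/-- The complex Jacobian `J_g(z) = det dg(z)`. -/
def jacobian {n : ℕ} (g : indefiniteSO n) (z : lieBall n) : ℂ :=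
  (fderiv ℂ (transformation g) z).det

/-- The continuous logarithm of `J_g` on `𝒟` whose value at `0` is the principal one. -/
def logJacobian {n : ℕ} (g : indefiniteSO n) : lieBall n → ℂ :=
  Classical.epsilon fun l : lieBall n → ℂ =>
    Continuous l ∧ (∀ z, cexp (l z) = jacobian g z) ∧
      l ⟨0, zero_mem_lieBall n⟩ = Complex.log (jacobian g ⟨0, zero_mem_lieBall n⟩)

/-- `(π_ν(g) f)(z) = J_{g⁻¹}(z)^{ν/n} f(g⁻¹ z)`. -/
def piNu {n : ℕ} (ν : ℝ) (g : indefiniteSO n) (f : lieBall n → ℂ) (z : lieBall n) : ℂ :=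
  cexp ((ν / n : ℂ) * logJacobian g⁻¹ z) * f (g⁻¹ • z)

end Representation

/-! ### Linearisation of the action: isotropic lifts and the automorphy factor. -/

noncomputable section AutomorphyFactor
open Complex Matrix Filter Topology

/-! A point `z` of the Lie ball is lifted to the isotropic vector `λ(z) = ((1 + q(z))/2, i(q(z) -
1)/2, z)` of `ℂ^(2+n)`, normalised by `x₁ + i x₂ = 1`. The form of signature `(2,n)` recovers the
kernel polynomial, `2(λ(z) | conj λ(w)) = h(z,w)`, and the Hua matrix of `z` sends the first two
coordinates of `λ(z)` to the remaining ones. Hence `G` acts on `𝒟` by linear maps of lifts followed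
by renormalisation: `g λ(z) = j(g,z) λ(gz)`, where `j` is `factor` (`mulVec_isotropicLift`).
Invariance of the form gives the cocycle rule for `j`, the rule `h(gz,gw) j(g,z) conj j(g,w) =
h(z,w)`, and its bilinear companion `q(gz-gw) j(g,z) j(g,w) = q(z-w)`. It also shows that `dg(z)` is
`j⁻¹` times a complex orthogonal matrix, so `J_g = ± j^(-n)`, and connectedness makes the sign `+`.

The delicate point is the branch of `J_g^(ν/n)`. Let `g ∈ H`. For distinct real points `z, w` both
rules compare positive real numbers, which forces `j(g,z)` to be real; as `H` comes from a connected
group, it is positive on `𝒳`. Taking `w = g⁻¹0`, a point of `𝒳`, the rule for `h` says that `h(·,w)`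
is `j(g,·)` times a positive constant, so `j(g,·)` avoids the closed negative axis on all of `𝒟`
(`factor_mem_slitPlane`). The principal logarithm of `j` is therefore continuous, and the
multiplicative identities lift to logarithms because the two sides have the same imaginary part at
one real point (`eq_zero_of_exp_eq_one`). So `J_g^(ν/n)` is `j^(-ν)`, an honest cocycle on `H`, and
`h^(-ν)` is covariant under it (`hPoly_cpow_smul`).

Covariance says that `K_w ↦ conj m(g,w) K_{gw}` preserves the Gram matrix of the kernel functions,
which are total in `𝓗_ν`; this yields the unitary operators, and strong continuity need only be
tested on kernel functions. The function `1` is `K_0`. If `l ∈ L`, then `j(l,0)` is positive with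
square `1`, so `K_0` is fixed. Finally `π(g)1` is a nonzero multiple of `K_{g0}` and `H` moves `0`
to every point of `𝒳`, so a vector orthogonal to the orbit vanishes on `𝒳`. Elements of `𝓗_ν` are
holomorphic along complex lines and `𝒳` is a real form of `𝒟`, so that vector is zero
(`eq_zero_of_eqOn_lieBallReal`). -/

/-- The isotropic vector `((1 + q(z)) / 2, i (q(z) - 1) / 2, z)` of `ℂ^(2+n)` above `z`. -/
def isotropicLift {n : ℕ} (z : EuclideanSpace ℂ (Fin n)) : Fin 2 ⊕ Fin n → ℂ :=
  Sum.elim ![(1 + quadForm z) / 2, I * (quadForm z - 1) / 2] fun k => z k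

/-- The complex bilinear form of signature `(2,n)`. -/
def bilinForm {n : ℕ} (x y : Fin 2 ⊕ Fin n → ℂ) : ℂ :=
  x ⬝ᵥ ((formMatrix n).map ofReal *ᵥ y)

theorem bilinForm_eq {n : ℕ} (x y : Fin 2 ⊕ Fin n → ℂ) :
    bilinForm x y = x (.inl 0) * y (.inl 0) + x (.inl 1) * y (.inl 1)
      - ∑ i, x (.inr i) * y (.inr i) := by
  have h : (formMatrix n).map ofReal = Matrix.fromBlocks (1 : Matrix (Fin 2) (Fin 2) ℂ) 0 0
      (-1 : Matrix (Fin n) (Fin n) ℂ) := by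
    rw [formMatrix, Matrix.fromBlocks_map]
    congr 1 <;> ext i j <;> simp [Matrix.one_apply, apply_ite]
  rw [bilinForm, h, Matrix.fromBlocks_mulVec, dotProduct, Fintype.sum_sum_type]
  simp [Fin.sum_univ_two, neg_mulVec, sub_eq_add_neg]

/-- The complexification of a real matrix. -/
abbrev complexify {n : ℕ} (g : indefiniteSO n) : Matrix (Fin 2 ⊕ Fin n) (Fin 2 ⊕ Fin n) ℂ :=
  g.1.1.map ofReal

theorem complexify_mul {n : ℕ} (g g' : indefiniteSO n) :
    complexify (g * g') = complexify g * complexify g' :=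
  Matrix.map_mul (f := ofRealHom)

theorem complexify_one {n : ℕ} : complexify (1 : indefiniteSO n) = 1 :=
  Matrix.map_one ofReal ofReal_zero ofReal_one

theorem bilinForm_mulVec {n : ℕ} (g : indefiniteSO n) (x y : Fin 2 ⊕ Fin n → ℂ) :
    bilinForm (complexify g *ᵥ x) (complexify g *ᵥ y) = bilinForm x y := by
  have h : (complexify g)ᵀ * (formMatrix n).map ofReal * complexify g
      = (formMatrix n).map ofReal := by
    have h1 : g.1.1ᵀ * formMatrix n * g.1.1 = formMatrix n := g.2
    have h2 := congrArg (fun M => M.map ofRealHom) h1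
    simp only [Matrix.map_mul] at h2
    exact h2
  rw [bilinForm, bilinForm]
  conv_rhs => rw [← h]
  rw [Matrix.mul_assoc, ← mulVec_mulVec, dotProduct_mulVec _ (complexify g)ᵀ, vecMul_transpose,
    mulVec_mulVec]

theorem conj_complexify_mulVec {n : ℕ} (g : indefiniteSO n) (x : Fin 2 ⊕ Fin n → ℂ)
    (i : Fin 2 ⊕ Fin n) :
    conj ((complexify g *ᵥ x) i) = (complexify g *ᵥ fun j => conj (x j)) i := by
  simp [mulVec, dotProduct]

/-- For `w = z` this is the isotropy of the lift. For distinct real points it produces a squared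
distance, the source of positivity in `factor_im_eq_zero`. -/
theorem bilinForm_isotropicLift {n : ℕ} (z w : EuclideanSpace ℂ (Fin n)) :
    2 * bilinForm (isotropicLift z) (isotropicLift w) = quadForm (z - w) := by
  have h : quadForm (z - w) = quadForm z + quadForm w - 2 * ∑ i, z i * w i := by
    simp only [quadForm, Finset.mul_sum, ← Finset.sum_add_distrib, ← Finset.sum_sub_distrib]
    exact Finset.sum_congr rfl fun i _ => by simp; ring
  rw [bilinForm_eq, h]
  simp only [isotropicLift, Sum.elim_inl, Sum.elim_inr, cons_val_zero, cons_val_one]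
  linear_combination ((quadForm z - 1) * (quadForm w - 1) / 2) * I_sq

theorem bilinForm_isotropicLift_conj {n : ℕ} (z w : EuclideanSpace ℂ (Fin n)) :
    2 * bilinForm (isotropicLift z) (fun i => conj (isotropicLift w i)) = hPoly z w := by
  rw [bilinForm_eq, hPoly]
  simp only [isotropicLift, Sum.elim_inl, Sum.elim_inr, cons_val_zero, cons_val_one, map_div₀,
    map_add, map_mul, map_sub, map_one, conj_I, map_ofNat]
  linear_combination (-(quadForm z - 1) * (conj (quadForm w) - 1) / 2) * I_sq

/-- The automorphy factor of `g` at `z`. -/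
def factor {n : ℕ} (g : indefiniteSO n) (z : EuclideanSpace ℂ (Fin n)) : ℂ :=
  (complexify g *ᵥ isotropicLift z) (.inl 0) + I * (complexify g *ᵥ isotropicLift z) (.inl 1)

/-- The complementary coordinate `x_1 - i x_2` of `g` applied to the lift of `z`. -/
def cofactor {n : ℕ} (g : indefiniteSO n) (z : EuclideanSpace ℂ (Fin n)) : ℂ :=
  (complexify g *ᵥ isotropicLift z) (.inl 0) - I * (complexify g *ᵥ isotropicLift z) (.inl 1)

theorem isotropicLift_inl_add {n : ℕ} (z : EuclideanSpace ℂ (Fin n)) :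
    isotropicLift z (.inl 0) + I * isotropicLift z (.inl 1) = 1 := by
  simp only [isotropicLift, Sum.elim_inl, cons_val_zero, cons_val_one]
  linear_combination ((quadForm z - 1) / 2) * I_sq

theorem isotropicLift_inl_sub {n : ℕ} (z : EuclideanSpace ℂ (Fin n)) :
    isotropicLift z (.inl 0) - I * isotropicLift z (.inl 1) = quadForm z := by
  simp only [isotropicLift, Sum.elim_inl, cons_val_zero, cons_val_one]
  linear_combination (-(quadForm z - 1) / 2) * I_sq

theorem factor_one {n : ℕ} (z : EuclideanSpace ℂ (Fin n)) : factor 1 z = 1 := by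
  rw [factor, complexify_one, one_mulVec, isotropicLift_inl_add]

theorem cofactor_one {n : ℕ} (z : EuclideanSpace ℂ (Fin n)) : cofactor 1 z = quadForm z := by
  rw [cofactor, complexify_one, one_mulVec, isotropicLift_inl_sub]

/-- Isotropy of `g` applied to the lift, with `x₁² + x₂²` factored as `(x₁ + i x₂)(x₁ - i x₂)`. -/
theorem factor_mul_cofactor {n : ℕ} (g : indefiniteSO n) (z : EuclideanSpace ℂ (Fin n)) :
    factor g z * cofactor g z = ∑ i, (complexify g *ᵥ isotropicLift z) (.inr i) ^ 2 := by
  have h := bilinForm_mulVec g (isotropicLift z) (isotropicLift z)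
  have h2 := bilinForm_isotropicLift z z
  rw [← h, bilinForm_eq, sub_self] at h2
  have h0 : quadForm (0 : EuclideanSpace ℂ (Fin n)) = 0 := by simp [quadForm]
  rw [h0] at h2
  simp only [sq, factor, cofactor]
  linear_combination h2 / 2
    - ((complexify g *ᵥ isotropicLift z) (.inl 1) * (complexify g *ᵥ isotropicLift z) (.inl 1)) * I_sq

/-- The Hermitian form takes the value `h(z,z)/2 > 0` on the lift, and `g` preserves it. This
becomes the first defining inequality of the Lie ball for the image point. -/
theorem sum_norm_lt_factor {n : ℕ} (g : indefiniteSO n) {z : EuclideanSpace ℂ (Fin n)}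
    (hz : z ∈ lieBall n) :
    2 * ∑ i, ‖(complexify g *ᵥ isotropicLift z) (.inr i)‖ ^ 2
      < ‖factor g z‖ ^ 2 + ‖cofactor g z‖ ^ 2 := by
  have h := bilinForm_mulVec g (isotropicLift z) fun i => conj (isotropicLift z i)
  have h2 := bilinForm_isotropicLift_conj z z
  rw [← h, bilinForm_eq] at h2
  simp only [← conj_complexify_mulVec, Complex.mul_conj'] at h2
  rw [hPoly_self] at h2
  have h1 := hz.1
  norm_cast at h2
  have e : ‖factor g z‖ ^ 2 + ‖cofactor g z‖ ^ 2
      = 2 * (‖(complexify g *ᵥ isotropicLift z) (.inl 0)‖ ^ 2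
        + ‖(complexify g *ᵥ isotropicLift z) (.inl 1)‖ ^ 2) := by
    rw [factor, cofactor]
    simp only [Complex.sq_norm, normSq_apply, add_re, add_im, sub_re, sub_im, I_mul_re, I_mul_im]
    ring
  rw [e]
  linarith

/-- If both norms were equal, isotropy would give `|j|² ≤ ∑ |x_k|²`, against the positivity of the
Hermitian form. -/
theorem norm_cofactor_ne {n : ℕ} (g : indefiniteSO n) {z : EuclideanSpace ℂ (Fin n)}
    (hz : z ∈ lieBall n) : ‖cofactor g z‖ ≠ ‖factor g z‖ := by
  intro h
  have h1 := sum_norm_lt_factor g hz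
  have h2 := congrArg norm (factor_mul_cofactor g z)
  have h3 := norm_sum_le Finset.univ
    fun i => (complexify g *ᵥ isotropicLift z) (.inr i) ^ 2
  simp only [norm_pow] at h3
  rw [norm_mul, h] at h2
  rw [h] at h1
  nlinarith

theorem continuous_complexify_apply {n : ℕ} (i j : Fin 2 ⊕ Fin n) :
    Continuous fun g : indefiniteSO n => complexify g i j := by
  have h : Continuous fun g : indefiniteSO n => g.1.1 :=
    continuous_subtype_val.comp continuous_subtype_val
  exact continuous_ofReal.comp (h.matrix_elem i j)

theorem continuous_isotropicLift {n : ℕ} (j : Fin 2 ⊕ Fin n) :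
    Continuous fun z : EuclideanSpace ℂ (Fin n) => isotropicLift z j := by
  have := continuous_quadForm (n := n)
  rcases j with j | j
  · fin_cases j
    · simp only [isotropicLift, Sum.elim_inl, Fin.zero_eta, cons_val_zero]; fun_prop
    · simp only [isotropicLift, Sum.elim_inl, Fin.mk_one, cons_val_one, cons_val_zero]; fun_prop
  · simp only [isotropicLift, Sum.elim_inr]; fun_prop

theorem continuous_mulVec_isotropicLift {n : ℕ} (i : Fin 2 ⊕ Fin n) :
    Continuous fun p : indefiniteSO n × EuclideanSpace ℂ (Fin n) =>
      (complexify p.1 *ᵥ isotropicLift p.2) i := by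
  simp only [mulVec, dotProduct]
  exact continuous_finsetSum _ fun j _ =>
    ((continuous_complexify_apply i j).comp continuous_fst).mul
      ((continuous_isotropicLift j).comp continuous_snd)

theorem continuous_factor {n : ℕ} :
    Continuous fun p : indefiniteSO n × EuclideanSpace ℂ (Fin n) => factor p.1 p.2 :=
  (continuous_mulVec_isotropicLift _).add
    (continuous_const.mul (continuous_mulVec_isotropicLift _))

theorem continuous_cofactor {n : ℕ} :
    Continuous fun p : indefiniteSO n × EuclideanSpace ℂ (Fin n) => cofactor p.1 p.2 :=
  (continuous_mulVec_isotropicLift _).sub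
    (continuous_const.mul (continuous_mulVec_isotropicLift _))

theorem pos_of_isPreconnected {X : Type*} [TopologicalSpace X] {s : Set X} (hs : IsPreconnected s)
    {f : X → ℝ} (hf : ContinuousOn f s) (hne : ∀ x ∈ s, f x ≠ 0) {x₀ : X} (hx₀ : x₀ ∈ s)
    (h₀ : 0 < f x₀) {x : X} (hx : x ∈ s) : 0 < f x := by
  by_contra! hle
  obtain ⟨y, hy, hy0⟩ := hs.intermediate_value hx hx₀ hf ⟨hle, h₀.le⟩
  exact hne y hy hy0

/-- At `g = 1` the inequality reads `|q(z)| < 1`. Equality never occurs, so it persists along the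
connected group `G`. In particular the automorphy factor has no zeros. -/
theorem norm_cofactor_lt {n : ℕ} {g : indefiniteSO n} (hg : g ∈ groupG n)
    {z : EuclideanSpace ℂ (Fin n)} (hz : z ∈ lieBall n) : ‖cofactor g z‖ < ‖factor g z‖ := by
  have hc : Continuous fun g : indefiniteSO n => ‖factor g z‖ - ‖cofactor g z‖ :=
    (continuous_factor.comp (Continuous.prodMk_left z)).norm.sub
      (continuous_cofactor.comp (Continuous.prodMk_left z)).norm
  have := pos_of_isPreconnected (s := connectedComponent (1 : indefiniteSO n))
    isPreconnected_connectedComponent hc.continuousOn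
    (fun g _ h => norm_cofactor_ne g hz (sub_eq_zero.1 h).symm) mem_connectedComponent
    (by rw [factor_one, cofactor_one, norm_one]; linarith [norm_quadForm_lt_one hz]) hg
  linarith

theorem factor_ne_zero {n : ℕ} {g : indefiniteSO n} (hg : g ∈ groupG n)
    {z : EuclideanSpace ℂ (Fin n)} (hz : z ∈ lieBall n) : factor g z ≠ 0 := by
  intro h
  have := norm_cofactor_lt hg hz
  rw [h, norm_zero] at this
  exact absurd this (norm_nonneg _).not_gt

/-- The action defined through the Hua bijection is the projective action on isotropic lifts. The
proof shows that the renormalised vector lies in `𝒟` and that its Hua matrix is the Möbius image of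
that of `z`; injectivity of the Hua map finishes. -/
theorem smul_apply_of_mem_groupG {n : ℕ} {g : indefiniteSO n} (hg : g ∈ groupG n) (z : lieBall n) :
    (∀ k, (g • z).1 k = (complexify g *ᵥ isotropicLift z.1) (.inr k) / factor g z) ∧
      quadForm (g • z).1 = cofactor g z / factor g z := by
  have hj := factor_ne_zero hg z.2
  have hlt := norm_cofactor_lt hg z.2
  have hsum := sum_norm_lt_factor g z.2
  have hmul := factor_mul_cofactor g z.1
  set x := complexify g *ᵥ isotropicLift z.1 with hx
  set y : EuclideanSpace ℂ (Fin n) := WithLp.toLp 2 fun k => x (.inr k) / factor g z with hy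
  have hq : quadForm y = cofactor g z / factor g z := by
    simp only [quadForm, hy, div_pow]
    rw [← Finset.sum_div, ← hmul]
    field_simp
  have hj0 : 0 < ‖factor g z‖ := norm_pos_iff.2 hj
  have hn : ‖y‖ ^ 2 = (∑ i, ‖x (.inr i)‖ ^ 2) / ‖factor g z‖ ^ 2 := by
    rw [EuclideanSpace.norm_sq_eq, Finset.sum_div]
    simp [hy, div_pow]
  have hc0 := norm_nonneg (cofactor g z.1)
  have hymem : y ∈ lieBall n := by
    constructor
    · rw [hn, hq, norm_div, div_pow]
      have : 1 - 2 * ((∑ i, ‖x (.inr i)‖ ^ 2) / ‖factor g z‖ ^ 2)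
          + ‖cofactor g z‖ ^ 2 / ‖factor g z‖ ^ 2
          = (‖factor g z‖ ^ 2 + ‖cofactor g z‖ ^ 2 - 2 * ∑ i, ‖x (.inr i)‖ ^ 2)
            / ‖factor g z‖ ^ 2 := by
        field_simp
        ring
      rw [this]
      exact div_pos (by linarith) (by positivity)
    · have : ‖y‖ ^ 2 < 1 := by
        rw [hn, div_lt_one (by positivity)]
        nlinarith
      nlinarith [norm_nonneg y]
  have hZ : hua y = moebius g.1.1 (hua z.1) := by
    refine hua_unique hymem fun k => ?_
    have hu := (Matrix.isUnit_iff_isUnit_det _).1 (isUnit_moebius_den g.2 (hua_mem z.2))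
    have hM : moebius g.1.1 (hua z.1) * (g.1.1.toBlocks₁₁ + g.1.1.toBlocks₁₂ * hua z.1)
        = g.1.1.toBlocks₂₁ + g.1.1.toBlocks₂₂ * hua z.1 := by
      rw [moebius, Matrix.mul_assoc, Matrix.nonsing_inv_mul _ hu, Matrix.mul_one]
    set v : Fin 2 → ℂ := ![(1 + quadForm z.1) / 2, I * (quadForm z.1 - 1) / 2] with hv
    set W := g.1.1.toBlocks₁₁ + g.1.1.toBlocks₁₂ * hua z.1 with hW
    set U := g.1.1.toBlocks₂₁ + g.1.1.toBlocks₂₂ * hua z.1 with hU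
    -- The lift lies on the graph of the Hua matrix, since `z = Z v` with `v` its first two
    -- coordinates.
    have hlift : isotropicLift z.1 = Sum.elim v ((hua z.1).map ofReal *ᵥ v) := by
      rw [isotropicLift, ← hv]
      congr 1
      ext k
      rw [hua_spec z.2 k]
      simp [hv, mulVec, dotProduct, Fin.sum_univ_two]
      ring
    have hxW : x = Sum.elim (W.map ofReal *ᵥ v) (U.map ofReal *ᵥ v) := by
      have e1 : W.map ofReal = g.1.1.toBlocks₁₁.map ofReal
          + g.1.1.toBlocks₁₂.map ofReal * (hua z.1).map ofReal := by
        rw [hW, Matrix.map_add _ ofReal_add]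
        congr 1
        exact Matrix.map_mul (f := ofRealHom)
      have e2 : U.map ofReal = g.1.1.toBlocks₂₁.map ofReal
          + g.1.1.toBlocks₂₂.map ofReal * (hua z.1).map ofReal := by
        rw [hU, Matrix.map_add _ ofReal_add]
        congr 1
        exact Matrix.map_mul (f := ofRealHom)
      rw [hx, hlift, complexify]
      conv_lhs => rw [← fromBlocks_toBlocks g.1.1]
      rw [Matrix.fromBlocks_map, fromBlocks_mulVec, e1, e2]
      simp [add_mulVec, mulVec_mulVec, Function.comp_def]
    -- A block matrix maps the graph of `Z` into the graph of its Möbius image.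
    have hxM : (fun k => x (.inr k)) = (moebius g.1.1 (hua z.1)).map ofReal *ᵥ fun j => x (.inl j) := by
      rw [hxW]
      simp only [Sum.elim_inl, Sum.elim_inr]
      change U.map ofReal *ᵥ v = (moebius g.1.1 (hua z.1)).map ofReal *ᵥ (W.map ofReal *ᵥ v)
      rw [mulVec_mulVec, ← hM]
      congr 1
      exact Matrix.map_mul (f := ofRealHom)
    have hk := congrFun hxM k
    simp only [mulVec, dotProduct, Fin.sum_univ_two, Matrix.map_apply] at hk
    rw [hq]
    change x (.inr k) / factor g z = _
    rw [hk]
    have f1 : factor g z = x (.inl 0) + I * x (.inl 1) := rfl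
    have f2 : cofactor g z = x (.inl 0) - I * x (.inl 1) := rfl
    rw [div_eq_iff hj]
    field_simp
    rw [f1, f2]
    linear_combination (2 * moebius g.1.1 (hua z.1) k 1 * x (.inl 1)) * I_sq
  have hsm : g • z = ⟨y, hymem⟩ := by
    apply (huaEquiv n).injective
    rw [huaEquiv_smul]
    exact Subtype.ext hZ.symm
  rw [hsm]
  exact ⟨fun k => rfl, hq⟩

theorem mulVec_isotropicLift {n : ℕ} {g : indefiniteSO n} (hg : g ∈ groupG n) (z : lieBall n) :
    complexify g *ᵥ isotropicLift z.1 = factor g z • isotropicLift (g • z).1 := by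
  obtain ⟨h1, h2⟩ := smul_apply_of_mem_groupG hg z
  have hj := factor_ne_zero hg z.2
  have f1 : factor g z = (complexify g *ᵥ isotropicLift z.1) (.inl 0)
    + I * (complexify g *ᵥ isotropicLift z.1) (.inl 1) := rfl
  have f2 : cofactor g z = (complexify g *ᵥ isotropicLift z.1) (.inl 0)
    - I * (complexify g *ᵥ isotropicLift z.1) (.inl 1) := rfl
  generalize complexify g *ᵥ isotropicLift z.1 = x at *
  ext i
  rw [Pi.smul_apply, smul_eq_mul]
  rcases i with i | i
  · have e : factor g z * quadForm (g • z).1 = cofactor g z := by rw [h2]; field_simp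
    fin_cases i
    · simp only [isotropicLift, Sum.elim_inl, Fin.zero_eta, cons_val_zero]
      linear_combination (-(1 : ℂ) / 2) * (f1 + f2 + e)
    · simp only [isotropicLift, Sum.elim_inl, Fin.mk_one, cons_val_one, cons_val_zero]
      linear_combination (I / 2) * (f1 - f2 - e) + x (.inl 1) * I_sq
  · simp only [isotropicLift, Sum.elim_inr]
    rw [h1 i]
    field_simp

theorem factor_mul {n : ℕ} (g : indefiniteSO n) {g' : indefiniteSO n} (hg' : g' ∈ groupG n)
    (z : lieBall n) : factor (g * g') z = factor g (g' • z).1 * factor g' z := by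
  have h : factor g (g' • z).1 = (complexify g *ᵥ isotropicLift (g' • z).1) (.inl 0)
    + I * (complexify g *ᵥ isotropicLift (g' • z).1) (.inl 1) := rfl
  rw [factor, complexify_mul, ← mulVec_mulVec, mulVec_isotropicLift hg', mulVec_smul, h]
  simp only [Pi.smul_apply, smul_eq_mul]
  ring

/-- Since `g` is real it commutes with conjugation, so the invariant form can be evaluated on a lift
and a conjugated lift, each of which is rescaled by its factor. -/
theorem hPoly_smul {n : ℕ} {g : indefiniteSO n} (hg : g ∈ groupG n) (z w : lieBall n) :
    hPoly (g • z).1 (g • w).1 * (factor g z * conj (factor g w)) = hPoly z.1 w.1 := by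
  have h := bilinForm_mulVec g (isotropicLift z.1) fun i => conj (isotropicLift w.1 i)
  rw [← bilinForm_isotropicLift_conj, ← bilinForm_isotropicLift_conj z.1 w.1, ← h]
  have e : (complexify g *ᵥ fun i => conj (isotropicLift w.1 i))
      = conj (factor g w) • fun i => conj (isotropicLift (g • w).1 i) := by
    ext i
    rw [← conj_complexify_mulVec, mulVec_isotropicLift hg]
    simp
  rw [e, mulVec_isotropicLift hg, bilinForm, bilinForm, mulVec_smul, smul_dotProduct,
    dotProduct_smul]
  simp only [smul_eq_mul]
  ring

theorem quadForm_smul_sub {n : ℕ} {g : indefiniteSO n} (hg : g ∈ groupG n) (z w : lieBall n) :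
    quadForm ((g • z).1 - (g • w).1) * (factor g z * factor g w) = quadForm (z.1 - w.1) := by
  have h := bilinForm_mulVec g (isotropicLift z.1) (isotropicLift w.1)
  rw [← bilinForm_isotropicLift, ← bilinForm_isotropicLift z.1 w.1, ← h,
    mulVec_isotropicLift hg, mulVec_isotropicLift hg, bilinForm, bilinForm, mulVec_smul,
    smul_dotProduct, dotProduct_smul]
  simp only [smul_eq_mul]
  ring

end AutomorphyFactor

/-! ### The group `H`: positivity of the automorphy factor on `𝒳`. -/

noncomputable section RealStabilizer
open Complex Matrix Filter Topology

theorem groupH_le_realStabilizer (n : ℕ) : groupH n ≤ realStabilizer n := by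
  rintro _ ⟨g, _, rfl⟩
  exact g.2

theorem groupH_le_groupG (n : ℕ) : groupH n ≤ groupG n :=
  fun _ h => (groupH_le_realStabilizer n h).1

theorem mem_lieBall_of_norm {n : ℕ} {z : EuclideanSpace ℂ (Fin n)} (h : 2 * ‖z‖ ^ 2 < 1) :
    z ∈ lieBall n := by
  constructor
  · nlinarith [sq_nonneg ‖quadForm z‖]
  · nlinarith [norm_nonneg z]

theorem conj_quadForm_of_real {n : ℕ} {z : EuclideanSpace ℂ (Fin n)}
    (hz : ∀ i, conj (z i) = z i) : conj (quadForm z) = quadForm z := by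
  simp only [quadForm, map_sum, map_pow, hz]

theorem conj_of_mem_lieBallReal {n : ℕ} {z : lieBall n} (hz : z ∈ lieBallReal n) (i : Fin n) :
    conj (z.1 i) = z.1 i :=
  Complex.conj_eq_iff_im.2 (hz i)

/-- At real points `h` is real, and a real number in the slit plane is positive. -/
theorem hPoly_re_pos_of_mem_lieBallReal {n : ℕ} (hn : 2 ≤ n) {z w : lieBall n}
    (hz : z ∈ lieBallReal n) (hw : w ∈ lieBallReal n) :
    0 < (hPoly z.1 w.1).re ∧ (hPoly z.1 w.1).im = 0 := by
  have h : conj (hPoly z.1 w.1) = hPoly z.1 w.1 := by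
    simp only [hPoly, map_add, map_sub, map_mul, map_one, map_ofNat, map_sum,
      conj_of_mem_lieBallReal hz, conj_of_mem_lieBallReal hw,
      conj_quadForm_of_real (conj_of_mem_lieBallReal hz),
      conj_quadForm_of_real (conj_of_mem_lieBallReal hw)]
  have him := Complex.conj_eq_iff_im.1 h
  refine ⟨?_, him⟩
  exact (hPoly_mem_slitPlane hn z.2 w.2).resolve_right fun h => h him

theorem quadForm_sub_re_pos_of_mem_lieBallReal {n : ℕ} {z w : lieBall n}
    (hz : z ∈ lieBallReal n) (hw : w ∈ lieBallReal n) (hne : z ≠ w) :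
    0 < (quadForm (z.1 - w.1)).re ∧ (quadForm (z.1 - w.1)).im = 0 := by
  have h : quadForm (z.1 - w.1) = ((∑ i, ((z.1 i).re - (w.1 i).re) ^ 2 : ℝ) : ℂ) := by
    rw [quadForm]
    push_cast
    refine Finset.sum_congr rfl fun i _ => ?_
    rw [PiLp.sub_apply, Complex.conj_eq_iff_re.1 (conj_of_mem_lieBallReal hz i),
      Complex.conj_eq_iff_re.1 (conj_of_mem_lieBallReal hw i)]
  rw [h, ofReal_re, ofReal_im]
  refine ⟨?_, rfl⟩
  obtain ⟨i, hi⟩ : ∃ i, z.1 i ≠ w.1 i := by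
    by_contra! hcon
    exact hne (Subtype.ext (PiLp.ext hcon))
  refine Finset.sum_pos' (fun i _ => sq_nonneg _) ⟨i, Finset.mem_univ i, ?_⟩
  refine sq_pos_iff.2 ?_
  intro h0
  apply hi
  rw [← Complex.conj_eq_iff_re.1 (conj_of_mem_lieBallReal hz i),
      ← Complex.conj_eq_iff_re.1 (conj_of_mem_lieBallReal hw i), sub_eq_zero.1 h0]

/-- The real parts add up to `2 u.re v.re > 0`, so `v.re ≠ 0`; the imaginary parts add up to `2 u.im
v.re = 0`. -/
theorem im_eq_zero_of_mul_pos {u v : ℂ} (h1 : 0 < (u * v).re) (h2 : (u * v).im = 0)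
    (h3 : 0 < (u * conj v).re) (h4 : (u * conj v).im = 0) : u.im = 0 := by
  simp only [mul_re, mul_im, conj_re, conj_im] at h1 h2 h3 h4
  have h5 : 0 < u.re * v.re := by nlinarith
  have h6 : v.re * u.im = 0 := by nlinarith
  exact (mul_eq_zero.1 h6).resolve_left fun h => by rw [h] at h5; simp at h5

theorem pos_of_pos_mul {a b c : ℂ} (h : a * b = c) (ha : 0 < a.re ∧ a.im = 0)
    (hc : 0 < c.re ∧ c.im = 0) : 0 < b.re ∧ b.im = 0 := by
  have hr := congrArg re h
  have hi := congrArg im h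
  rw [mul_re, ha.2, zero_mul, sub_zero] at hr
  rw [mul_im, ha.2, zero_mul, add_zero, hc.2] at hi
  refine ⟨?_, (mul_eq_zero.1 hi).resolve_left ha.1.ne'⟩
  exact (pos_iff_pos_of_mul_pos (by rw [hr]; exact hc.1)).1 ha.1

theorem zero_mem_lieBallReal (n : ℕ) : (⟨0, zero_mem_lieBall n⟩ : lieBall n) ∈ lieBallReal n :=
  fun i => by simp

/-- For a second real point `w`, the rule for `q(z - w)` makes `j(g,z) j(g,w)` positive and the rule
for `h` makes `j(g,z) conj j(g,w)` positive. -/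
theorem factor_im_eq_zero {n : ℕ} (hn : 2 ≤ n) {g : indefiniteSO n} (hg : g ∈ realStabilizer n)
    {z : lieBall n} (hz : z ∈ lieBallReal n) : (factor g z).im = 0 := by
  -- Any other point of `𝒳` will do: `0`, or `(1/2, 0, …, 0)` when `z` is `0` itself.
  obtain ⟨w, hw, hne⟩ : ∃ w ∈ lieBallReal n, z ≠ w := by
    have hmem : (EuclideanSpace.single ⟨0, by omega⟩ (1 / 2) : EuclideanSpace ℂ (Fin n))
        ∈ lieBall n := by
      apply mem_lieBall_of_norm
      rw [PiLp.norm_single]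
      norm_num
    by_cases h0 : z = ⟨0, zero_mem_lieBall n⟩
    · refine ⟨⟨_, hmem⟩, fun i => ?_, ?_⟩
      · by_cases hi : i = ⟨0, by omega⟩ <;> simp [hi]
      · rw [h0]
        intro h
        have := congrArg (fun x : lieBall n => x.1 ⟨0, by omega⟩) h
        simp at this
    · exact ⟨_, zero_mem_lieBallReal n, h0⟩
  have hne' : g • z ≠ g • w := fun h => hne (MulAction.injective g h)
  have h1 := pos_of_pos_mul (quadForm_smul_sub hg.1 z w)
    (quadForm_sub_re_pos_of_mem_lieBallReal (hg.2 z hz) (hg.2 w hw) hne')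
    (quadForm_sub_re_pos_of_mem_lieBallReal hz hw hne)
  have h2 := pos_of_pos_mul (hPoly_smul hg.1 z w)
    (hPoly_re_pos_of_mem_lieBallReal hn (hg.2 z hz) (hg.2 w hw))
    (hPoly_re_pos_of_mem_lieBallReal hn hz hw)
  exact im_eq_zero_of_mul_pos h1.1 h1.2 h2.1 h2.2

/-- On the whole stabiliser of `𝒳` the factor is real and nonzero, hence of constant sign on the
identity component, where it equals `1` at `g = 1`. -/
theorem factor_re_pos {n : ℕ} (hn : 2 ≤ n) {g : indefiniteSO n} (hg : g ∈ groupH n)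
    {z : lieBall n} (hz : z ∈ lieBallReal n) : 0 < (factor g z).re := by
  have hc : Continuous fun g : realStabilizer n => (factor g.1 z.1).re :=
    Complex.continuous_re.comp
      ((continuous_factor.comp (Continuous.prodMk_left z.1)).comp continuous_subtype_val)
  have h1 : 0 < (factor ((1 : realStabilizer n) : indefiniteSO n) z.1).re := by
    rw [Subgroup.coe_one, factor_one, one_re]
    exact one_pos
  have hne : ∀ g : realStabilizer n, (factor g.1 z.1).re ≠ 0 := fun g h =>
    factor_ne_zero g.2.1 z.2 (Complex.ext h (factor_im_eq_zero hn g.2 hz))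
  have key : ∀ g ∈ connectedComponent (1 : realStabilizer n), 0 < (factor g.1 z.1).re :=
    fun g hg => pos_of_isPreconnected (f := fun g : realStabilizer n => (factor g.1 z.1).re)
      isPreconnected_connectedComponent hc.continuousOn (fun g _ => hne g) mem_connectedComponent
      h1 hg
  obtain ⟨g', hg', e⟩ := Subgroup.mem_map.1 hg
  rw [← e]
  exact key g' hg'

/-- With `w = g⁻¹0` in `𝒳` one has `h(gz, gw) = h(gz, 0) = 1`, so `h(z,w) = j(g,z) j(g,w)` with
`j(g,w) > 0`. Thus `j(g,·)` inherits the slit plane from `h(·,w)`, and its principal logarithm is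
continuous on `𝒟`. -/
theorem factor_mem_slitPlane {n : ℕ} (hn : 2 ≤ n) {g : indefiniteSO n} (hg : g ∈ groupH n)
    (z : lieBall n) : factor g z ∈ slitPlane := by
  set w : lieBall n := g⁻¹ • ⟨0, zero_mem_lieBall n⟩ with hw
  have hwX : w ∈ lieBallReal n :=
    (groupH_le_realStabilizer n (inv_mem hg)).2 _ (zero_mem_lieBallReal n)
  have h := hPoly_smul (groupH_le_groupG n hg) z w
  have hgw : (g • w).1 = 0 := by rw [hw, smul_inv_smul]
  have h0 : hPoly (g • z).1 (0 : EuclideanSpace ℂ (Fin n)) = 1 := by simp [hPoly, quadForm]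
  have hpos := factor_re_pos hn hg hwX
  have him := factor_im_eq_zero hn (groupH_le_realStabilizer n hg) hwX
  rw [hgw, h0, one_mul] at h
  have hs := hPoly_mem_slitPlane hn z.2 w.2
  rw [← h, Complex.conj_eq_iff_im.2 him, mem_slitPlane_iff, mul_re, mul_im, him, mul_zero, mul_zero,
    sub_zero, zero_add] at hs
  rw [mem_slitPlane_iff]
  refine hs.imp (fun h => (pos_iff_pos_of_mul_pos h).2 hpos) fun h h0 => h (by rw [h0, zero_mul])

/-! ### Transvections: the transitivity of `H` on `𝒳`. -/

/-- The vector `(1, 0, x)`. -/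
def boostVec {n : ℕ} (x : Fin n → ℝ) : Fin 2 ⊕ Fin n → ℝ := Sum.elim ![1, 0] x

/-- The diagonal matrix with entries `-1, 1, …, 1`. -/
def boostDiag (n : ℕ) : Matrix (Fin 2 ⊕ Fin n) (Fin 2 ⊕ Fin n) ℝ :=
  Matrix.diagonal (Sum.elim ![-1, 1] 1)

/-- The matrix of the transvection of `𝒟` that maps `0` to `x`. -/
def boostMatrix {n : ℕ} (x : Fin n → ℝ) : Matrix (Fin 2 ⊕ Fin n) (Fin 2 ⊕ Fin n) ℝ :=
  boostDiag n + (2 / (1 - x ⬝ᵥ x)) • vecMulVec (boostVec x) (boostVec x)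

theorem formMatrix_eq_diagonal (n : ℕ) :
    formMatrix n = Matrix.diagonal (Sum.elim 1 (-1)) := by
  rw [formMatrix, ← Matrix.diagonal_one, ← Matrix.diagonal_one, Matrix.diagonal_neg,
    Matrix.fromBlocks_diagonal]
  rfl

/-- The matrix is the reflection in `e₁` followed by the reflection in `w = (1, 0, x)`, a vector
with `(w|w) = 1 - |x|² > 0`. The coefficient `2/(w|w)` is that of the reflection formula; the
remaining sign comes from `S J w = -w`, with `S` the diagonal matrix and `J` the Gram matrix. -/
theorem boostMatrix_form {n : ℕ} {x : Fin n → ℝ} (hx : x ⬝ᵥ x < 1) :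
    (boostMatrix x)ᵀ * formMatrix n * boostMatrix x = formMatrix n := by
  have hT : (boostMatrix x)ᵀ = boostMatrix x := by
    rw [boostMatrix, transpose_add, transpose_smul, transpose_vecMulVec, boostDiag,
      diagonal_transpose]
  have hw : boostVec x ⬝ᵥ (formMatrix n *ᵥ boostVec x) = 1 - x ⬝ᵥ x := by
    rw [boostVec, form_elim]
    simp [dotProduct, Fin.sum_univ_two]
  have hS : boostDiag n * formMatrix n * boostDiag n = formMatrix n := by
    rw [boostDiag, formMatrix_eq_diagonal, diagonal_mul_diagonal, diagonal_mul_diagonal]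
    congr 1
    ext i
    rcases i with i | i
    · fin_cases i <;> simp
    · simp
  have hSw : (boostDiag n * formMatrix n) *ᵥ boostVec x = -boostVec x := by
    rw [boostDiag, formMatrix_eq_diagonal, diagonal_mul_diagonal]
    ext i
    rw [mulVec_diagonal]
    rcases i with i | i
    · fin_cases i <;> simp [boostVec]
    · simp [boostVec]
  have hwS : boostVec x ᵥ* (formMatrix n * boostDiag n) = -boostVec x := by
    rw [boostDiag, formMatrix_eq_diagonal, diagonal_mul_diagonal]
    ext i
    rw [vecMul_diagonal]
    rcases i with i | i
    · fin_cases i <;> simp [boostVec]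
    · simp [boostVec]
  have hc : (2 / (1 - x ⬝ᵥ x)) * (1 - x ⬝ᵥ x) = 2 := by
    have : 1 - x ⬝ᵥ x ≠ 0 := by linarith
    field_simp
  rw [hT, boostMatrix]
  generalize 2 / (1 - x ⬝ᵥ x) = c at *
  set w := boostVec x
  rw [Matrix.add_mul, Matrix.add_mul, Matrix.mul_add, Matrix.mul_add, hS, Matrix.mul_smul,
    mul_vecMulVec, hSw, Matrix.smul_mul, Matrix.smul_mul, Matrix.smul_mul, Matrix.mul_assoc,
    vecMulVec_mul, hwS, vecMulVec_mul, Matrix.mul_smul, vecMulVec_mul_vecMulVec,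
    ← dotProduct_mulVec, hw, vecMulVec_neg, neg_vecMulVec]
  rw [vecMulVec_smul, smul_smul, smul_smul]
  have : c * (c * (1 - x ⬝ᵥ x)) = c + c := by rw [hc]; ring
  rw [mul_assoc c c, this, add_smul]
  simp only [smul_neg]
  abel

/-- Both `S` and the rank one perturbation of the identity have determinant `-1`, the latter by the
matrix determinant lemma. -/
theorem boostMatrix_det {n : ℕ} {x : Fin n → ℝ} (hx : x ⬝ᵥ x < 1) : (boostMatrix x).det = 1 := by
  have hS : (boostDiag n).det = -1 := by
    rw [boostDiag, det_diagonal, Fintype.prod_sum_type]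
    simp
  have hSS : boostDiag n * boostDiag n = 1 := by
    rw [boostDiag, diagonal_mul_diagonal, ← diagonal_one]
    congr 1
    ext i
    rcases i with i | i
    · fin_cases i <;> simp
    · simp
  have hc : (2 / (1 - x ⬝ᵥ x)) * (1 - x ⬝ᵥ x) = 2 := by
    have : 1 - x ⬝ᵥ x ≠ 0 := by linarith
    field_simp
  have e : boostMatrix x = boostDiag n * (1 + replicateCol Unit
      ((2 / (1 - x ⬝ᵥ x)) • (boostDiag n *ᵥ boostVec x)) * replicateRow Unit (boostVec x)) := by
    rw [← vecMulVec_eq, Matrix.mul_add, Matrix.mul_one, mul_vecMulVec, mulVec_smul, mulVec_mulVec,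
      hSS, one_mulVec, smul_vecMulVec, boostMatrix]
  have hd : boostVec x ⬝ᵥ (boostDiag n *ᵥ boostVec x) = x ⬝ᵥ x - 1 := by
    rw [dotProduct, Fintype.sum_sum_type]
    simp [boostDiag, mulVec_diagonal, boostVec, Fin.sum_univ_two, dotProduct]
    ring
  rw [e, det_mul, hS, det_one_add_replicateCol_mul_replicateRow, dotProduct_smul, hd, smul_eq_mul]
  linear_combination hc

/-- The transvection of `𝒟` that maps `0` to `x`. -/
def boost {n : ℕ} (x : Fin n → ℝ) (hx : x ⬝ᵥ x < 1) : indefiniteSO n :=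
  ⟨⟨boostMatrix x, boostMatrix_det hx⟩, boostMatrix_form hx⟩

theorem boost_mulVec {n : ℕ} {x : Fin n → ℝ} (hx : x ⬝ᵥ x < 1) (v : Fin 2 ⊕ Fin n → ℂ) :
    complexify (boost x hx) *ᵥ v = (fun i => ((Sum.elim ![-1, 1] 1 : Fin 2 ⊕ Fin n → ℝ) i : ℂ) * v i)
      + fun i => ((2 / (1 - x ⬝ᵥ x) : ℝ) : ℂ) * (v (.inl 0) + ∑ k, x k * v (.inr k))
        * ((boostVec x i : ℝ) : ℂ) := by
  ext i
  simp only [boost, boostMatrix, boostDiag, mulVec, dotProduct, Matrix.map_apply, Matrix.add_apply,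
    Matrix.smul_apply, vecMulVec_apply, diagonal_apply, smul_eq_mul, ofReal_add, ofReal_mul, add_mul,
    Finset.sum_add_distrib, Pi.add_apply]
  congr 1
  · rw [Finset.sum_eq_single i]
    · simp
    · intro j _ hj
      simp [hj.symm]
    · simp
  · rw [Fintype.sum_sum_type]
    simp only [boostVec, Sum.elim_inl, Sum.elim_inr, Fin.sum_univ_two, cons_val_zero, cons_val_one,
      ofReal_one, ofReal_zero, mul_add, Finset.mul_sum, add_mul, Finset.sum_mul]
    rw [mul_zero, mul_zero, zero_mul, add_zero]
    congr 1
    · ring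
    · exact Finset.sum_congr rfl fun k _ => by ring

/-- The path `t ↦ boost (t x)` starts at `1`, because for `x = 0` both reflections coincide. It
stays among the transvections, and so serves for both `G` and the stabiliser of `𝒳`. -/
theorem exists_path_boost {n : ℕ} {x : Fin n → ℝ} (hx : x ⬝ᵥ x < 1) :
    ∃ γ : unitInterval → indefiniteSO n, Continuous γ ∧ γ 0 = 1 ∧ γ 1 = boost x hx ∧
      ∀ t, ∃ (y : Fin n → ℝ) (hy : y ⬝ᵥ y < 1), γ t = boost y hy := by
  have hlt : ∀ t : unitInterval, ((t : ℝ) • x) ⬝ᵥ ((t : ℝ) • x) < 1 := by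
    intro t
    rw [smul_dotProduct, dotProduct_smul, smul_eq_mul, smul_eq_mul, ← mul_assoc]
    have h0 : 0 ≤ x ⬝ᵥ x := Finset.sum_nonneg fun i _ => mul_self_nonneg _
    have h1 := t.2.1
    have h2 := t.2.2
    have h3 : (t : ℝ) * t ≤ 1 := by nlinarith
    nlinarith [mul_le_mul_of_nonneg_right h3 h0]
  refine ⟨fun t => boost ((t : ℝ) • x) (hlt t), ?_, ?_, ?_, fun t => ⟨_, hlt t, rfl⟩⟩
  · refine Continuous.subtype_mk (Continuous.subtype_mk ?_ _) _
    have hc : Continuous fun t : unitInterval => ((t : ℝ) • x) ⬝ᵥ ((t : ℝ) • x) := by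
      simp only [dotProduct, Pi.smul_apply]; fun_prop
    have hv : Continuous fun t : unitInterval => boostVec ((t : ℝ) • x) := by
      refine continuous_pi fun i => ?_
      rcases i with i | i
      · exact continuous_const
      · simp only [boostVec, Sum.elim_inr, Pi.smul_apply]; fun_prop
    have hs : Continuous fun t : unitInterval =>
        2 / (1 - ((t : ℝ) • x) ⬝ᵥ ((t : ℝ) • x)) := ?_
    · exact continuous_const.add (hs.smul (hv.matrix_vecMulVec hv))
    exact continuous_const.div (continuous_const.sub hc) fun t => by linarith [hlt t]
  · refine Subtype.ext (Subtype.ext ?_)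
    change boostMatrix (((0 : unitInterval) : ℝ) • x) = 1
    rw [Set.Icc.coe_zero, zero_smul, boostMatrix, boostDiag]
    ext i j
    rcases i with i | i <;> rcases j with j | j
    · fin_cases i <;> fin_cases j <;> simp [boostVec, vecMulVec_apply]
      norm_num
    · simp [boostVec, vecMulVec_apply]
    · simp [boostVec, vecMulVec_apply]
    · simp [boostVec, vecMulVec_apply, diagonal_apply, one_apply]
  · simp

theorem boost_mem_groupG {n : ℕ} {x : Fin n → ℝ} (hx : x ⬝ᵥ x < 1) : boost x hx ∈ groupG n := by
  obtain ⟨γ, hγ, h0, h1, -⟩ := exists_path_boost hx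
  have := (isPreconnected_range hγ).subset_connectedComponent ⟨0, h0⟩
  exact this ⟨1, h1⟩

/-- Over a real point only the second coordinate of the lift is imaginary. The transvection leaves
that coordinate alone, and it enters the factor multiplied by `i`, so numerators and factor are
real. -/
theorem boost_mem_realStabilizer {n : ℕ} {x : Fin n → ℝ} (hx : x ⬝ᵥ x < 1) :
    boost x hx ∈ realStabilizer n := by
  refine ⟨boost_mem_groupG hx, fun z hz => ?_⟩
  have hz' := conj_of_mem_lieBallReal hz
  have hq := conj_quadForm_of_real hz'
  intro k
  rw [← Complex.conj_eq_iff_im, (smul_apply_of_mem_groupG (boost_mem_groupG hx) z).1 k, factor,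
    boost_mulVec]
  simp only [isotropicLift, boostVec, Pi.add_apply, Sum.elim_inl, Sum.elim_inr, cons_val_zero,
    cons_val_one, ofReal_zero, mul_zero, add_zero, ofReal_one, one_mul, mul_one, Pi.one_apply]
  rw [← mul_div_assoc]
  simp only [map_div₀, map_add, map_mul, map_sum, conj_ofReal, hz', hq, map_one, map_ofNat,
    map_sub, conj_I]
  ring

theorem boost_mem_groupH {n : ℕ} {x : Fin n → ℝ} (hx : x ⬝ᵥ x < 1) : boost x hx ∈ groupH n := by
  obtain ⟨γ, hγ, h0, h1, hb⟩ := exists_path_boost hx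
  have hmem : ∀ t, γ t ∈ realStabilizer n := fun t => by
    obtain ⟨y, hy, e⟩ := hb t
    rw [e]
    exact boost_mem_realStabilizer hy
  have hγ' : Continuous fun t => (⟨γ t, hmem t⟩ : realStabilizer n) := hγ.subtype_mk _
  have := (isPreconnected_range hγ').subset_connectedComponent (x := (1 : realStabilizer n)) ⟨0, Subtype.ext h0⟩
  exact ⟨⟨γ 1, hmem 1⟩, this ⟨1, rfl⟩, h1⟩

/-- The group `H` acts transitively on `𝒳`. -/
theorem exists_smul_zero_eq {n : ℕ} {z : lieBall n} (hz : z ∈ lieBallReal n) :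
    ∃ g ∈ groupH n, g • (⟨0, zero_mem_lieBall n⟩ : lieBall n) = z := by
  set x : Fin n → ℝ := fun i => (z.1 i).re with hxd
  have hzx : ∀ i, z.1 i = x i := fun i =>
    (Complex.conj_eq_iff_re.1 (conj_of_mem_lieBallReal hz i)).symm
  have hx : x ⬝ᵥ x < 1 := by
    have h1 := z.2.2
    have h2 : ‖z.1‖ ^ 2 = x ⬝ᵥ x := by
      rw [EuclideanSpace.norm_sq_eq]
      exact Finset.sum_congr rfl fun i _ => by rw [hzx, norm_real, Real.norm_eq_abs, sq_abs, sq]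
    rw [← h2]
    nlinarith [norm_nonneg z.1]
  refine ⟨boost x hx, boost_mem_groupH hx, Subtype.ext (PiLp.ext fun k => ?_)⟩
  rw [(smul_apply_of_mem_groupG (boost_mem_groupG hx) _).1 k, factor, boost_mulVec, hzx]
  have hc : ((2 / (1 - x ⬝ᵥ x) : ℝ) : ℂ) ≠ 0 := by
    have : 1 - x ⬝ᵥ x ≠ 0 := by linarith
    exact ofReal_ne_zero.2 (div_ne_zero two_ne_zero this)
  generalize ((2 / (1 - x ⬝ᵥ x) : ℝ) : ℂ) = c at *
  have h0 : quadForm (0 : EuclideanSpace ℂ (Fin n)) = 0 := by simp [quadForm]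
  simp [isotropicLift, boostVec, h0]
  -- The lift of `0` is `(1/2, -i/2, 0)`. The reflected first coordinate contributes `-1/2` to the
  -- factor and the second `1/2`, so the factor is `c/2`, which cancels against the numerator `(c/2)
  -- x_k`.
  have e : I * (-I / 2) = 1 / 2 := by linear_combination (-1 / 2 : ℂ) * I_sq
  have e' : -2⁻¹ + c * 2⁻¹ + 1 / 2 = c * 2⁻¹ := by ring
  rw [e, e']
  field_simp

end RealStabilizer

/-! ### The complex derivative and the Jacobian of the action. -/

noncomputable section Jacobian
open Complex Matrix Filter Topology

theorem isOpen_lieBall (n : ℕ) : IsOpen (lieBall n) := by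
  have hq := continuous_quadForm (n := n)
  have h : Continuous fun z : EuclideanSpace ℂ (Fin n) => 1 - 2 * ‖z‖ ^ 2 + ‖quadForm z‖ ^ 2 := by
    fun_prop
  exact (isOpen_lt continuous_const h).inter (isOpen_lt continuous_norm continuous_const)

/-- The Lie ball is star-shaped about `0`. -/
theorem isPreconnected_lieBall (n : ℕ) : IsPreconnected (lieBall n) := by
  have h : StarConvex ℝ (0 : EuclideanSpace ℂ (Fin n)) (lieBall n) := by
    rw [starConvex_zero_iff]
    intro z hz t ht0 ht1
    have := smul_mem_lieBall_of_mem_Icc hz ⟨ht0, ht1⟩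
    rwa [Complex.coe_smul] at this
  exact (h.isPathConnected (zero_mem_lieBall n)).isConnected.isPreconnected

instance preconnectedSpace_lieBall (n : ℕ) : PreconnectedSpace (lieBall n) :=
  isPreconnected_iff_preconnectedSpace.1 (isPreconnected_lieBall n)

theorem transformation_apply {n : ℕ} (g : indefiniteSO n) (z : lieBall n) :
    transformation g z = (g • z).1 :=
  Subtype.val_injective.extend_apply _ _ _

theorem continuous_smul_lieBall {n : ℕ} {X : Type*} [TopologicalSpace X] {γ : X → indefiniteSO n}
    (hγ : Continuous γ) (hG : ∀ x, γ x ∈ groupG n) {w : X → lieBall n} (hw : Continuous w) :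
    Continuous fun x => γ x • w x := by
  rw [continuous_induced_rng, ← (PiLp.homeomorph 2 fun _ : Fin n => ℂ).comp_continuous_iff]
  refine continuous_pi fun k => ?_
  have hp : Continuous fun x => (γ x, (w x).1) := hγ.prodMk (continuous_subtype_val.comp hw)
  refine (((continuous_mulVec_isotropicLift (.inr k)).comp hp).div (continuous_factor.comp hp)
    fun x => factor_ne_zero (hG x) (w x).2).congr fun x => ?_
  exact ((smul_apply_of_mem_groupG (hG x) (w x)).1 k).symm

theorem continuous_smul_lieBall_right {n : ℕ} {g : indefiniteSO n} (hg : g ∈ groupG n) :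
    Continuous fun z : lieBall n => g • z :=
  continuous_smul_lieBall continuous_const (fun _ => hg) continuous_id

/-- The derivative of `isotropicLift` in the direction of the `i`-th coordinate. -/
def liftDeriv {n : ℕ} (z : EuclideanSpace ℂ (Fin n)) (i : Fin n) : Fin 2 ⊕ Fin n → ℂ :=
  Sum.elim ![z i, I * z i] (Pi.single i 1)

/-- The lift is a quadratic polynomial; its second order part along a coordinate line comes from the
`t²` in `q`. -/
theorem isotropicLift_add_smul_single {n : ℕ} (z : EuclideanSpace ℂ (Fin n)) (i : Fin n) (t : ℂ) :
    isotropicLift (z + t • EuclideanSpace.single i 1) = isotropicLift z + t • liftDeriv z i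
      + t ^ 2 • Sum.elim ![1 / 2, I / 2] 0 := by
  have hq : quadForm (z + t • EuclideanSpace.single i 1) = quadForm z + 2 * t * z i + t ^ 2 := by
    have : ∀ k, (z + t • EuclideanSpace.single i (1 : ℂ)) k ^ 2
        = z k ^ 2 + if k = i then 2 * t * z i + t ^ 2 else 0 := by
      intro k
      by_cases h : k = i
      · subst h; simp; ring
      · simp [h]
    simp only [quadForm, this, Finset.sum_add_distrib]
    simp
    ring
  ext j
  rcases j with j | j
  · fin_cases j
    · simp [isotropicLift, liftDeriv, hq]; ring
    · simp [isotropicLift, liftDeriv, hq]; ring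
  · by_cases h : j = i
    · subst h; simp [isotropicLift, liftDeriv]
    · simp [isotropicLift, liftDeriv, h]

theorem hasDerivAt_mulVec_isotropicLift {n : ℕ} (g : indefiniteSO n) (z : EuclideanSpace ℂ (Fin n))
    (i : Fin n) (j : Fin 2 ⊕ Fin n) :
    HasDerivAt (fun t : ℂ => (complexify g *ᵥ isotropicLift (z + t • EuclideanSpace.single i 1)) j)
      ((complexify g *ᵥ liftDeriv z i) j) 0 := by
  simp only [isotropicLift_add_smul_single, mulVec_add, mulVec_smul, Pi.add_apply, Pi.smul_apply,
    smul_eq_mul]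
  have h1 := (hasDerivAt_id (0 : ℂ)).mul_const ((complexify g *ᵥ liftDeriv z i) j)
  have h2 := (hasDerivAt_pow 2 (0 : ℂ)).mul_const
    ((complexify g *ᵥ Sum.elim ![1 / 2, I / 2] 0) j)
  refine ((h1.const_add ((complexify g *ᵥ isotropicLift z) j)).add h2).congr_deriv ?_
  simp

/-- The derivative of `factor g` in the direction of the `i`-th coordinate. -/
def factorDeriv {n : ℕ} (g : indefiniteSO n) (z : EuclideanSpace ℂ (Fin n)) (i : Fin n) : ℂ :=
  (complexify g *ᵥ liftDeriv z i) (.inl 0) + I * (complexify g *ᵥ liftDeriv z i) (.inl 1)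

/-- The matrix of the complex derivative of `g` at `z`. -/
def derivMatrix {n : ℕ} (g : indefiniteSO n) (z : EuclideanSpace ℂ (Fin n)) :
    Matrix (Fin n) (Fin n) ℂ :=
  Matrix.of fun k i => ((complexify g *ᵥ liftDeriv z i) (.inr k) * factor g z
    - (complexify g *ᵥ isotropicLift z) (.inr k) * factorDeriv g z i) / factor g z ^ 2

theorem differentiable_quadForm {n : ℕ} : Differentiable ℂ (quadForm (n := n)) := by
  unfold quadForm; fun_prop

theorem differentiable_isotropicLift {n : ℕ} (j : Fin 2 ⊕ Fin n) :
    Differentiable ℂ fun z : EuclideanSpace ℂ (Fin n) => isotropicLift z j := by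
  have := differentiable_quadForm (n := n)
  rcases j with j | j
  · fin_cases j
    · simp only [isotropicLift, Sum.elim_inl, Fin.zero_eta, cons_val_zero]; fun_prop
    · simp only [isotropicLift, Sum.elim_inl, Fin.mk_one, cons_val_one, cons_val_zero]; fun_prop
  · simp only [isotropicLift, Sum.elim_inr]; fun_prop

theorem differentiable_mulVec_isotropicLift {n : ℕ} (g : indefiniteSO n) (j : Fin 2 ⊕ Fin n) :
    Differentiable ℂ fun z : EuclideanSpace ℂ (Fin n) => (complexify g *ᵥ isotropicLift z) j := by
  have := differentiable_isotropicLift (n := n)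
  simp only [mulVec, dotProduct]
  fun_prop

theorem transformation_eventuallyEq {n : ℕ} {g : indefiniteSO n} (hg : g ∈ groupG n)
    (z : lieBall n) (k : Fin n) :
    (fun w => transformation g w k) =ᶠ[𝓝 z.1]
      fun w => (complexify g *ᵥ isotropicLift w) (.inr k) / factor g w := by
  filter_upwards [(isOpen_lieBall n).mem_nhds z.2] with w hw
  rw [transformation_apply g ⟨w, hw⟩]
  exact (smul_apply_of_mem_groupG hg ⟨w, hw⟩).1 k

theorem differentiableAt_transformation {n : ℕ} {g : indefiniteSO n} (hg : g ∈ groupG n)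
    (z : lieBall n) : DifferentiableAt ℂ (transformation g) z := by
  rw [differentiableAt_euclidean]
  intro k
  refine DifferentiableAt.congr_of_eventuallyEq ?_ (transformation_eventuallyEq hg z k)
  have hj : Differentiable ℂ fun z : EuclideanSpace ℂ (Fin n) => factor g z :=
    (differentiable_mulVec_isotropicLift g _).add
      ((differentiable_mulVec_isotropicLift g _).const_mul I)
  simp only [div_eq_mul_inv]
  exact (differentiable_mulVec_isotropicLift g _ _).mul ((hj _).inv (factor_ne_zero hg z.2))

/-- The quotient rule along the coordinate line through `z`, applied to the formula for `g • z` near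
`z`. -/
theorem fderiv_transformation_single {n : ℕ} {g : indefiniteSO n} (hg : g ∈ groupG n)
    (z : lieBall n) (k i : Fin n) :
    fderiv ℂ (transformation g) z (EuclideanSpace.single i 1) k = derivMatrix g z k i := by
  have hline : HasDerivAt (fun t : ℂ => z.1 + t • EuclideanSpace.single i (1 : ℂ))
      (EuclideanSpace.single i 1) 0 := by
    simpa using ((hasDerivAt_id (0 : ℂ)).smul_const (EuclideanSpace.single i (1 : ℂ))).const_add z.1
  have hz : z.1 + (0 : ℂ) • EuclideanSpace.single i (1 : ℂ) = z.1 := by simp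
  have hd := (differentiableAt_transformation hg z).hasFDerivAt
  rw [← hz] at hd
  have h1 := hd.comp_hasDerivAt 0 hline
  rw [hz] at h1
  have h1' := (EuclideanSpace.proj (𝕜 := ℂ) k).hasFDerivAt.comp_hasDerivAt 0 h1
  have hj : HasDerivAt (fun t : ℂ => factor g (z.1 + t • EuclideanSpace.single i 1))
      (factorDeriv g z i) 0 :=
    (hasDerivAt_mulVec_isotropicLift g z.1 i _).add
      ((hasDerivAt_mulVec_isotropicLift g z.1 i _).const_mul I)
  have h2 := (hasDerivAt_mulVec_isotropicLift g z.1 i (.inr k)).div hj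
    (by rw [hz]; exact factor_ne_zero hg z.2)
  simp only [zero_smul, add_zero] at h2
  have hev : (fun t : ℂ => transformation g (z.1 + t • EuclideanSpace.single i 1) k) =ᶠ[𝓝 0]
      fun t => (complexify g *ᵥ isotropicLift (z.1 + t • EuclideanSpace.single i 1)) (.inr k)
        / factor g (z.1 + t • EuclideanSpace.single i 1) := by
    have := transformation_eventuallyEq hg z k
    rw [← hz] at this
    exact hline.continuousAt.eventually this
  exact h1'.unique (h2.congr_of_eventuallyEq hev)

theorem jacobian_eq_det {n : ℕ} {g : indefiniteSO n} (hg : g ∈ groupG n) (z : lieBall n) :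
    jacobian g z = (derivMatrix g z).det := by
  rw [jacobian, ContinuousLinearMap.det,
    ← LinearMap.det_toMatrix (EuclideanSpace.basisFun (Fin n) ℂ).toBasis]
  congr 1
  ext k i
  rw [LinearMap.toMatrix_apply, ← fderiv_transformation_single hg]
  simp

theorem bilinForm_liftDeriv {n : ℕ} (z : EuclideanSpace ℂ (Fin n)) (i l : Fin n) :
    bilinForm (liftDeriv z i) (liftDeriv z l) = -(1 : Matrix (Fin n) (Fin n) ℂ) i l := by
  rw [bilinForm_eq]
  simp [liftDeriv, Matrix.one_apply, Pi.single_apply]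
  simp only [eq_comm (a := l)]
  linear_combination (z i * z l) * I_sq

theorem bilinForm_isotropicLift_liftDeriv {n : ℕ} (z : EuclideanSpace ℂ (Fin n)) (i : Fin n) :
    bilinForm (isotropicLift z) (liftDeriv z i) = 0 := by
  rw [bilinForm_eq]
  simp [liftDeriv, isotropicLift, Pi.single_apply]
  linear_combination ((quadForm z - 1) / 2 * z i) * I_sq

/-- Put `x = g λ(z)` and `y_i = g ∂_i λ(z)`. The vectors `j y_i - d_i x`, where `d_i` is
`factorDeriv`, satisfy `x₁ + i x₂ = 0`, so the first two coordinates do not contribute to their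
mutual products. As `(x|x) = (x|y_i) = 0` and `(y_i|y_l) = -δ_il`, the last `n` coordinates have
Euclidean products `j² δ_il`. Those coordinates are `j²` times the columns of the derivative. -/
theorem derivMatrix_transpose_mul {n : ℕ} {g : indefiniteSO n} {z : EuclideanSpace ℂ (Fin n)}
    (hj : factor g z ≠ 0) :
    factor g z ^ 2 • ((derivMatrix g z)ᵀ * derivMatrix g z) = 1 := by
  ext i l
  have h1 := bilinForm_mulVec g (liftDeriv z i) (liftDeriv z l)
  have h2 := bilinForm_mulVec g (isotropicLift z) (liftDeriv z i)
  have h3 := bilinForm_mulVec g (isotropicLift z) (liftDeriv z l)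
  have h4 := bilinForm_mulVec g (isotropicLift z) (isotropicLift z)
  have h5 : bilinForm (isotropicLift z) (isotropicLift z) = 0 := by
    have := bilinForm_isotropicLift z z
    rw [sub_self] at this
    simpa [quadForm] using this
  rw [bilinForm_liftDeriv, bilinForm_eq] at h1
  rw [bilinForm_isotropicLift_liftDeriv, bilinForm_eq] at h2 h3
  rw [h5, bilinForm_eq] at h4
  have hjd : factor g z = (complexify g *ᵥ isotropicLift z) (.inl 0)
    + I * (complexify g *ᵥ isotropicLift z) (.inl 1) := rfl
  have hdi : factorDeriv g z i = (complexify g *ᵥ liftDeriv z i) (.inl 0)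
    + I * (complexify g *ᵥ liftDeriv z i) (.inl 1) := rfl
  have hdl : factorDeriv g z l = (complexify g *ᵥ liftDeriv z l) (.inl 0)
    + I * (complexify g *ᵥ liftDeriv z l) (.inl 1) := rfl
  rw [Matrix.smul_apply, Matrix.mul_apply, smul_eq_mul]
  simp only [transpose_apply, derivMatrix, Matrix.of_apply]
  generalize factor g z = j at *
  generalize factorDeriv g z i = di at *
  generalize factorDeriv g z l = dl at *
  generalize complexify g *ᵥ isotropicLift z = x at *
  generalize complexify g *ᵥ liftDeriv z i = y at *
  generalize complexify g *ᵥ liftDeriv z l = w at *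
  have e : ∑ k, (y (.inr k) * j - x (.inr k) * di) / j ^ 2 * ((w (.inr k) * j - x (.inr k) * dl) / j ^ 2)
      = ((∑ k, y (.inr k) * w (.inr k)) * j ^ 2 - (∑ k, x (.inr k) * y (.inr k)) * (dl * j)
        - (∑ k, x (.inr k) * w (.inr k)) * (di * j) + (∑ k, x (.inr k) * x (.inr k)) * (di * dl))
        / j ^ 4 := by
    simp only [Finset.sum_mul, ← Finset.sum_sub_distrib, ← Finset.sum_add_distrib, Finset.sum_div]
    refine Finset.sum_congr rfl fun k _ => ?_
    field_simp
    ring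
  rw [e]
  have s1 : ∑ k, y (.inr k) * w (.inr k) = y (.inl 0) * w (.inl 0) + y (.inl 1) * w (.inl 1)
    + (1 : Matrix (Fin n) (Fin n) ℂ) i l := by linear_combination -h1
  have s2 : ∑ k, x (.inr k) * y (.inr k) = x (.inl 0) * y (.inl 0) + x (.inl 1) * y (.inl 1) := by
    linear_combination -h2
  have s3 : ∑ k, x (.inr k) * w (.inr k) = x (.inl 0) * w (.inl 0) + x (.inl 1) * w (.inl 1) := by
    linear_combination -h3
  have s4 : ∑ k, x (.inr k) * x (.inr k) = x (.inl 0) * x (.inl 0) + x (.inl 1) * x (.inl 1) := by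
    linear_combination -h4
  rw [s1, s2, s3, s4]
  generalize (1 : Matrix (Fin n) (Fin n) ℂ) i l = δ
  -- Eliminating the first coordinates through `j`, `d_i`, `d_l` turns the claim into a polynomial
  -- identity modulo `i² = -1`.
  have a0 : x (.inl 0) = j - I * x (.inl 1) := by linear_combination -hjd
  have b0 : y (.inl 0) = di - I * y (.inl 1) := by linear_combination -hdi
  have c0 : w (.inl 0) = dl - I * w (.inl 1) := by linear_combination -hdl
  rw [a0, b0, c0]
  field_simp
  ring_nf
  simp only [I_sq]
  ring

theorem continuous_mulVec_liftDeriv {n : ℕ} (i : Fin n) (j : Fin 2 ⊕ Fin n) :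
    Continuous fun p : indefiniteSO n × EuclideanSpace ℂ (Fin n) =>
      (complexify p.1 *ᵥ liftDeriv p.2 i) j := by
  simp only [mulVec, dotProduct]
  refine continuous_finsetSum _ fun l _ =>
    ((continuous_complexify_apply j l).comp continuous_fst).mul ?_
  rcases l with l | l
  · fin_cases l
    · simp only [liftDeriv, Sum.elim_inl, Fin.zero_eta, cons_val_zero]; fun_prop
    · simp only [liftDeriv, Sum.elim_inl, Fin.mk_one, cons_val_one, cons_val_zero]; fun_prop
  · exact continuous_const

theorem continuousOn_det_derivMatrix {n : ℕ} :
    ContinuousOn (fun p : indefiniteSO n × EuclideanSpace ℂ (Fin n) => (derivMatrix p.1 p.2).det)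
      (connectedComponent 1 ×ˢ lieBall n) := by
  simp only [Matrix.det_apply]
  refine continuousOn_finsetSum _ fun σ _ => ContinuousOn.const_smul ?_ _
  refine continuousOn_finsetProd _ fun i _ => ?_
  refine ContinuousOn.div (Continuous.continuousOn ?_) (continuous_factor.pow 2).continuousOn
    fun p hp => pow_ne_zero 2 (factor_ne_zero hp.1 hp.2)
  exact ((continuous_mulVec_liftDeriv _ _).mul continuous_factor).sub
    ((continuous_mulVec_isotropicLift _).mul ((continuous_mulVec_liftDeriv _ _).add
      (continuous_const.mul (continuous_mulVec_liftDeriv _ _))))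

/-- Determinants in the orthogonality relation give only the square. The sign is constant on the
connected set `G × 𝒟` and is `+` at `(1, 0)`. -/
theorem det_derivMatrix_mul_factor {n : ℕ} {g : indefiniteSO n} (hg : g ∈ groupG n)
    {z : EuclideanSpace ℂ (Fin n)} (hz : z ∈ lieBall n) :
    (derivMatrix g z).det * factor g z ^ n = 1 := by
  set s : Set (indefiniteSO n × EuclideanSpace ℂ (Fin n)) := connectedComponent 1 ×ˢ lieBall n
  set f : indefiniteSO n × EuclideanSpace ℂ (Fin n) → ℂ :=
    fun p => (derivMatrix p.1 p.2).det * factor p.1 p.2 ^ n with hf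
  have hsq : ∀ p ∈ s, f p = 1 ∨ f p = -1 := by
    intro p hp
    rw [← sq_eq_one_iff]
    have := congrArg Matrix.det (derivMatrix_transpose_mul (factor_ne_zero hp.1 hp.2))
    rw [det_smul, det_mul, det_transpose, det_one, Fintype.card_fin] at this
    rw [← this, hf]
    ring
  have hc : ContinuousOn (fun p => (f p).re) s :=
    Complex.continuous_re.comp_continuousOn
      (continuousOn_det_derivMatrix.mul (continuous_factor.pow n).continuousOn)
  have h1 : f (1, 0) = 1 := by
    have : derivMatrix (1 : indefiniteSO n) 0 = 1 := by
      ext k i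
      simp [derivMatrix, complexify_one, factor_one, liftDeriv, isotropicLift, Matrix.one_apply,
        Pi.single_apply]
    simp [hf, this, factor_one]
  have hpos := pos_of_isPreconnected
    (isPreconnected_connectedComponent.prod (isPreconnected_lieBall n)) hc
    (fun p hp h => by rcases hsq p hp with h' | h' <;> simp [h'] at h)
    (x₀ := (1, 0)) ⟨mem_connectedComponent, zero_mem_lieBall n⟩ (by simp [h1])
    (x := (g, z)) ⟨hg, hz⟩
  refine (hsq (g, z) ⟨hg, hz⟩).resolve_right fun h => ?_
  rw [h] at hpos
  norm_num at hpos

/-! ### Branches: the cocycle identities for logarithms. -/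

/-- The values lie in `2πiℤ`, so the zero set is also `{|Im f| < π}`; being closed and open, it is
everything. This upgrades each multiplicative identity to one between logarithms, from a single real
base point. -/
theorem eq_zero_of_exp_eq_one {X : Type*} [TopologicalSpace X] [PreconnectedSpace X] {f : X → ℂ}
    (hf : Continuous f) (hexp : ∀ x, cexp (f x) = 1) {x₀ : X} (h₀ : (f x₀).im = 0) (x : X) :
    f x = 0 := by
  have key : ∀ y, |(f y).im| < Real.pi → f y = 0 := by
    intro y hy
    rw [abs_lt] at hy
    rw [← Complex.log_exp hy.1 hy.2.le, hexp, Complex.log_one]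
  have hset : {y | f y = 0} = {y | |(f y).im| < Real.pi} := by
    ext y
    exact ⟨fun h => by
      have h : f y = 0 := h
      simp [h, Real.pi_pos], key y⟩
  have hclopen : IsClopen {y | f y = 0} := by
    refine ⟨isClosed_eq hf continuous_const, ?_⟩
    rw [hset]
    exact isOpen_lt (Complex.continuous_im.comp hf).abs continuous_const
  have := hclopen.eq_univ ⟨x₀, key x₀ (by rw [h₀, abs_zero]; exact Real.pi_pos)⟩
  exact (Set.ext_iff.1 this x).2 trivial

theorem continuous_log_factor {n : ℕ} (hn : 2 ≤ n) {g : indefiniteSO n} (hg : g ∈ groupH n) :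
    Continuous fun z : lieBall n => log (factor g z) :=
  ((continuous_factor.comp (Continuous.prodMk_right g)).comp continuous_subtype_val).clog
    fun z => factor_mem_slitPlane hn hg z

theorem log_factor_im_eq_zero {n : ℕ} (hn : 2 ≤ n) {g : indefiniteSO n} (hg : g ∈ groupH n)
    {z : lieBall n} (hz : z ∈ lieBallReal n) : (log (factor g z)).im = 0 := by
  rw [Complex.log_im, Complex.arg_eq_zero_iff]
  exact ⟨(factor_re_pos hn hg hz).le, factor_im_eq_zero hn (groupH_le_realStabilizer n hg) hz⟩

/-- Since `J_g = j^(-n)`, the function `-n log j` is a continuous logarithm of `J_g`. It is real at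
`0`, hence principal there, so it meets the specification of the chosen logarithm and is the only
function that does. -/
theorem logJacobian_eq {n : ℕ} (hn : 2 ≤ n) {g : indefiniteSO n} (hg : g ∈ groupH n)
    (z : lieBall n) : logJacobian g z = -n * log (factor g z) := by
  set l : lieBall n → ℂ := fun z => -n * log (factor g z) with hl
  have hexp : ∀ z, cexp (l z) = jacobian g z := by
    intro z
    have hj := factor_ne_zero (groupH_le_groupG n hg) z.2
    rw [jacobian_eq_det (groupH_le_groupG n hg),
      eq_inv_of_mul_eq_one_left (det_derivMatrix_mul_factor (groupH_le_groupG n hg) z.2), hl]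
    simp only [neg_mul]
    rw [Complex.exp_neg, Complex.exp_nat_mul, Complex.exp_log hj]
  have h0im : (l ⟨0, zero_mem_lieBall n⟩).im = 0 := by
    simp [hl, mul_im, log_factor_im_eq_zero hn hg (zero_mem_lieBallReal n)]
  have hspec : Continuous l ∧ (∀ z, cexp (l z) = jacobian g z) ∧
      l ⟨0, zero_mem_lieBall n⟩ = Complex.log (jacobian g ⟨0, zero_mem_lieBall n⟩) := by
    refine ⟨continuous_const.mul (continuous_log_factor hn hg), hexp, ?_⟩
    rw [← hexp, Complex.log_exp] <;> rw [h0im]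
    · linarith [Real.pi_pos]
    · exact Real.pi_pos.le
  obtain ⟨e1, e2, e3⟩ : Continuous (logJacobian g) ∧ (∀ z, cexp (logJacobian g z) = jacobian g z) ∧
      logJacobian g ⟨0, zero_mem_lieBall n⟩
        = Complex.log (jacobian g ⟨0, zero_mem_lieBall n⟩) :=
    Classical.epsilon_spec (p := fun l : lieBall n → ℂ =>
      Continuous l ∧ (∀ z, cexp (l z) = jacobian g z) ∧
      l ⟨0, zero_mem_lieBall n⟩ = Complex.log (jacobian g ⟨0, zero_mem_lieBall n⟩)) ⟨l, hspec⟩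
  have := eq_zero_of_exp_eq_one (f := fun z => logJacobian g z - l z) (e1.sub hspec.1)
    (fun z => by rw [Complex.exp_sub, e2, hexp, div_self]; rw [← hexp]; exact Complex.exp_ne_zero _)
    (x₀ := ⟨0, zero_mem_lieBall n⟩) (by rw [e3, hspec.2.2, sub_self, zero_im]) z
  exact sub_eq_zero.1 this

/-- The multiplier `J_g(z)^(ν/n)`, see `piNu_eq`. -/
def multiplier {n : ℕ} (ν : ℝ) (g : indefiniteSO n) (z : lieBall n) : ℂ :=
  cexp (-ν * log (factor g z))

theorem piNu_eq {n : ℕ} (hn : 2 ≤ n) (ν : ℝ) {g : indefiniteSO n} (hg : g ∈ groupH n)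
    (f : lieBall n → ℂ) (z : lieBall n) :
    piNu ν g f z = multiplier ν g⁻¹ z * f (g⁻¹ • z) := by
  rw [piNu, logJacobian_eq hn (inv_mem hg), multiplier]
  have : (n : ℂ) ≠ 0 := by
    have : n ≠ 0 := by omega
    exact_mod_cast this
  congr 2
  field_simp

/-- The logarithms in the cocycle rule for `j` add without a multiple of `2πi`: at `0` all three are
real, because `g'` keeps `0` inside `𝒳`. -/
theorem multiplier_mul {n : ℕ} (hn : 2 ≤ n) (ν : ℝ) {g g' : indefiniteSO n} (hg : g ∈ groupH n)
    (hg' : g' ∈ groupH n) (z : lieBall n) :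
    multiplier ν (g * g') z = multiplier ν g (g' • z) * multiplier ν g' z := by
  have hG := groupH_le_groupG n hg
  have hG' := groupH_le_groupG n hg'
  have h := eq_zero_of_exp_eq_one (x₀ := (⟨0, zero_mem_lieBall n⟩ : lieBall n))
    (f := fun z : lieBall n => log (factor (g * g') z) -
      (log (factor g (g' • z).1) + log (factor g' z)))
    ((continuous_log_factor hn (mul_mem hg hg')).sub
      (((continuous_log_factor hn hg).comp (continuous_smul_lieBall_right hG')).add
        (continuous_log_factor hn hg')))
    (fun z => by
      rw [Complex.exp_sub, Complex.exp_add, Complex.exp_log (factor_ne_zero hG (g' • z).2),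
        Complex.exp_log (factor_ne_zero hG' z.2),
        Complex.exp_log (factor_ne_zero (mul_mem hG hG') z.2), factor_mul g hG', div_self]
      exact mul_ne_zero (factor_ne_zero hG (g' • z).2) (factor_ne_zero hG' z.2))
    (by
      rw [sub_im, add_im, log_factor_im_eq_zero hn (mul_mem hg hg') (zero_mem_lieBallReal n),
        log_factor_im_eq_zero hn hg' (zero_mem_lieBallReal n), log_factor_im_eq_zero hn hg
          ((groupH_le_realStabilizer n hg').2 _ (zero_mem_lieBallReal n))]
      simp) z
  rw [multiplier, multiplier, multiplier, ← Complex.exp_add, sub_eq_zero.1 h]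
  congr 1
  ring

theorem multiplier_one {n : ℕ} (ν : ℝ) (z : lieBall n) : multiplier ν 1 z = 1 := by
  simp [multiplier, factor_one]

theorem multiplier_inv_smul {n : ℕ} (hn : 2 ≤ n) (ν : ℝ) {g : indefiniteSO n} (hg : g ∈ groupH n)
    (z : lieBall n) : multiplier ν g⁻¹ (g • z) * multiplier ν g z = 1 := by
  rw [← multiplier_mul hn ν (inv_mem hg) hg, inv_mul_cancel, multiplier_one]

/-- The transformation rule of `h` in logarithmic form on the connected space `𝒟 × 𝒟`; at `(0,0)`
every logarithm involved is real. -/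
theorem hPoly_cpow_smul {n : ℕ} (hn : 2 ≤ n) (ν : ℝ) {g : indefiniteSO n} (hg : g ∈ groupH n)
    (z w : lieBall n) :
    multiplier ν g z * conj (multiplier ν g w) * hPoly (g • z).1 (g • w).1 ^ (-(ν : ℂ))
      = hPoly z.1 w.1 ^ (-(ν : ℂ)) := by
  have hG := groupH_le_groupG n hg
  have hlh : Continuous fun p : lieBall n × lieBall n => log (hPoly p.1.1 p.2.1) :=
    (continuous_hPoly.comp (continuous_subtype_val.prodMap continuous_subtype_val)).clog
      fun p => hPoly_mem_slitPlane hn p.1.2 p.2.2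
  have him : ∀ {x y : lieBall n}, x ∈ lieBallReal n → y ∈ lieBallReal n →
      (log (hPoly x.1 y.1)).im = 0 := fun hx hy => by
    rw [Complex.log_im, Complex.arg_eq_zero_iff]
    exact ⟨(hPoly_re_pos_of_mem_lieBallReal hn hx hy).1.le,
      (hPoly_re_pos_of_mem_lieBallReal hn hx hy).2⟩
  have h0 := zero_mem_lieBallReal n
  have hg0 := (groupH_le_realStabilizer n hg).2 _ h0
  have hs := continuous_smul_lieBall_right hG
  have hl := continuous_log_factor hn hg
  have h := eq_zero_of_exp_eq_one
    (x₀ := ((⟨0, zero_mem_lieBall n⟩, ⟨0, zero_mem_lieBall n⟩) : lieBall n × lieBall n))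
    (f := fun p : lieBall n × lieBall n => log (hPoly p.1.1 p.2.1) -
      (log (hPoly (g • p.1).1 (g • p.2).1) +
        (log (factor g p.1) + conj (log (factor g p.2)))))
    (hlh.sub ((hlh.comp (hs.prodMap hs)).add ((hl.comp continuous_fst).add
      (Complex.continuous_conj.comp (hl.comp continuous_snd)))))
    (fun p => by
      have e1 := factor_ne_zero hG p.1.2
      have e2 := factor_ne_zero hG p.2.2
      have e3 := hPoly_ne_zero hn p.1.2 p.2.2
      have e4 := hPoly_ne_zero hn (g • p.1).2 (g • p.2).2
      rw [Complex.exp_sub, Complex.exp_add, Complex.exp_add, Complex.exp_conj, Complex.exp_log e1,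
        Complex.exp_log e2, Complex.exp_log e3, Complex.exp_log e4, hPoly_smul hG, div_self e3])
    (by
      simp only [sub_im, add_im, conj_im]
      rw [him h0 h0, him hg0 hg0, log_factor_im_eq_zero hn hg h0]
      simp) (z, w)
  have h' := sub_eq_zero.1 h
  simp only at h'
  rw [Complex.cpow_def_of_ne_zero (hPoly_ne_zero hn (g • z).2 (g • w).2),
    Complex.cpow_def_of_ne_zero (hPoly_ne_zero hn z.2 w.2), h', multiplier, multiplier,
    ← Complex.exp_conj, ← Complex.exp_add, ← Complex.exp_add]
  congr 1
  simp only [map_mul, map_neg, conj_ofReal]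
  ring

theorem continuous_multiplier_left {n : ℕ} (hn : 2 ≤ n) (ν : ℝ) (z : lieBall n) :
    Continuous fun g : groupH n => multiplier ν (g : indefiniteSO n) z := by
  refine Complex.continuous_exp.comp (continuous_const.mul (Continuous.clog ?_
    fun g => factor_mem_slitPlane hn g.2 z))
  exact (continuous_factor.comp (Continuous.prodMk_left z.1)).comp continuous_subtype_val

theorem continuous_smul_left {n : ℕ} (z : lieBall n) :
    Continuous fun g : groupH n => (g : indefiniteSO n) • z :=
  continuous_smul_lieBall continuous_subtype_val (fun g => groupH_le_groupG n g.2) continuous_const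

end Jacobian

/-! ### Operators determined by a Gram matrix. -/

section GramIsometry
open scoped InnerProductSpace

/-- The norm of a combination depends on the Gram matrix alone. So `v x ↦ w x` is well defined and
isometric on the span even if the `v x` are linearly dependent. -/
theorem norm_linearCombination_eq_of_inner_eq {𝕜 X H : Type*} [RCLike 𝕜] [NormedAddCommGroup H]
    [InnerProductSpace 𝕜 H] {v w : X → H} (h : ∀ x y, ⟪w x, w y⟫_𝕜 = ⟪v x, v y⟫_𝕜) (c : X →₀ 𝕜) :
    ‖Finsupp.linearCombination 𝕜 w c‖ = ‖Finsupp.linearCombination 𝕜 v c‖ := by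
  have e : ⟪Finsupp.linearCombination 𝕜 w c, Finsupp.linearCombination 𝕜 w c⟫_𝕜
      = ⟪Finsupp.linearCombination 𝕜 v c, Finsupp.linearCombination 𝕜 v c⟫_𝕜 := by
    simp only [Finsupp.linearCombination_apply, Finsupp.sum, sum_inner, inner_sum, inner_smul_left,
      inner_smul_right, h]
  rw [@norm_eq_sqrt_re_inner 𝕜, @norm_eq_sqrt_re_inner 𝕜, e]

/-- Two families with the same Gram matrix, the first of them total, are related by an isometry. -/
theorem exists_isometry_of_inner_eq {𝕜 X H : Type*} [RCLike 𝕜] [NormedAddCommGroup H]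
    [InnerProductSpace 𝕜 H] [CompleteSpace H] {v w : X → H}
    (hv : (Submodule.span 𝕜 (Set.range v)).topologicalClosure = ⊤)
    (h : ∀ x y, ⟪w x, w y⟫_𝕜 = ⟪v x, v y⟫_𝕜) :
    ∃ T : H →L[𝕜] H, ‖T‖ ≤ 1 ∧ ∀ x, T (v x) = w x := by
  have hd : DenseRange (Finsupp.linearCombination 𝕜 v) := by
    have h1 := Submodule.dense_iff_topologicalClosure_eq_top.2 hv
    rwa [← Finsupp.range_linearCombination, LinearMap.coe_range] at h1
  have hn : ∀ c, ‖Finsupp.linearCombination 𝕜 w c‖ ≤ 1 * ‖Finsupp.linearCombination 𝕜 v c‖ :=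
    fun c => by rw [one_mul, norm_linearCombination_eq_of_inner_eq h]
  refine ⟨(Finsupp.linearCombination 𝕜 w).extendOfNorm (Finsupp.linearCombination 𝕜 v),
    LinearMap.opNorm_extendOfNorm_le hd zero_le_one hn, fun x => ?_⟩
  have := LinearMap.extendOfNorm_eq hd ⟨1, hn⟩ (Finsupp.single x 1)
  simpa using this

end GramIsometry

/-! ### The unitary operators on `𝓗_ν`. -/

noncomputable section UnitaryRepresentation
open Complex Filter Topology
open scoped InnerProductSpace

variable {n : ℕ} [hn : Fact (2 < n)] {ν : ℝ} [Fact (ν ∈ wallachSet n)]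

variable (ν) in
/-- The kernel function `z ↦ h(z,w)^{-ν}` as an element of `𝓗_ν`. -/
def kernelVec (w : lieBall n) : HilbertNu n ν := RKHS.kerFun (HilbertNu n ν) w 1

theorem inner_kernelVec (w : lieBall n) (f : HilbertNu n ν) : ⟪kernelVec ν w, f⟫_ℂ = f w := by
  rw [kernelVec, RKHS.kerFun_inner]
  simp

theorem kernelVec_apply (w z : lieBall n) :
    (kernelVec ν w) z = hPoly z.1 w.1 ^ (-(ν : ℂ)) := by
  rw [kernelVec, RKHS.kerFun_apply, RKHS.OfKernel.kernel_ofKernel]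
  simp [lieBallKernel]

theorem inner_kernelVec_kernelVec (z w : lieBall n) :
    ⟪kernelVec ν z, kernelVec ν w⟫_ℂ = hPoly z.1 w.1 ^ (-(ν : ℂ)) := by
  rw [inner_kernelVec, kernelVec_apply]

variable (n ν) in
theorem span_kernelVec :
    (Submodule.span ℂ (Set.range (kernelVec (n := n) ν))).topologicalClosure = ⊤ := by
  rw [eq_top_iff, ← RKHS.kerFun_dense (HilbertNu n ν)]
  refine Submodule.topologicalClosure_mono (Submodule.span_le.2 ?_)
  rintro _ ⟨z, v, rfl⟩
  have : RKHS.kerFun (HilbertNu n ν) z v = v • kernelVec ν z := by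
    rw [kernelVec, ← map_smul, smul_eq_mul, mul_one]
  rw [this]
  exact Submodule.smul_mem _ _ (Submodule.subset_span ⟨z, rfl⟩)

variable (ν) in
/-- The weighted composition operator attached to `g ∈ H` is a contraction of `𝓗_ν`. -/
theorem exists_weighted_composition {g : indefiniteSO n} (hg : g ∈ groupH n) :
    ∃ S : HilbertNu n ν →L[ℂ] HilbertNu n ν, ‖S‖ ≤ 1 ∧
      ∀ f z, S f z = multiplier ν g z * f (g • z) := by
  obtain ⟨T, hT, hTK⟩ := exists_isometry_of_inner_eq (𝕜 := ℂ)
    (v := kernelVec (n := n) ν) (w := fun z => conj (multiplier ν g z) • kernelVec ν (g • z))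
    (span_kernelVec n ν) fun z w => by
      rw [inner_smul_left, inner_smul_right, inner_kernelVec_kernelVec, inner_kernelVec_kernelVec,
        ← hPoly_cpow_smul hn.out.le ν hg z w, conj_conj]
      ring
  -- The isometry `T` acts on kernel functions; pairing with `K_z` turns its adjoint into a weighted
  -- composition on values, `⟨K_z, T* f⟩ = ⟨T K_z, f⟩ = m(g,z) f(gz)`.
  refine ⟨T.adjoint, by rwa [LinearIsometryEquiv.norm_map], fun f z => ?_⟩
  rw [← inner_kernelVec, ContinuousLinearMap.adjoint_inner_right, hTK, inner_smul_left, conj_conj,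
    inner_kernelVec]

variable (ν) in
-- The weighted compositions for `g` and `g⁻¹` are mutually inverse contractions, hence both
-- isometric. The one for `g⁻¹` represents `g`.
theorem exists_unitary {g : indefiniteSO n} (hg : g ∈ groupH n) :
    ∃ U : HilbertNu n ν ≃ₗᵢ[ℂ] HilbertNu n ν,
      ∀ f z, U f z = multiplier ν g⁻¹ z * f (g⁻¹ • z) := by
  obtain ⟨S, hS, hSf⟩ := exists_weighted_composition ν hg
  obtain ⟨S', hS', hSf'⟩ := exists_weighted_composition ν (inv_mem hg)
  have h1 : ∀ f, S (S' f) = f := fun f => RKHS.ext fun z => by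
    rw [hSf, hSf', inv_smul_smul, ← mul_assoc, mul_comm (multiplier ν g z),
      multiplier_inv_smul hn.out.le ν hg, one_mul]
  have h2 : ∀ f, S' (S f) = f := fun f => RKHS.ext fun z => by
    have := multiplier_inv_smul hn.out.le ν (inv_mem hg) z
    rw [inv_inv] at this
    rw [hSf', hSf, smul_inv_smul, ← mul_assoc, mul_comm (multiplier ν g⁻¹ z), this, one_mul]
  have hle : ∀ {R : HilbertNu n ν →L[ℂ] HilbertNu n ν}, ‖R‖ ≤ 1 → ∀ f, ‖R f‖ ≤ ‖f‖ :=
    fun hR f => (ContinuousLinearMap.le_of_opNorm_le _ hR f).trans_eq (one_mul _)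
  refine ⟨⟨LinearEquiv.ofLinearMap S'.toLinearMap S.toLinearMap (LinearMap.ext h2)
    (LinearMap.ext h1), fun f => le_antisymm (hle hS' f) ?_⟩, hSf'⟩
  have := hle hS (S' f)
  rwa [h1] at this

/-- The squared distance of two kernel functions is a combination of values of the continuous
kernel. -/
theorem continuous_kernelVec : Continuous (kernelVec (n := n) ν) := by
  have hk : Continuous fun p : lieBall n × lieBall n => hPoly p.1.1 p.2.1 ^ (-(ν : ℂ)) :=
    (continuous_hPoly.comp (continuous_subtype_val.prodMap continuous_subtype_val)).cpow
      continuous_const fun p => hPoly_mem_slitPlane hn.out.le p.1.2 p.2.2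
  rw [continuous_iff_continuousAt]
  intro w
  rw [ContinuousAt, tendsto_iff_norm_sub_tendsto_zero]
  have hsq : Tendsto (fun z => ‖kernelVec ν z - kernelVec ν w‖ ^ 2) (𝓝 w) (𝓝 0) := by
    have e : ∀ z, ‖kernelVec ν z - kernelVec ν w‖ ^ 2 = (hPoly z.1 z.1 ^ (-(ν : ℂ))).re
        - 2 * (hPoly z.1 w.1 ^ (-(ν : ℂ))).re + (hPoly w.1 w.1 ^ (-(ν : ℂ))).re := fun z => by
      rw [@norm_sub_sq ℂ, @norm_sq_eq_re_inner ℂ _ _ _ _ (kernelVec ν z),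
        @norm_sq_eq_re_inner ℂ _ _ _ _ (kernelVec ν w), inner_kernelVec_kernelVec,
        inner_kernelVec_kernelVec, inner_kernelVec_kernelVec]
      rfl
    simp only [e]
    have hc : Continuous fun z : lieBall n => (hPoly z.1 z.1 ^ (-(ν : ℂ))).re
        - 2 * (hPoly z.1 w.1 ^ (-(ν : ℂ))).re + (hPoly w.1 w.1 ^ (-(ν : ℂ))).re :=
      ((Complex.continuous_re.comp (hk.comp (continuous_id.prodMk continuous_id))).sub
        (continuous_const.mul (Complex.continuous_re.comp
          (hk.comp (continuous_id.prodMk continuous_const))))).add continuous_const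
    refine (hc.tendsto w).trans_eq ?_
    congr 1
    ring
  have := hsq.sqrt
  simpa using this

/-- Apply the covariance of the kernel at the pair `g⁻¹z, w`; the multipliers at `z` cancel by the
cocycle rule. -/
theorem unitary_kernelVec {g : indefiniteSO n} (hg : g ∈ groupH n)
    {U : HilbertNu n ν ≃ₗᵢ[ℂ] HilbertNu n ν}
    (hU : ∀ f z, U f z = multiplier ν g⁻¹ z * f (g⁻¹ • z)) (w : lieBall n) :
    U (kernelVec ν w) = conj (multiplier ν g w) • kernelVec ν (g • w) := by
  refine RKHS.ext fun z => ?_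
  rw [hU, RKHS.coe_smul, Pi.smul_apply, kernelVec_apply, kernelVec_apply, smul_eq_mul,
    ← hPoly_cpow_smul hn.out.le ν hg, smul_inv_smul]
  have := multiplier_inv_smul hn.out.le ν (inv_mem hg) z
  rw [inv_inv] at this
  linear_combination (conj (multiplier ν g w) * hPoly z.1 (g • w).1 ^ (-(ν : ℂ))) * this

/-- A family of isometries that is strongly continuous on a total set is strongly continuous. -/
theorem continuous_isometry_apply {𝕜 X G H : Type*} [RCLike 𝕜] [NormedAddCommGroup H]
    [InnerProductSpace 𝕜 H] [TopologicalSpace G] (U : G → H ≃ₗᵢ[𝕜] H) {v : X → H}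
    (hv : (Submodule.span 𝕜 (Set.range v)).topologicalClosure = ⊤)
    (hU : ∀ x, Continuous fun g => U g (v x)) (f : H) : Continuous fun g => U g f := by
  have hspan : ∀ f ∈ Submodule.span 𝕜 (Set.range v), Continuous fun g => U g f := by
    intro f hf
    induction hf using Submodule.span_induction with
    | mem f hf => obtain ⟨x, rfl⟩ := hf; exact hU x
    | zero => simpa using continuous_const
    | add f f' _ _ h h' => simp only [map_add]; exact h.add h'
    | smul c f _ h => simp only [map_smul]; exact h.const_smul c
  have hd := Submodule.dense_iff_topologicalClosure_eq_top.2 hv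
  refine continuous_of_uniform_approx_of_continuous fun u hu => ?_
  obtain ⟨ε, hε, hεu⟩ := Metric.mem_uniformity_dist.1 hu
  obtain ⟨f', hf', hdist⟩ := Metric.dense_iff.1 hd f ε hε
  refine ⟨fun g => U g f', hspan f' hdist, fun g => hεu ?_⟩
  rw [(U g).dist_map, dist_comm]
  exact hf'

theorem norm_kernelVec_sq (z : lieBall n) :
    ‖kernelVec ν z‖ ^ 2 = (hPoly z.1 z.1 ^ (-(ν : ℂ))).re := by
  rw [@norm_sq_eq_re_inner ℂ, inner_kernelVec_kernelVec]
  rfl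

/-! ### Holomorphy, and uniqueness from values on `𝒳`. -/

/-- The elements of `𝓗_ν` are holomorphic along complex lines. -/
theorem differentiableOn_line (f : HilbertNu n ν) (a b : EuclideanSpace ℂ (Fin n)) :
    DifferentiableOn ℂ (fun s : ℂ => Function.extend Subtype.val f 0 (a + s • b))
      {s | a + s • b ∈ lieBall n} := by
  set S : Set ℂ := {s | a + s • b ∈ lieBall n} with hS
  have hline : Continuous fun s : ℂ => a + s • b := by fun_prop
  have hSo : IsOpen S := (isOpen_lieBall n).preimage hline
  have hext : ∀ (f : HilbertNu n ν) {s : ℂ} (hs : s ∈ S),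
      Function.extend Subtype.val f 0 (a + s • b) = f ⟨a + s • b, hs⟩ := fun f s hs =>
    Subtype.val_injective.extend_apply f 0 ⟨a + s • b, hs⟩
  have hspan : ∀ f ∈ Submodule.span ℂ (Set.range (kernelVec (n := n) ν)),
      DifferentiableOn ℂ (fun s : ℂ => Function.extend Subtype.val f 0 (a + s • b)) S := by
    intro f hf
    induction hf using Submodule.span_induction with
    | mem f hf =>
      obtain ⟨w, rfl⟩ := hf
      have h1 : DifferentiableOn ℂ (fun s : ℂ => hPoly (a + s • b) w.1 ^ (-(ν : ℂ))) S := by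
        have hd : Differentiable ℂ fun s : ℂ => hPoly (a + s • b) w.1 := by
          unfold hPoly quadForm
          simp only [PiLp.add_apply, PiLp.smul_apply]
          fun_prop
        intro s hs
        exact ((hd s).cpow_const (hPoly_mem_slitPlane hn.out.le hs w.2)).differentiableWithinAt
      refine h1.congr fun s hs => ?_
      rw [hext _ hs, kernelVec_apply]
    | zero =>
      refine (differentiableOn_const 0).congr fun s hs => ?_
      rw [hext _ hs, RKHS.coe_zero, Pi.zero_apply]
    | add f f' _ _ h h' =>
      refine (h.add h').congr fun s hs => ?_
      rw [hext _ hs, RKHS.coe_add, Pi.add_apply, Pi.add_apply, hext _ hs, hext _ hs]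
    | smul c f _ h =>
      refine (h.const_smul c).congr fun s hs => ?_
      rw [hext _ hs, RKHS.coe_smul, Pi.smul_apply, Pi.smul_apply, hext _ hs]
  have hd := Submodule.dense_iff_topologicalClosure_eq_top.2 (span_kernelVec n ν)
  -- Approximation by combinations of kernel functions. By `|F_k(z) - f(z)| ≤ ‖K_z‖ ‖F_k - f‖`,
  -- convergence is uniform wherever `‖K_z‖² = h(z,z)^(-ν)` is bounded.
  obtain ⟨F, hF, hFf⟩ := mem_closure_iff_seq_limit.1 (hd f)
  refine TendstoLocallyUniformlyOn.differentiableOn (φ := atTop)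
    (F := fun k (s : ℂ) => Function.extend Subtype.val (F k) 0 (a + s • b)) ?_
    (Eventually.of_forall fun k => hspan _ (hF k)) hSo
  rw [Metric.tendstoLocallyUniformlyOn_iff]
  intro ε hε s hs
  have hc : ContinuousAt (fun s : ℂ => (hPoly (a + s • b) (a + s • b) ^ (-(ν : ℂ))).re) s :=
    Complex.continuous_re.continuousAt.comp
      (ContinuousAt.cpow (continuous_hPoly.comp (hline.prodMk hline)).continuousAt
        continuousAt_const (hPoly_mem_slitPlane hn.out.le hs hs))
  -- The summand `1` leaves room for the bound to hold on a whole neighbourhood of `s`, by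
  -- continuity of `h(z,z)^(-ν)`.
  set C := (hPoly (a + s • b) (a + s • b) ^ (-(ν : ℂ))).re + 1 with hC
  have hC0 : 0 < C := by
    have := sq_nonneg ‖kernelVec ν (⟨a + s • b, hs⟩ : lieBall n)‖
    rw [norm_kernelVec_sq] at this
    linarith
  refine ⟨S ∩ {s | (hPoly (a + s • b) (a + s • b) ^ (-(ν : ℂ))).re < C},
    inter_mem self_mem_nhdsWithin (mem_nhdsWithin_of_mem_nhds
      (hc.eventually_lt continuousAt_const (by rw [hC]; linarith))), ?_⟩
  have hlim := tendsto_iff_norm_sub_tendsto_zero.1 hFf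
  have hpos : 0 < ε / √C := div_pos hε (Real.sqrt_pos.2 hC0)
  filter_upwards [hlim.eventually_lt_const hpos] with k hk t ht
  rw [hext _ ht.1, hext _ ht.1, dist_eq_norm', ← inner_kernelVec, ← inner_kernelVec, ← inner_sub_right]
  refine (norm_inner_le_norm _ _).trans_lt ?_
  have hK : ‖kernelVec ν (⟨a + t • b, ht.1⟩ : lieBall n)‖ ≤ √C := by
    refine Real.le_sqrt_of_sq_le ?_
    rw [norm_kernelVec_sq]
    exact ht.2.le
  calc _ ≤ √C * ‖F k - f‖ := by gcongr
    _ < √C * (ε / √C) := by gcongr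
    _ = ε := by field_simp

/-- An element of `𝓗_ν` that vanishes on `𝒳` is zero. -/
theorem eq_zero_of_eqOn_lieBallReal {f : HilbertNu n ν} (hf : ∀ z ∈ lieBallReal n, f z = 0) :
    f = 0 := by
  set E : EuclideanSpace ℂ (Fin n) → ℂ := Function.extend Subtype.val f 0 with hE
  have hEval : ∀ z : lieBall n, E z.1 = f z := fun z => Subtype.val_injective.extend_apply f 0 z
  -- Write `z = a + ib` with `a, b` real. On the line `s ↦ a + sb` the function vanishes at real `s`
  -- near `0`, hence also at `s = i`. The bound `1/2` provides a ball inside `𝒟`, so the relevant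
  -- set of `s` is convex and contains both `0` and `i`.
  have hsmall : ∀ z : EuclideanSpace ℂ (Fin n), ‖z‖ < 1 / 2 → E z = 0 := by
    intro z hz
    set a : EuclideanSpace ℂ (Fin n) := WithLp.toLp 2 fun i => ((z i).re : ℂ) with ha
    set b : EuclideanSpace ℂ (Fin n) := WithLp.toLp 2 fun i => ((z i).im : ℂ) with hb
    have hzab : z = a + I • b := by
      ext i
      simp only [ha, hb, PiLp.add_apply, PiLp.smul_apply, smul_eq_mul]
      rw [mul_comm, Complex.re_add_im]
    have hna : ‖a‖ ≤ ‖z‖ := by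
      rw [← sq_le_sq₀ (norm_nonneg _) (norm_nonneg _), EuclideanSpace.norm_sq_eq,
        EuclideanSpace.norm_sq_eq]
      refine Finset.sum_le_sum fun i _ => pow_le_pow_left₀ (norm_nonneg _) ?_ 2
      simp only [ha, norm_real, Real.norm_eq_abs]
      exact Complex.abs_re_le_norm _
    have hline : Continuous fun s : ℂ => a + s • b := by fun_prop
    set S : Set ℂ := {s | ‖a + s • b‖ < 1 / 2} with hS
    have hSo : IsOpen S := isOpen_lt hline.norm continuous_const
    have hSc : IsPreconnected S := by
      refine Convex.isPreconnected fun s hs t ht p q hp hq hpq => ?_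
      have e : a + (p • s + q • t) • b = p • (a + s • b) + q • (a + t • b) := by
        rw [smul_add, smul_add, add_add_add_comm, ← add_smul, hpq, one_smul, add_smul,
          smul_assoc, smul_assoc]
      have := convex_ball (0 : EuclideanSpace ℂ (Fin n)) (1 / 2)
        (mem_ball_zero_iff.2 hs) (mem_ball_zero_iff.2 ht) hp hq hpq
      rw [← e, mem_ball_zero_iff] at this
      exact this
    have hSD : ∀ s ∈ S, a + s • b ∈ lieBall n := fun s hs => by
      have hs : ‖a + s • b‖ < 1 / 2 := hs
      exact mem_lieBall_of_norm (by nlinarith [norm_nonneg (a + s • b)])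
    have h0 : (0 : ℂ) ∈ S := by
      change ‖a + (0 : ℂ) • b‖ < 1 / 2
      rw [zero_smul, add_zero]
      exact hna.trans_lt hz
    have hI : I ∈ S := by
      change ‖a + I • b‖ < 1 / 2
      rwa [← hzab]
    have han := ((differentiableOn_line f a b).mono hSD).analyticOnNhd hSo
    have hreal : ∀ t : ℝ, (t : ℂ) ∈ S → E (a + (t : ℂ) • b) = 0 := by
      intro t ht
      rw [hEval ⟨_, hSD _ ht⟩]
      refine hf _ fun i => ?_
      simp [ha, hb]
    have hlim : Tendsto (fun t : ℝ => (t : ℂ)) (𝓝[≠] 0) (𝓝[≠] 0) := by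
      refine tendsto_nhdsWithin_of_tendsto_nhds_of_eventually_within _ ?_ ?_
      · have := (Complex.continuous_ofReal.tendsto 0).mono_left
          (nhdsWithin_le_nhds (s := {(0 : ℝ)}ᶜ))
        rwa [ofReal_zero] at this
      · filter_upwards [self_mem_nhdsWithin] with t ht
        exact ofReal_ne_zero.2 ht
    have hev : ∀ᶠ t : ℝ in 𝓝[≠] 0, E (a + (t : ℂ) • b) = 0 := by
      filter_upwards [hlim.eventually (mem_nhdsWithin_of_mem_nhds (hSo.mem_nhds h0))] with t ht
      exact hreal t ht
    have := han.eqOn_zero_of_preconnected_of_frequently_eq_zero hSc h0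
      (hlim.frequently hev.frequently) hI
    rw [hzab]
    exact this
  refine RKHS.ext fun z => ?_
  rw [RKHS.coe_zero, Pi.zero_apply, ← hEval]
  -- From the small ball to an arbitrary `z`: along the line through `0` and `z` the function
  -- vanishes near `s = 0`, and the domain is star-shaped and contains `1`. The summand `0` matches
  -- the form of `differentiableOn_line`.
  set S : Set ℂ := {s | 0 + s • z.1 ∈ lieBall n} with hS
  have hline : Continuous fun s : ℂ => 0 + s • z.1 := by fun_prop
  have hSo : IsOpen S := (isOpen_lieBall n).preimage hline
  have h0 : (0 : ℂ) ∈ S := by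
    change 0 + (0 : ℂ) • z.1 ∈ lieBall n
    rw [zero_smul, add_zero]
    exact zero_mem_lieBall n
  have h1 : (1 : ℂ) ∈ S := by
    change 0 + (1 : ℂ) • z.1 ∈ lieBall n
    rw [one_smul, zero_add]
    exact z.2
  have hSc : IsPreconnected S := by
    have h : StarConvex ℝ (0 : ℂ) S := by
      rw [starConvex_zero_iff]
      intro s hs t ht0 ht1
      have hs : 0 + s • z.1 ∈ lieBall n := hs
      rw [zero_add] at hs
      have := smul_mem_lieBall_of_mem_Icc hs ⟨ht0, ht1⟩
      change 0 + (t • s) • z.1 ∈ lieBall n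
      rwa [zero_add, smul_assoc, ← Complex.coe_smul]
    exact (h.isPathConnected h0).isConnected.isPreconnected
  have han := (differentiableOn_line f 0 z.1).analyticOnNhd hSo
  have hev : (fun s : ℂ => E (0 + s • z.1)) =ᶠ[𝓝 0] 0 := by
    have : ∀ᶠ s : ℂ in 𝓝 0, ‖0 + s • z.1‖ < 1 / 2 :=
      hline.norm.continuousAt.eventually_lt continuousAt_const (by simp)
    filter_upwards [this] with s hs
    exact hsmall _ hs
  have : E (0 + (1 : ℂ) • z.1) = 0 :=
    han.eqOn_zero_of_preconnected_of_eventuallyEq_zero hSc h0 hev h1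
  rwa [zero_add, one_smul] at this

end UnitaryRepresentation

/-! ### Assembly: the representation, its `L`-invariant vector and cyclicity. -/

theorem mainTheorem9 (n : ℕ) [Fact (2 < n)] (ν : ℝ) [Fact (ν ∈ wallachSet n)] :
    ∃ one : HilbertNu n ν, (∀ z : lieBall n, one z = 1) ∧
      ∃ π : groupH n →* (HilbertNu n ν ≃ₗᵢ[ℂ] HilbertNu n ν),
        (∀ (h : groupH n) (f : HilbertNu n ν) (z : lieBall n), π h f z = piNu ν h f z) ∧
        (∀ f : HilbertNu n ν, Continuous fun h : groupH n => π h f) ∧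
        (∀ l : groupH n, (l : indefiniteSO n) ∈ groupL n → π l one = one) ∧
        (Submodule.span ℂ (Set.range fun h : groupH n => π h one)).topologicalClosure = ⊤ := by
  have hn : 2 ≤ n := (Fact.out : 2 < n).le
  set o : lieBall n := ⟨0, zero_mem_lieBall n⟩ with ho
  choose U hU using fun g : groupH n => exists_unitary (n := n) ν g.2
  have hker : ∀ (g : groupH n) (w : lieBall n), U g (kernelVec ν w)
      = conj (multiplier ν (g : indefiniteSO n) w) • kernelVec ν ((g : indefiniteSO n) • w) :=
    fun g w => unitary_kernelVec g.2 (hU g) w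
  have hone : ∀ z : lieBall n, (kernelVec ν o) z = 1 := fun z => by
    rw [kernelVec_apply]
    simp [ho, hPoly, quadForm]
  let π : groupH n →* (HilbertNu n ν ≃ₗᵢ[ℂ] HilbertNu n ν) := MonoidHom.mk' U fun g g' => by
    refine LinearIsometryEquiv.ext fun f => RKHS.ext fun z => ?_
    change U (g * g') f z = U g (U g' f) z
    rw [hU, hU, hU]
    simp only [Subgroup.coe_mul, mul_inv_rev, mul_smul]
    rw [multiplier_mul hn ν (inv_mem g'.2) (inv_mem g.2)]
    ring
  refine ⟨kernelVec ν o, hone, π, fun g f z => ?_, fun f => ?_, fun l hl => ?_, ?_⟩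
  · rw [piNu_eq hn ν g.2]
    exact hU g f z
  -- On kernel functions the operator is `conj m(g,w) K_{gw}`, which is continuous in `g`.
  · refine continuous_isometry_apply U (span_kernelVec n ν) (fun w => ?_) f
    simp only [hker]
    exact (Complex.continuous_conj.comp (continuous_multiplier_left hn ν w)).smul
      (continuous_kernelVec.comp (continuous_smul_left w))
  · have hfix : (l : indefiniteSO n) • o = o := hl.2.2
    -- As `l` fixes `0` and `h(0,0) = 1`, the transformation rule gives `|j(l,0)|² = 1`; being real
    -- and positive, `j(l,0)` is `1`.
    have hm : multiplier ν (l : indefiniteSO n) o = 1 := by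
      have hre := factor_re_pos hn l.2 (zero_mem_lieBallReal n)
      have him := factor_im_eq_zero hn (groupH_le_realStabilizer n l.2) (zero_mem_lieBallReal n)
      have h := hPoly_smul (groupH_le_groupG n l.2) o o
      have h00 : hPoly o.1 o.1 = 1 := by simp [ho, hPoly, quadForm]
      rw [hfix, h00, one_mul, Complex.mul_conj, Complex.normSq_apply, him, mul_zero, add_zero] at h
      norm_cast at h
      have h1 : factor (l : indefiniteSO n) o = 1 :=
        Complex.ext (by rw [Complex.one_re]; nlinarith) him
      rw [multiplier, h1, Complex.log_one, mul_zero, Complex.exp_zero]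
    change U l (kernelVec ν o) = kernelVec ν o
    rw [hker, hfix, hm, map_one, one_smul]
  -- It suffices that a vector `f` orthogonal to the orbit of `1` vanishes. Orthogonality to `π(g)1`
  -- reads `m(g,0) f(g0) = 0` with a nonvanishing multiplier, and `g0` runs through `𝒳`.
  · rw [← Submodule.orthogonal_eq_bot_iff, Submodule.eq_bot_iff]
    intro f hf
    refine eq_zero_of_eqOn_lieBallReal fun z hz => ?_
    obtain ⟨g, hg, rfl⟩ := exists_smul_zero_eq hz
    have h := (Submodule.mem_orthogonal _ f).1 hf (U ⟨g, hg⟩ (kernelVec ν o))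
      (Submodule.le_topologicalClosure _ (Submodule.subset_span ⟨⟨g, hg⟩, rfl⟩))
    rw [hker, inner_smul_left, inner_kernelVec, Complex.conj_conj] at h
    exact (mul_eq_zero.1 h).resolve_left (Complex.exp_ne_zero _)
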